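/- Let $\mathbb K$ be a field, let $H=\mathcal O(\mathbb T^n)$ be the Hopf algebra with basis of group-like elements $t_{\mathbf m}$, $\mathbf m\in\mathbb Z^n$, with $t_{\mathbf m}t_{\mathbf m'}=t_{\mathbf m+\mathbf m'}$, and let $R:H\otimes H\to\mathbb K$ be a cotriangular structure on $H$. Left $H$-comodules (with coaction $v\mapsto v_{(-1)}\otimes v_{(0)}$) form a symmetric monoidal category with braiding $\tau(v\otimes w)=R(w_{(-1)}\otimes v_{(-1)})\,w_{(0)}\otimes v_{(0)}$. Write $V^{\mathbf m}$ for the elements $v$ of $V$ with coaction $t_{\mathbf m}\otimes v$; in particular $V^{\mathbf 0}$ is the space of coinvariants. Let ${}^H\mathscr A$ be the category of algebra objects $A$ in comodules whose product satisfies $\mu_A\circ\tau=\mu_A$, with equivariant algebra maps. The free algebra $F_{\mathbf m_1,\dots,\mathbf m_N}$ is generated by $x_i$ of weight $\mathbf m_i$ with relations $x_ix_j=R(t_{\mathbf m_j}\otimes t_{\mathbf m_i})\,x_jx_i$; an object $A$ is finitely presented if $A\cong F_{\mathbf m_1,\dots,\mathbf m_N}/(f_1,\dots,f_M)$ with homogeneous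 $f_k$. The coproduct $A\sqcup B$ in ${}^H\mathscr A$ is $A\otimes B$ with $(a\otimes b)(a'\otimes b')=R(a'_{(-1)}\otimes b_{(-1)})\,aa'_{(0)}\otimes b_{(0)}b'$. Let ${}^H\mathscr S$ be the opposite of the category of finitely presented algebras, with objects $X_A$, equipped with the Grothendieck topology generated by the finite families $\{X_{A[s_i^{-1}]}\to X_A\}$ with $s_i\in A^{\mathbf 0}$ and $\sum_i a_is_i=1$ for some $a_i\in A$, and let ${}^H\mathscr G$ be its topos of sheaves. The line object $\underline{\mathbb K}=\mathrm{Hom}(-,X_{F_{\mathbf 0}})$, $\underline{\mathbb K}(X_B)\cong B^{\mathbf 0}$, is a ring object. Let $A=F_{\mathbf m_1,\dots,\mathbf m_N}/(f_k)$ be finitely presented. - Let $\partial_j$ be the linear maps on $F_{\mathbf m_1,\dots,\mathbf m_N}$ with $\partial_jx_i=\delta_{ij}$ and $\partial_j(aa')=\partial_j(a)\,a'+R(a_{(-1)}\otimes t_{-\mathbf m_j})\,a_{(0)}\,\partial_j(a')$. The comodule of braided derivations is $$\mathrm{der}(A)=\Big\{L\in\coprod_{j}A[-\mathbf m_j]\;:\;\sum_jL_j\,\partial_j(f_k)=0\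 \text{ for all }k\Big\},$$ where $A[-\mathbf m]$ is $A$ with coaction $a\mapsto a_{(-1)}t_{-\mathbf m}\otimes a_{(0)}$. It acts on $A$ by $\mathrm{ev}(L\otimes a)=\sum_jL_j\,\partial_j(a)$. - For a comodule $V$ let $j(V)$ be the functor $X_B\mapsto(B\otimes V)^{\mathbf 0}$, with $B^{\mathbf 0}$-module structure $b\cdot(b'\otimes v)=bb'\otimes v$. - Let ${}^H\mathrm{Der}(A,-\sqcup A)$ be the functor that sends $X_B$ to the set ${}^H\mathrm{Der}(A,B\sqcup A)$ of equivariant linear maps $v:A\to B\sqcup A$ with $v(aa')=v(a)(1\otimes a')+(1\otimes a)v(a')$, with $B^{\mathbf 0}$-module structure $(b\cdot v)(a)=(b\otimes1)\,v(a)$. On a morphism $f$ it is $v\mapsto(f^*\otimes\mathrm{id})\circ v$. - Let $\xi$ be the natural map with components $\xi_{X_B}:(B\otimes\mathrm{der}(A))^{\mathbf 0}\to{}^H\mathrm{Der}(A,B\sqcup A)$, $\xi_{X_B}(b\otimes L)(a)=b\otimes\mathrm{ev}(L\otimes a)$. - Let $\mathrm{Aut}(X_A)\subseteq X_A^{X_A}$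 be the object of invertible elements of the monoid of internal endomorphisms of $X_A$. Let $D=X_{F_{\mathbf 0}/(x^2)}$, let $\pi:\mathrm{Aut}(X_A)^D\to\mathrm{Aut}(X_A)$ be restriction along the point $x\mapsto0$ of $D$, and let $T_e\mathrm{Aut}(X_A)$ be the fibre of $\pi$ over the identity $e$. **Theorem.** 1. $\underline{\mathbb K}$, $j(\mathrm{der}(A))$ and ${}^H\mathrm{Der}(A,-\sqcup A)$ are sheaves, and $\xi:j(\mathrm{der}(A))\to{}^H\mathrm{Der}(A,-\sqcup A)$ is an isomorphism of $\underline{\mathbb K}$-module objects in ${}^H\mathscr G$. 2. There is a natural isomorphism $T_e\mathrm{Aut}(X_A)\cong{}^H\mathrm{Der}(A,-\sqcup A)$ of presheaves, and hence of sheaves, of sets, given by $g\mapsto g_1$. Here $g\in T_e\mathrm{Aut}(X_A)(X_B)$ corresponds to the algebra map $A\to F_{\mathbf 0}/(x^2)\sqcup B\sqcup A$, $a\mapsto1\otimes1_B\otimes a+x\otimes g_1(a)$. Equivalently, on points $f:X_E\to X_B$, $d:X_E\to D$, $h:X_{E'}\to X_E$ and $y:X_{E'}\to X_A$, one has $$\big(g(f,d)(h,y)\big)^*(a)=y^*(a)+h^*(d^*(x))\cdot\mu_{E'}\big((fh)^*\otimes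 y^*\big)(g_1(a)).$$ So braided derivations of $A$ and ${}^H\mathrm{Der}(A,-\sqcup A)$ are equivalent descriptions of the infinitesimal automorphisms of $X_A$. -/

import Mathlib

open scoped TensorProduct
open CategoryTheory

universe u

noncomputable section

namespace Toric

/-! ### The torus Hopf algebra and its comodules -/

/-- The weight lattice `ℤⁿ`. -/
abbrev Wt (n : ℕ) : Type := Fin n → ℤ

/-- The Hopf algebra `H = O(𝕋ⁿ)`: the group algebra of `ℤⁿ`, with Mathlib's Hopf structure,
in which every basis element `t m` is group-like. -/
abbrev TorusHopf (K : Type u) [Field K] (n : ℕ) : Type u := AddMonoidAlgebra K (Wt n)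

/-- The basis elements `t_m` of `H`. -/
def t (K : Type u) [Field K] {n : ℕ} (m : Wt n) : TorusHopf K n := AddMonoidAlgebra.single m 1

/-- Left `H`-comodules. -/
class Comod (K : Type u) [Field K] (n : ℕ) (V : Type u) [AddCommGroup V] [Module K V] where
  /-- the coaction `ρ : V → H ⊗ V` -/
  coact : V →ₗ[K] TorusHopf K n ⊗[K] V
  /-- `(id ⊗ ρ) ∘ ρ = (Δ ⊗ id) ∘ ρ` -/
  coassoc : (coact.lTensor (TorusHopf K n)) ∘ₗ coact =
    (TensorProduct.assoc K (TorusHopf K n) (TorusHopf K n) V).toLinearMap ∘ₗ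
      (Coalgebra.comul (R := K) (A := TorusHopf K n)).rTensor V ∘ₗ coact
  /-- `(ε ⊗ id) ∘ ρ = id` -/
  counit : (TensorProduct.lid K V).toLinearMap ∘ₗ
    (Coalgebra.counit (R := K) (A := TorusHopf K n)).rTensor V ∘ₗ coact = LinearMap.id

section Comodules

variable {K : Type u} [Field K] {n : ℕ}

/-- The coaction of a comodule. -/
abbrev coact (V : Type u) [AddCommGroup V] [Module K V] [Comod K n V] :
    V →ₗ[K] TorusHopf K n ⊗[K] V := Comod.coact

/-- `v` is homogeneous of weight `m`, i.e. `ρ v = t_m ⊗ v`; so `v ∈ V^m`. -/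
def IsHomog {V : Type u} [AddCommGroup V] [Module K V] [Comod K n V] (m : Wt n) (v : V) : Prop :=
  coact (K := K) (n := n) V v = t K m ⊗ₜ v

/-- The subspace `V^0` of coinvariants. -/
def coinv (K : Type u) [Field K] (n : ℕ) (V : Type u) [AddCommGroup V] [Module K V]
    [Comod K n V] : Submodule K V where
  carrier := {v | IsHomog (K := K) (n := n) 0 v}
  add_mem' {a b} ha hb := by
    simp only [Set.mem_ofPred_eq, IsHomog, map_add, TensorProduct.tmul_add] at *; rw [ha, hb]
  zero_mem' := by simp [IsHomog]
  smul_mem' c a ha := by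
    simp only [Set.mem_ofPred_eq, IsHomog, map_smul, TensorProduct.tmul_smul] at *; rw [ha]

/-- `L : V → W` is a morphism of comodules. -/
def IsEquivariant {V W : Type u} [AddCommGroup V] [Module K V] [Comod K n V]
    [AddCommGroup W] [Module K W] [Comod K n W] (L : V →ₗ[K] W) : Prop :=
  (L.lTensor (TorusHopf K n)) ∘ₗ coact (K := K) (n := n) V = coact (K := K) (n := n) W ∘ₗ L

variable {V W : Type u} [AddCommGroup V] [Module K V] [AddCommGroup W] [Module K W]

lemma t_mul (m p : Wt n) : t K m * t K p = t K (m + p) := by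
  simp [t, AddMonoidAlgebra.single_mul_single]

lemma t_zero : t K (0 : Wt n) = 1 := rfl

lemma comul_t (m : Wt n) : Coalgebra.comul (R := K) (t K m) = t K m ⊗ₜ t K m := by
  simp [t]

lemma counit_t (m : Wt n) : Coalgebra.counit (R := K) (t K m) = 1 := by
  simp [t]

lemma hopf_induction {P : TorusHopf K n → Prop} (h : TorusHopf K n) (h0 : P 0)
    (ha : ∀ x y, P x → P y → P (x + y)) (hs : ∀ (c : K) (m : Wt n), P (c • t K m)) : P h := by
  refine AddMonoidAlgebra.induction_linear h h0 ha fun m r => ?_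
  have := hs r m
  simpa [t] using this

/-- Reading off the coefficient of `t_m` in `H ⊗ V`. -/
def coeffT (m : Wt n) (V : Type u) [AddCommGroup V] [Module K V] : TorusHopf K n ⊗[K] V →ₗ[K] V :=
  (TensorProduct.lid K V).toLinearMap ∘ₗ
    ((Finsupp.lapply m) ∘ₗ (AddMonoidAlgebra.coeffLinearEquiv K).toLinearMap).rTensor V

lemma coeffT_tmul (m p : Wt n) (v : V) :
    coeffT (K := K) m V (t K p ⊗ₜ v) = if p = m then v else 0 := by
  simp only [coeffT, t, LinearMap.coe_comp, Function.comp_apply, LinearMap.rTensor_tmul,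
    LinearEquiv.coe_coe, TensorProduct.lid_tmul, Finsupp.lapply_apply]
  rw [show (AddMonoidAlgebra.coeffLinearEquiv K) (AddMonoidAlgebra.single p (1 : K)) =
    Finsupp.single p 1 from rfl, Finsupp.single_apply]
  split_ifs <;> simp

/-- Every element of `H ⊗ V` is a finite sum of `t_m ⊗ v_m`. -/
lemma tensor_expand (x : TorusHopf K n ⊗[K] V) :
    ∃ s : Finset (Wt n), ∀ s' ⊇ s, x = ∑ m ∈ s', t K m ⊗ₜ coeffT m V x := by
  classical
  induction x with
  | zero => exact ⟨∅, fun s' _ => by simp⟩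
  | add x y hx hy =>
    obtain ⟨s, hs⟩ := hx
    obtain ⟨s2, hs2⟩ := hy
    refine ⟨s ∪ s2, fun s' h => ?_⟩
    conv_lhs => rw [hs s' (Finset.union_subset_left h), hs2 s' (Finset.union_subset_right h)]
    rw [← Finset.sum_add_distrib]
    simp [TensorProduct.tmul_add]
  | tmul h v =>
    induction h using hopf_induction with
    | h0 => exact ⟨∅, fun s' _ => by simp⟩
    | ha x y hx hy =>
      obtain ⟨s, hs⟩ := hx
      obtain ⟨s2, hs2⟩ := hy
      refine ⟨s ∪ s2, fun s' h => ?_⟩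
      rw [TensorProduct.add_tmul]
      conv_lhs => rw [hs s' (Finset.union_subset_left h), hs2 s' (Finset.union_subset_right h)]
      rw [← Finset.sum_add_distrib]
      simp [TensorProduct.tmul_add]
    | hs c m =>
      refine ⟨{m}, fun s' h => ?_⟩
      rw [Finset.sum_eq_single m]
      · rw [← TensorProduct.smul_tmul', map_smul, coeffT_tmul]; simp
      · intro p _ hp
        rw [← TensorProduct.smul_tmul', map_smul, coeffT_tmul, if_neg (Ne.symm hp)]; simp
      · intro h'; exact absurd (h (Finset.mem_singleton_self m)) h'

lemma coeffT_lTensor (m : Wt n) (L : V →ₗ[K] W) (x : TorusHopf K n ⊗[K] V) :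
    coeffT m W (L.lTensor _ x) = L (coeffT m V x) := by
  induction x with
  | zero => simp
  | add x y hx hy => simp [hx, hy]
  | tmul h v => simp [coeffT]

lemma lTensor_subtype_injective (U : Submodule K V) :
    Function.Injective (U.subtype.lTensor (TorusHopf K n)) :=
  Module.Flat.lTensor_preserves_injective_linearMap _ U.injective_subtype

variable [Comod K n V] [Comod K n W]

/-- The component of weight `m` of an element of a comodule. -/
def comp (K : Type u) [Field K] {n : ℕ} {V : Type u} [AddCommGroup V] [Module K V] [Comod K n V]
    (m : Wt n) : V →ₗ[K] V := coeffT m V ∘ₗ coact (K := K) (n := n) V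

lemma comp_homog (m : Wt n) (v : V) : IsHomog (K := K) m (comp K m v) := by
  obtain ⟨s, hs⟩ := tensor_expand (coact (K := K) (n := n) V v)
  have hc := LinearMap.congr_fun (Comod.coassoc (K := K) (n := n) (V := V)) v
  simp only [LinearMap.coe_comp, Function.comp_apply, LinearEquiv.coe_coe] at hc
  have h1 := congrArg (coeffT m _) hc
  rw [coeffT_lTensor] at h1
  have h2 : coeffT m _ ((TensorProduct.assoc K (TorusHopf K n) (TorusHopf K n) V)
      ((Coalgebra.comul (R := K)).rTensor V (Comod.coact v))) =
      t K m ⊗ₜ coeffT m V (coact (K := K) (n := n) V v) := by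
    generalize (coact (K := K) (n := n) V v) = x
    induction x with
    | zero => simp
    | add x y hx hy => simp [hx, hy, TensorProduct.tmul_add]
    | tmul h v =>
      induction h using hopf_induction with
      | h0 => simp
      | ha x y hx hy => simp only [TensorProduct.add_tmul, map_add, hx, hy, TensorProduct.tmul_add]
      | hs c p =>
        rw [← TensorProduct.smul_tmul']
        simp only [map_smul, LinearMap.rTensor_tmul, comul_t, TensorProduct.assoc_tmul,
          coeffT_tmul]
        split_ifs with h
        · subst h; simp
        · simp
  rw [h2] at h1
  exact h1

lemma sum_comp (v : V) : ∃ s : Finset (Wt n), v = ∑ m ∈ s, comp K m v := by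
  obtain ⟨s, hs⟩ := tensor_expand (coact (K := K) (n := n) V v)
  refine ⟨s, ?_⟩
  have hc := LinearMap.congr_fun (Comod.counit (K := K) (n := n) (V := V)) v
  simp only [LinearMap.coe_comp, Function.comp_apply, LinearEquiv.coe_coe, LinearMap.id_coe,
    id_eq] at hc
  conv_lhs => rw [← hc]
  change (TensorProduct.lid K V) ((Coalgebra.counit (R := K)).rTensor V (coact V v)) = _
  rw [hs s subset_rfl]
  simp only [map_sum, LinearMap.rTensor_tmul, counit_t, TensorProduct.lid_tmul, one_smul]
  rfl

lemma comp_of_homog {m : Wt n} {v : V} (h : IsHomog (K := K) m v) (p : Wt n) :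
    comp K p v = if m = p then v else 0 := by
  unfold IsHomog at h
  simp only [comp, LinearMap.coe_comp, Function.comp_apply, h, coeffT_tmul]

/-- Induction over homogeneous elements. -/
lemma homog_induction {P : V → Prop} (v : V) (h0 : P 0) (ha : ∀ x y, P x → P y → P (x + y))
    (hh : ∀ (m : Wt n) (x : V), IsHomog (K := K) m x → P x) : P v := by
  obtain ⟨s, hs⟩ := sum_comp (K := K) (n := n) v
  rw [hs]
  exact Finset.sum_induction _ P ha h0 fun m _ => hh m _ (comp_homog m v)

lemma isEquivariant_of_homog {L : V →ₗ[K] W}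
    (h : ∀ (m : Wt n) (v : V), IsHomog (K := K) m v → IsHomog (K := K) m (L v)) :
    IsEquivariant (K := K) (n := n) L := by
  ext v
  refine homog_induction (K := K) (n := n) (P := fun v => (L.lTensor (TorusHopf K n) ∘ₗ coact V) v =
    (coact W ∘ₗ L) v) v (by simp only [map_zero])
    (fun x y hx hy => by simp only [map_add, hx, hy]) fun m x hx => ?_
  have h2 := h m x hx
  unfold IsHomog at hx h2
  simp only [LinearMap.coe_comp, Function.comp_apply]
  rw [h2, hx, LinearMap.lTensor_tmul]

lemma IsEquivariant.map_homog {L : V →ₗ[K] W} (hL : IsEquivariant (K := K) (n := n) L)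
    {m : Wt n} {v : V} (h : IsHomog (K := K) m v) : IsHomog (K := K) m (L v) := by
  have := LinearMap.congr_fun hL v
  unfold IsHomog at *
  simp only [LinearMap.coe_comp, Function.comp_apply] at this
  rw [← this, h, LinearMap.lTensor_tmul]

lemma IsHomog.add {m : Wt n} {v w : V} (h : IsHomog (K := K) m v) (h' : IsHomog (K := K) m w) :
    IsHomog (K := K) m (v + w) := by
  unfold IsHomog at *; rw [map_add, h, h', TensorProduct.tmul_add]

lemma IsHomog.smul {m : Wt n} {v : V} (c : K) (h : IsHomog (K := K) m v) :
    IsHomog (K := K) m (c • v) := by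
  unfold IsHomog at *; rw [map_smul, h, TensorProduct.tmul_smul]

/-- Constructing a comodule from a coaction for which homogeneous elements span. -/
@[reducible] def Comod.ofSpan (V : Type u) [AddCommGroup V] [Module K V]
    (ρ : V →ₗ[K] TorusHopf K n ⊗[K] V)
    (h : Submodule.span K {v : V | ∃ m : Wt n, ρ v = t K m ⊗ₜ v} = ⊤) : Comod K n V where
  coact := ρ
  coassoc := by
    refine LinearMap.ext_on h ?_
    rintro v ⟨m, hm⟩
    simp only [LinearMap.coe_comp, Function.comp_apply, LinearEquiv.coe_coe, hm,
      LinearMap.lTensor_tmul, LinearMap.rTensor_tmul, comul_t, TensorProduct.assoc_tmul]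
  counit := by
    refine LinearMap.ext_on h ?_
    rintro v ⟨m, hm⟩
    simp only [LinearMap.coe_comp, Function.comp_apply, LinearEquiv.coe_coe, hm,
      LinearMap.rTensor_tmul, counit_t, TensorProduct.lid_tmul, one_smul, LinearMap.id_coe, id_eq]

/-- The coaction `v ⊗ w ↦ v₍₋₁₎ w₍₋₁₎ ⊗ v₍₀₎ ⊗ w₍₀₎` on a tensor product. -/
def tensorCoact (K : Type u) [Field K] (n : ℕ) (V W : Type u) [AddCommGroup V] [Module K V]
    [AddCommGroup W] [Module K W] [Comod K n V] [Comod K n W] :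
    V ⊗[K] W →ₗ[K] TorusHopf K n ⊗[K] (V ⊗[K] W) :=
  (LinearMap.mul' K (TorusHopf K n)).rTensor (V ⊗[K] W) ∘ₗ
    (TensorProduct.tensorTensorTensorComm K (TorusHopf K n) V (TorusHopf K n) W).toLinearMap ∘ₗ
    TensorProduct.map (coact V) (coact W)

lemma tensorCoact_homog {m p : Wt n} {v : V} {w : W} (hv : IsHomog (K := K) m v)
    (hw : IsHomog (K := K) p w) :
    tensorCoact K n V W (v ⊗ₜ w) = t K (m + p) ⊗ₜ (v ⊗ₜ w) := by
  unfold IsHomog at *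
  simp [tensorCoact, hv, hw, t_mul]

lemma tensor_span_homog : Submodule.span K {x : V ⊗[K] W | ∃ (m p : Wt n) (v : V) (w : W),
    IsHomog (K := K) m v ∧ IsHomog (K := K) p w ∧ x = v ⊗ₜ w} = ⊤ := by
  rw [eq_top_iff]
  rintro x -
  induction x with
  | zero => exact zero_mem _
  | add x y hx hy => exact add_mem hx hy
  | tmul v w =>
    refine homog_induction (K := K) (n := n) (P := fun v => v ⊗ₜ[K] w ∈ Submodule.span K _) v
      (by rw [TensorProduct.zero_tmul]; exact zero_mem _)
      (fun x y hx hy => by rw [TensorProduct.add_tmul]; exact add_mem hx hy) fun m v hv => ?_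
    refine homog_induction (K := K) (n := n) (P := fun w => v ⊗ₜ[K] w ∈ Submodule.span K _) w
      (by rw [TensorProduct.tmul_zero]; exact zero_mem _)
      (fun x y hx hy => by rw [TensorProduct.tmul_add]; exact add_mem hx hy) fun p w hw => ?_
    exact Submodule.subset_span ⟨m, p, v, w, hv, hw, rfl⟩

/-- The tensor product of comodules. -/
instance tensorComod : Comod K n (V ⊗[K] W) :=
  Comod.ofSpan _ (tensorCoact K n V W) (by
    rw [eq_top_iff, ← tensor_span_homog (K := K) (n := n) (V := V) (W := W)]
    refine Submodule.span_mono ?_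
    rintro x ⟨m, p, v, w, hv, hw, rfl⟩
    exact ⟨m + p, tensorCoact_homog hv hw⟩)

lemma IsHomog.tmul {m p : Wt n} {v : V} {w : W} (hv : IsHomog (K := K) m v)
    (hw : IsHomog (K := K) p w) : IsHomog (K := K) (m + p) (v ⊗ₜ[K] w) :=
  tensorCoact_homog hv hw

lemma tensor_homog_induction {P : V ⊗[K] W → Prop} (x : V ⊗[K] W) (h0 : P 0)
    (ha : ∀ x y, P x → P y → P (x + y))
    (hh : ∀ (m p : Wt n) (v : V) (w : W), IsHomog (K := K) m v → IsHomog (K := K) p w →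
      P (v ⊗ₜ w)) : P x := by
  induction x with
  | zero => exact h0
  | add x y hx hy => exact ha _ _ hx hy
  | tmul v w =>
    refine homog_induction (K := K) (n := n) (P := fun v => P (v ⊗ₜ[K] w)) v
      (by rwa [TensorProduct.zero_tmul])
      (fun x y hx hy => by rw [TensorProduct.add_tmul]; exact ha _ _ hx hy) fun m v hv => ?_
    refine homog_induction (K := K) (n := n) (P := fun w => P (v ⊗ₜ[K] w)) w
      (by rwa [TensorProduct.tmul_zero])
      (fun x y hx hy => by rw [TensorProduct.tmul_add]; exact ha _ _ hx hy) fun p w hw => ?_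
    exact hh m p v w hv hw

/-- A coinvariant of a tensor product is a sum of `v ⊗ w` with opposite weights. -/
lemma coinv_tensor_induction {P : V ⊗[K] W → Prop} (x : V ⊗[K] W)
    (hx : IsHomog (K := K) (0 : Wt n) x) (h0 : P 0)
    (ha : ∀ x y, P x → P y → P (x + y))
    (hh : ∀ (m : Wt n) (v : V) (w : W), IsHomog (K := K) (-m) v → IsHomog (K := K) m w →
      P (v ⊗ₜ w)) : P x := by
  have key : ∀ x : V ⊗[K] W, P (comp K (0 : Wt n) x) := by
    intro x
    refine tensor_homog_induction (K := K) (n := n) (P := fun x => P (comp K (0 : Wt n) x)) x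
      (by rwa [map_zero])
      (fun x y hx hy => by rw [map_add]; exact ha _ _ hx hy) fun m p v w hv hw => ?_
    rw [comp_of_homog (hv.tmul hw)]
    split_ifs with h
    · have : m = -p := eq_neg_of_add_eq_zero_left h
      subst this
      exact hh p v w hv hw
    · exact h0
  have := key x
  rwa [comp_of_homog hx, if_pos rfl] at this

/-- The restriction to `U` of a coaction that maps `U` into `H ⊗ U`. -/
def subCoact (U : Submodule K V) (hU : ∀ v : U, (coact (K := K) (n := n) V ∘ₗ U.subtype) v ∈
    LinearMap.range (U.subtype.lTensor (TorusHopf K n))) : U →ₗ[K] TorusHopf K n ⊗[K] U :=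
  (LinearEquiv.ofInjective _ (lTensor_subtype_injective U)).symm.toLinearMap ∘ₗ
    LinearMap.codRestrict _ (coact (K := K) (n := n) V ∘ₗ U.subtype) hU

lemma lTensor_subCoact (U : Submodule K V)
    (hU : ∀ v : U, (coact (K := K) (n := n) V ∘ₗ U.subtype) v ∈
      LinearMap.range (U.subtype.lTensor (TorusHopf K n))) (x : U) :
    U.subtype.lTensor _ (subCoact U hU x) = coact (K := K) (n := n) V x :=
  congrArg Subtype.val ((LinearEquiv.ofInjective _ (lTensor_subtype_injective U)).apply_symm_apply
    (LinearMap.codRestrict _ (coact (K := K) (n := n) V ∘ₗ U.subtype) hU x))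

/-- A subspace `U` with `ρ(U) ⊆ H ⊗ U` is a comodule: the coaction is the restriction. -/
@[reducible] def subComod (U : Submodule K V)
    (hU : ∀ v : U, (coact (K := K) (n := n) V ∘ₗ U.subtype) v ∈
      LinearMap.range (U.subtype.lTensor (TorusHopf K n))) : Comod K n U :=
  Comod.ofSpan U (subCoact U hU) (by
    rw [eq_top_iff]
    rintro x -
    have hmem : ∀ m : Wt n, (coeffT m U (subCoact U hU x) : V) = comp K m (x : V) := fun m => by
      rw [comp, LinearMap.comp_apply, ← lTensor_subCoact U hU x, coeffT_lTensor]; rfl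
    obtain ⟨s, hs⟩ := sum_comp (K := K) (n := n) (x : V)
    have hx : x = ∑ m ∈ s, coeffT m U (subCoact U hU x) := by
      apply Subtype.ext
      rw [AddSubmonoidClass.coe_finsetSum]
      conv_lhs => rw [hs]
      exact Finset.sum_congr rfl fun m _ => (hmem m).symm
    rw [hx]
    refine Submodule.sum_mem _ fun m _ => Submodule.subset_span ⟨m, ?_⟩
    apply lTensor_subtype_injective U
    rw [lTensor_subCoact, hmem, LinearMap.lTensor_tmul, Submodule.subtype_apply, hmem]
    exact comp_homog m _)

lemma subComod_homog (U : Submodule K V)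
    (hU : ∀ v : U, (coact (K := K) (n := n) V ∘ₗ U.subtype) v ∈
      LinearMap.range (U.subtype.lTensor (TorusHopf K n))) (m : Wt n) (x : U) :
    letI := subComod U hU
    IsHomog (K := K) m x ↔ IsHomog (K := K) m (x : V) := by
  constructor
  · intro h
    have h' : subCoact U hU x = t K m ⊗ₜ x := h
    unfold IsHomog
    rw [← lTensor_subCoact U hU x, h']; rfl
  · intro h
    apply lTensor_subtype_injective (n := n) U
    exact (lTensor_subCoact U hU x).trans h

end Comodules

/-! ### Cotriangular structures, braiding, commutative algebra objects -/

/-- A cotriangular structure on `H`: a linear map `R : H ⊗ H → K` such that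
`R(fg ⊗ h) = R(f ⊗ h₍₁₎) R(g ⊗ h₍₂₎)`, `R(f ⊗ gh) = R(f₍₁₎ ⊗ h) R(f₍₂₎ ⊗ g)` and
`ε(h) ε(g) = R(h₍₁₎ ⊗ g₍₁₎) R(g₍₂₎ ⊗ h₍₂₎)`. -/
structure Cotriangular (K : Type u) [Field K] (n : ℕ) where
  /-- the linear map `R` -/
  form : TorusHopf K n ⊗[K] TorusHopf K n →ₗ[K] K
  mul_left : ∀ f g h : TorusHopf K n, form ((f * g) ⊗ₜ h) =
    LinearMap.mul' K K (TensorProduct.map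
      (form ∘ₗ TensorProduct.mk K _ _ f) (form ∘ₗ TensorProduct.mk K _ _ g)
      (Coalgebra.comul (R := K) h))
  mul_right : ∀ f g h : TorusHopf K n, form (f ⊗ₜ (g * h)) =
    LinearMap.mul' K K (TensorProduct.map
      (form ∘ₗ (TensorProduct.mk K _ _).flip h) (form ∘ₗ (TensorProduct.mk K _ _).flip g)
      (Coalgebra.comul (R := K) f))
  symm : ∀ h g : TorusHopf K n,
    Coalgebra.counit (R := K) h * Coalgebra.counit (R := K) g =
    LinearMap.mul' K K (TensorProduct.map form
      (form ∘ₗ (TensorProduct.comm K (TorusHopf K n) (TorusHopf K n)).toLinearMap)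
      (TensorProduct.tensorTensorTensorComm K _ _ _ _
        (Coalgebra.comul (R := K) h ⊗ₜ Coalgebra.comul (R := K) g)))

variable {K : Type u} [Field K] {n : ℕ}

namespace Cotriangular

variable (R : Cotriangular K n)

/-- The values `R(t_m ⊗ t_p)`. -/
def chi (m p : Wt n) : K := R.form (t K m ⊗ₜ t K p)

lemma chi_add_left (m m' p : Wt n) : R.chi (m + m') p = R.chi m p * R.chi m' p := by
  have := R.mul_left (t K m) (t K m') (t K p)
  rw [comul_t, t_mul] at this
  simpa [chi] using this

lemma chi_add_right (m p p' : Wt n) : R.chi m (p + p') = R.chi m p * R.chi m p' := by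
  have := R.mul_right (t K m) (t K p) (t K p')
  rw [comul_t, t_mul] at this
  rw [mul_comm (R.chi m p)]
  simpa [chi] using this

lemma chi_symm (m p : Wt n) : R.chi m p * R.chi p m = 1 := by
  have := R.symm (t K m) (t K p)
  rw [comul_t, comul_t, counit_t, counit_t] at this
  simpa [chi] using this.symm

lemma chi_ne_zero (m p : Wt n) : R.chi m p ≠ 0 := fun h => by
  have := R.chi_symm m p
  rw [h, zero_mul] at this
  exact zero_ne_one this

lemma chi_zero_left (p : Wt n) : R.chi 0 p = 1 := by
  have := R.chi_add_left 0 0 p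
  rw [add_zero] at this
  exact mul_left_cancel₀ (R.chi_ne_zero 0 p) (by rw [← this, mul_one])

lemma chi_zero_right (p : Wt n) : R.chi p 0 = 1 := by
  have := R.chi_symm p 0
  rwa [chi_zero_left, mul_one] at this

lemma chi_neg_left (m p : Wt n) : R.chi (-m) p = R.chi p m := by
  have h := R.chi_add_left (-m) m p
  rw [neg_add_cancel, chi_zero_left] at h
  exact mul_right_cancel₀ (R.chi_ne_zero m p) (by rw [← h, mul_comm, chi_symm])

lemma chi_neg_right (m p : Wt n) : R.chi m (-p) = R.chi p m := by
  have h := R.chi_add_right m (-p) p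
  rw [neg_add_cancel, chi_zero_right] at h
  exact mul_right_cancel₀ (R.chi_ne_zero m p) (by rw [← h, chi_symm])

section Braid

variable (V W : Type u) [AddCommGroup V] [Module K V] [AddCommGroup W] [Module K W]
  [Comod K n V] [Comod K n W]

/-- The commutativity constraint `τ(v ⊗ w) = R(w₍₋₁₎ ⊗ v₍₋₁₎) w₍₀₎ ⊗ v₍₀₎`. -/
def braid : V ⊗[K] W →ₗ[K] W ⊗[K] V :=
  (TensorProduct.lid K (W ⊗[K] V)).toLinearMap ∘ₗ
    TensorProduct.map (R.form ∘ₗ (TensorProduct.comm K (TorusHopf K n) (TorusHopf K n)).toLinearMap)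
      (TensorProduct.comm K V W).toLinearMap ∘ₗ
    (TensorProduct.tensorTensorTensorComm K (TorusHopf K n) V (TorusHopf K n) W).toLinearMap ∘ₗ
    TensorProduct.map (coact V) (coact W)

variable {V W}

lemma braid_homog {m p : Wt n} {v : V} {w : W} (hv : IsHomog (K := K) m v)
    (hw : IsHomog (K := K) p w) : R.braid V W (v ⊗ₜ w) = R.chi p m • (w ⊗ₜ v) := by
  unfold IsHomog at *
  simp [braid, hv, hw, chi]

/-- The linear map `v ↦ R(v₍₋₁₎ ⊗ t_p) v₍₀₎`. -/
def twist (V : Type u) [AddCommGroup V] [Module K V] [Comod K n V] (p : Wt n) : V →ₗ[K] V :=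
  (TensorProduct.lid K V).toLinearMap ∘ₗ
    (R.form ∘ₗ (TensorProduct.mk K _ _).flip (t K p)).rTensor V ∘ₗ coact V

lemma twist_homog {m : Wt n} (p : Wt n) {v : V} (hv : IsHomog (K := K) m v) :
    R.twist V p v = R.chi m p • v := by
  unfold IsHomog at *
  simp [twist, hv, chi]

lemma twist_equivariant {L : V →ₗ[K] W} (hL : IsEquivariant (K := K) (n := n) L) (p : Wt n)
    (v : V) : L (R.twist V p v) = R.twist W p (L v) := by
  refine homog_induction (K := K) (n := n)
    (P := fun v => L (R.twist V p v) = R.twist W p (L v)) v (by simp only [map_zero])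
    (fun x y hx hy => by simp only [map_add, hx, hy]) fun m x hx => ?_
  rw [R.twist_homog p hx, R.twist_homog p (hL.map_homog hx), map_smul]

end Braid

end Cotriangular

/-- Objects of `ᴴ𝒜`: algebra objects in `H`-comodules whose product is compatible with the
commutativity constraint. -/
structure ToricAlg (R : Cotriangular K n) where
  /-- the underlying vector space -/
  carrier : Type u
  [ring : Ring carrier]
  [algebra : Algebra K carrier]
  [comod : Comod K n carrier]
  mul_equivariant : IsEquivariant (K := K) (n := n) (LinearMap.mul' K carrier)
  one_coinv : IsHomog (K := K) (0 : Wt n) (1 : carrier)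
  braided_comm : LinearMap.mul' K carrier ∘ₗ R.braid carrier carrier = LinearMap.mul' K carrier

attribute [instance] ToricAlg.ring ToricAlg.algebra ToricAlg.comod

variable {R : Cotriangular K n}

instance : CoeSort (ToricAlg R) (Type u) := ⟨ToricAlg.carrier⟩

lemma ToricAlg.mul_homog (A : ToricAlg R) {m p : Wt n} {a b : A} (ha : IsHomog (K := K) m a)
    (hb : IsHomog (K := K) p b) : IsHomog (K := K) (m + p) (a * b) :=
  A.mul_equivariant.map_homog (ha.tmul hb)

lemma ToricAlg.comm_homog (A : ToricAlg R) {m p : Wt n} {a b : A} (ha : IsHomog (K := K) m a)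
    (hb : IsHomog (K := K) p b) : a * b = R.chi p m • (b * a) := by
  have := LinearMap.congr_fun A.braided_comm (a ⊗ₜ b)
  rw [LinearMap.comp_apply, R.braid_homog ha hb, map_smul] at this
  exact this.symm

lemma ToricAlg.twist_mul (A : ToricAlg R) (p : Wt n) (a b : A) :
    R.twist A p (a * b) = R.twist A p a * R.twist A p b := by
  refine homog_induction (K := K) (n := n) (P := fun a => R.twist A p (a * b) =
    R.twist A p a * R.twist A p b) a (by simp) (fun x y hx hy => by
      simp only [add_mul, map_add, hx, hy]) fun m a ha => ?_
  refine homog_induction (K := K) (n := n) (P := fun b => R.twist A p (a * b) =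
    R.twist A p a * R.twist A p b) b (by simp) (fun x y hx hy => by
      simp only [mul_add, map_add, hx, hy]) fun q b hb => ?_
  rw [R.twist_homog p ha, R.twist_homog p hb, R.twist_homog p (A.mul_homog ha hb),
    R.chi_add_left, smul_mul_smul_comm]

lemma ToricAlg.coact_mul (A : ToricAlg R) (a b : A) :
    coact (K := K) (n := n) A (a * b) = coact A a * coact A b := by
  refine homog_induction (K := K) (n := n) (P := fun a => coact (K := K) (n := n) A (a * b) =
    coact A a * coact A b) a (by simp) (fun x y hx hy => by
      simp only [add_mul, map_add, hx, hy]) fun m a ha => ?_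
  refine homog_induction (K := K) (n := n) (P := fun b => coact (K := K) (n := n) A (a * b) =
    coact A a * coact A b) b (by simp) (fun x y hx hy => by
      simp only [mul_add, map_add, hx, hy]) fun q b hb => ?_
  have h := A.mul_homog ha hb
  unfold IsHomog at ha hb h
  rw [ha, hb, h, Algebra.TensorProduct.tmul_mul_tmul, t_mul]

/-- Morphisms of `ᴴ𝒜`: equivariant algebra homomorphisms. -/
@[ext] structure ToricHom (A B : ToricAlg R) where
  /-- the underlying algebra homomorphism -/
  hom : A →ₐ[K] B
  equivariant : IsEquivariant (K := K) (n := n) hom.toLinearMap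

namespace ToricHom

instance (A B : ToricAlg R) : FunLike (ToricHom A B) A B where
  coe f := f.hom
  coe_injective _ _ h := ToricHom.ext (DFunLike.coe_injective h)

variable {A B C : ToricAlg R}

/-- Identity morphism. -/
def id (A : ToricAlg R) : ToricHom A A :=
  ⟨AlgHom.id K A, isEquivariant_of_homog fun _ _ h => h⟩

/-- Composition of morphisms, `g ∘ f`. -/
def comp (g : ToricHom B C) (f : ToricHom A B) : ToricHom A C :=
  ⟨g.hom.comp f.hom, isEquivariant_of_homog fun _ _ h =>
    g.equivariant.map_homog (f.equivariant.map_homog h)⟩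

lemma map_homog (f : ToricHom A B) {m : Wt n} {a : A} (h : IsHomog (K := K) m a) :
    IsHomog (K := K) m (f a) := f.equivariant.map_homog h

end ToricHom

/-! ### Free algebras and finite presentations -/

section Free

variable {N : ℕ} (R) (deg : Fin N → Wt n)

/-- The commutation relations `x_i x_j = R(t_{m_j} ⊗ t_{m_i}) x_j x_i`. -/
inductive FreeRel : FreeAlgebra K (Fin N) → FreeAlgebra K (Fin N) → Prop
  | comm (i j : Fin N) : FreeRel (FreeAlgebra.ι K i * FreeAlgebra.ι K j)
      (R.form (t K (deg j) ⊗ₜ t K (deg i)) • (FreeAlgebra.ι K j * FreeAlgebra.ι K i))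

/-- The algebra underlying `F_{m_1,…,m_N}`. -/
abbrev FreeCarrier : Type u := RingQuot (FreeRel R deg)

/-- The generators `x_i`. -/
def gen (i : Fin N) : FreeCarrier R deg := RingQuot.mkAlgHom K (FreeRel R deg) (FreeAlgebra.ι K i)

lemma gen_comm (i j : Fin N) :
    gen R deg i * gen R deg j = R.chi (deg j) (deg i) • (gen R deg j * gen R deg i) := by
  have := RingQuot.mkAlgHom_rel K (FreeRel.comm (R := R) (deg := deg) i j)
  rw [map_smul, map_mul, map_mul] at this
  exact this

variable {R deg} in
/-- Induction by left multiplication with generators. -/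
lemma free_induction {P : FreeCarrier R deg → Prop} (a : FreeCarrier R deg)
    (h1 : P 1) (hadd : ∀ a b, P a → P b → P (a + b)) (hsmul : ∀ (c : K) a, P a → P (c • a))
    (hgen : ∀ i a, P a → P (gen R deg i * a)) : P a := by
  obtain ⟨a, rfl⟩ := RingQuot.mkAlgHom_surjective K (FreeRel R deg) a
  suffices h : ∀ b, P b → P (RingQuot.mkAlgHom K (FreeRel R deg) a * b) by
    simpa using h 1 h1
  induction a using FreeAlgebra.induction with
  | grade0 r => intro b hb; rw [AlgHom.commutes, ← Algebra.smul_def]; exact hsmul r b hb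
  | grade1 i => intro b hb; exact hgen i b hb
  | mul a a' ha ha' => intro b hb; rw [map_mul, mul_assoc]; exact ha _ (ha' _ hb)
  | add a a' ha ha' => intro b hb; rw [map_add, add_mul]; exact hadd _ _ (ha _ hb) (ha' _ hb)

/-- An algebra map out of `F_{m_1,…,m_N}` from images of the generators. -/
def freeLift {B : Type u} [Ring B] [Algebra K B] (y : Fin N → B)
    (hy : ∀ i j, y i * y j = R.chi (deg j) (deg i) • (y j * y i)) : FreeCarrier R deg →ₐ[K] B :=
  RingQuot.liftAlgHom K ⟨FreeAlgebra.lift K y, by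
    rintro _ _ ⟨i, j⟩
    rw [map_smul, map_mul, map_mul, FreeAlgebra.lift_ι_apply, FreeAlgebra.lift_ι_apply]
    exact hy i j⟩

lemma freeLift_gen {B : Type u} [Ring B] [Algebra K B] (y : Fin N → B)
    (hy : ∀ i j, y i * y j = R.chi (deg j) (deg i) • (y j * y i)) (i : Fin N) :
    freeLift R deg y hy (gen R deg i) = y i := by
  simp [freeLift, gen]

/-- The coaction on `F_{m_1,…,m_N}`, the algebra homomorphism with `x_i ↦ t_{m_i} ⊗ x_i`. -/
def freeCoact : FreeCarrier R deg →ₐ[K] TorusHopf K n ⊗[K] FreeCarrier R deg :=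
  freeLift R deg (fun i => t K (deg i) ⊗ₜ gen R deg i) (fun i j => by
    rw [Algebra.TensorProduct.tmul_mul_tmul, Algebra.TensorProduct.tmul_mul_tmul, t_mul, t_mul,
      gen_comm, TensorProduct.tmul_smul, add_comm])

lemma freeCoact_span : Submodule.span K {a : FreeCarrier R deg |
    ∃ m : Wt n, (freeCoact R deg).toLinearMap a = t K m ⊗ₜ a} = ⊤ := by
  rw [eq_top_iff]
  rintro a -
  refine free_induction a (Submodule.subset_span ⟨0, ?_⟩) (fun _ _ ha hb => add_mem ha hb)
    (fun c a ha => Submodule.smul_mem _ c ha) fun i a ha => ?_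
  · rw [t_zero]; simp [Algebra.TensorProduct.one_def]
  · refine Submodule.span_induction (p := fun a _ => gen R deg i * a ∈ Submodule.span K _)
      ?_ (by rw [mul_zero]; exact zero_mem _)
      (fun x y _ _ hx hy => by rw [mul_add]; exact add_mem hx hy)
      (fun c x _ hx => by rw [mul_smul_comm]; exact Submodule.smul_mem _ c hx) ha
    rintro x ⟨m, hm⟩
    refine Submodule.subset_span ⟨deg i + m, ?_⟩
    rw [AlgHom.toLinearMap_apply] at hm ⊢
    rw [map_mul, hm, freeCoact, freeLift_gen, Algebra.TensorProduct.tmul_mul_tmul, t_mul]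

instance freeComod : Comod K n (FreeCarrier R deg) :=
  Comod.ofSpan _ (freeCoact R deg).toLinearMap (freeCoact_span R deg)

lemma coact_free (a : FreeCarrier R deg) :
    coact (K := K) (n := n) (FreeCarrier R deg) a = freeCoact R deg a := rfl

lemma gen_homog (i : Fin N) : IsHomog (K := K) (deg i) (gen R deg i) :=
  freeLift_gen R deg _ _ i

lemma free_mul_homog {m p : Wt n} {a b : FreeCarrier R deg} (ha : IsHomog (K := K) m a)
    (hb : IsHomog (K := K) p b) : IsHomog (K := K) (m + p) (a * b) := by
  unfold IsHomog at *
  rw [coact_free] at *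
  rw [map_mul, ha, hb, Algebra.TensorProduct.tmul_mul_tmul, t_mul]

lemma free_one_coinv : IsHomog (K := K) (0 : Wt n) (1 : FreeCarrier R deg) := by
  unfold IsHomog; rw [coact_free, map_one, t_zero]; rfl

lemma twist_gen_mul (j : Fin N) (q : Wt n) (a : FreeCarrier R deg) :
    R.twist _ q (gen R deg j * a) = R.chi (deg j) q • (gen R deg j * R.twist _ q a) := by
  refine homog_induction (K := K) (n := n) (P := fun a => R.twist _ q (gen R deg j * a) =
    R.chi (deg j) q • (gen R deg j * R.twist _ q a)) a (by simp)
    (fun x y hx hy => by simp only [mul_add, map_add, hx, hy, smul_add]) fun p x hx => ?_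
  rw [R.twist_homog _ (free_mul_homog R deg (gen_homog R deg j) hx), R.twist_homog _ hx,
    R.chi_add_left, mul_smul_comm, smul_smul]

lemma free_gen_mul_homog (i : Fin N) {p : Wt n} {b : FreeCarrier R deg}
    (hb : IsHomog (K := K) p b) :
    gen R deg i * b = R.chi p (deg i) • (b * gen R deg i) := by
  rw [← smul_mul_assoc, ← R.twist_homog (deg i) hb]
  refine free_induction (P := fun b => gen R deg i * b = R.twist _ (deg i) b * gen R deg i) b
    ?_ (fun a b ha hb => by simp only [mul_add, map_add, add_mul, ha, hb])
    (fun c a ha => by simp only [map_smul, mul_smul_comm, smul_mul_assoc, ha]) fun j a ha => ?_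
  · rw [R.twist_homog _ (free_one_coinv R deg), R.chi_zero_left, one_smul, mul_one, one_mul]
  · rw [twist_gen_mul, ← mul_assoc, gen_comm, smul_mul_assoc, mul_assoc, ha, smul_mul_assoc, mul_assoc]

lemma comp_gen_mul (i : Fin N) (q : Wt n) (a : FreeCarrier R deg) :
    comp K q (gen R deg i * a) = gen R deg i * comp K (q - deg i) a := by
  refine homog_induction (K := K) (n := n) (P := fun a => comp K q (gen R deg i * a) =
    gen R deg i * comp K (q - deg i) a) a (by simp)
    (fun x y hx hy => by simp only [mul_add, map_add, hx, hy]) fun p x hx => ?_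
  rw [comp_of_homog (free_mul_homog R deg (gen_homog R deg i) hx), comp_of_homog hx]
  by_cases h : p = q - deg i
  · rw [if_pos h, if_pos (by rw [h]; abel)]
  · rw [if_neg h, if_neg (fun h' => h (by rw [← h']; abel)), mul_zero]

lemma free_comm_homog {m p : Wt n} {a b : FreeCarrier R deg} (ha : IsHomog (K := K) m a)
    (hb : IsHomog (K := K) p b) : a * b = R.chi p m • (b * a) := by
  have key : ∀ a : FreeCarrier R deg, ∀ q : Wt n, comp K q a * b = R.chi p q • (b * comp K q a) := by
    intro a
    refine free_induction (P := fun a => ∀ q : Wt n, comp K q a * b = R.chi p q • (b * comp K q a)) a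
      ?_ (fun a b ha hb q => ?_) (fun c a ha q => ?_) fun i a ha q => ?_
    · intro q
      rw [comp_of_homog (free_one_coinv R deg)]
      split_ifs with h
      · subst h; simp [R.chi_zero_right]
      · simp
    · simp only [map_add, add_mul, mul_add, smul_add, ha q, hb q]
    · simp only [map_smul, smul_mul_assoc, mul_smul_comm, ha q]; rw [smul_comm]
    · rw [comp_gen_mul, mul_assoc, ha, mul_smul_comm, ← mul_assoc, free_gen_mul_homog R deg i hb,
        smul_mul_assoc, smul_smul, ← R.chi_add_right, sub_add_cancel, mul_assoc]
  have := key a m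
  rwa [comp_of_homog ha, if_pos rfl] at this

/-- Constructor for `ToricAlg` from homogeneous elements. -/
def ToricAlg.ofHomog (A : Type u) [Ring A] [Algebra K A] [Comod K n A]
    (h1 : IsHomog (K := K) (0 : Wt n) (1 : A))
    (hm : ∀ (m p : Wt n) (a b : A), IsHomog (K := K) m a → IsHomog (K := K) p b →
      IsHomog (K := K) (m + p) (a * b))
    (hc : ∀ (m p : Wt n) (a b : A), IsHomog (K := K) m a → IsHomog (K := K) p b →
      a * b = R.chi p m • (b * a)) : ToricAlg R where
  carrier := A
  mul_equivariant := by
    refine LinearMap.ext fun x => ?_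
    refine tensor_homog_induction (K := K) (n := n)
      (P := fun x => ((LinearMap.mul' K A).lTensor (TorusHopf K n) ∘ₗ coact (A ⊗[K] A)) x =
        (coact A ∘ₗ LinearMap.mul' K A) x) x (by simp only [map_zero])
      (fun x y hx hy => by simp only [map_add, hx, hy]) fun m p a b ha hb => ?_
    have h := hm m p a b ha hb
    have h' := ha.tmul hb
    unfold IsHomog at h h'
    rw [LinearMap.comp_apply, h', LinearMap.lTensor_tmul, LinearMap.comp_apply,
      LinearMap.mul'_apply, h]
  one_coinv := h1
  braided_comm := by
    refine LinearMap.ext fun x => ?_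
    refine tensor_homog_induction (K := K) (n := n)
      (P := fun x => (LinearMap.mul' K A ∘ₗ R.braid A A) x = LinearMap.mul' K A x) x
      (by simp only [map_zero])
      (fun x y hx hy => by simp only [map_add, hx, hy]) fun m p a b ha hb => ?_
    rw [LinearMap.comp_apply, R.braid_homog ha hb, map_smul, LinearMap.mul'_apply,
      LinearMap.mul'_apply, hc m p a b ha hb]

/-- The free algebra `F_{m_1,…,m_N}` on generators `x_i` of weight `m_i`. -/
def freeAlg : ToricAlg R :=
  ToricAlg.ofHomog R (FreeCarrier R deg)
    (free_one_coinv R deg)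
    (fun _ _ _ _ ha hb => free_mul_homog R deg ha hb)
    (fun _ _ _ _ ha hb => free_comm_homog R deg ha hb)

end Free

/-- A finite presentation `A ≅ F_{m_1,…,m_N} / (f_1,…,f_M)` with homogeneous `f_k`: a surjective
morphism `F_{m_1,…,m_N} → A` whose kernel is the two-sided ideal generated by the `f_k`. -/
structure Presentation (A : ToricAlg R) where
  /-- number of generators -/
  N : ℕ
  /-- weights of the generators -/
  deg : Fin N → Wt n
  /-- number of relations -/
  M : ℕ
  /-- the relations -/
  rel : Fin M → FreeCarrier R deg
  /-- weights of the relations -/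
  relDeg : Fin M → Wt n
  rel_homog : ∀ k, IsHomog (K := K) (relDeg k) (rel k)
  /-- the quotient map -/
  proj : FreeCarrier R deg →ₐ[K] A
  proj_equivariant : IsEquivariant (K := K) (n := n) proj.toLinearMap
  proj_surjective : Function.Surjective proj
  proj_eq_zero_iff : ∀ a, proj a = 0 ↔ a ∈ TwoSidedIdeal.span (Set.range rel)

/-! ### Braided derivations -/

section Partial

variable {N : ℕ} (R) (deg : Fin N → Wt n)

/-- The algebra homomorphism `a ↦ [[R(a₍₋₁₎ ⊗ t_{-m_j}) a₍₀₎, ∂_j a], [0, a]]`, which encodes the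
braided Leibniz rule of `∂_j`. -/
def partialMatrix (j : Fin N) :
    FreeCarrier R deg →ₐ[K] Matrix (Fin 2) (Fin 2) (FreeCarrier R deg) :=
  freeLift R deg (fun i => !![R.chi (deg i) (-deg j) • gen R deg i, if i = j then 1 else 0;
    0, gen R deg i]) (fun i k => by
    have hself : ∀ m : Wt n, R.chi m (-m) = R.chi m m := fun m => R.chi_neg_right m m
    ext a b
    fin_cases a <;> fin_cases b
    · simp only [Matrix.mul_apply, Fin.sum_univ_two, Matrix.smul_apply]
      simp only [Fin.zero_eta, Matrix.of_apply, Matrix.cons_val_zero, Matrix.cons_val_one,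
        Matrix.cons_val', mul_zero, add_zero, smul_mul_assoc, mul_smul_comm]
      rw [gen_comm R deg i k]
      simp only [smul_smul]
      congr 1; ring
    · simp only [Matrix.mul_apply, Fin.sum_univ_two, Matrix.smul_apply]
      simp only [Fin.zero_eta, Fin.mk_one, Matrix.of_apply, Matrix.cons_val_zero,
        Matrix.cons_val_one, Matrix.cons_val', mul_ite, ite_mul, mul_one,
        mul_zero, one_mul, zero_mul, smul_ite, smul_add, smul_zero, R.chi_neg_right]
      by_cases hi : i = j <;> by_cases hk : k = j
      · subst hi; subst hk
        simp only [if_true, smul_smul, R.chi_symm, one_smul]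
        rw [add_comm]
      · subst hi
        simp only [if_true, if_neg hk, zero_add, smul_smul, add_zero]
        rw [R.chi_symm, one_smul]
      · subst hk
        simp [if_neg hi]
      · simp [if_neg hi, if_neg hk]
    · simp [Matrix.mul_apply, Fin.sum_univ_two]
    · simp only [Matrix.mul_apply, Fin.sum_univ_two, Matrix.smul_apply]
      simp only [Fin.mk_one, Matrix.of_apply, Matrix.cons_val_zero,
        Matrix.cons_val_one, Matrix.cons_val', zero_mul, zero_add]
      exact gen_comm R deg i k)

/-- The partial derivative `∂_j` on `F_{m_1,…,m_N}`. -/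
def partialD (j : Fin N) : FreeCarrier R deg →ₗ[K] FreeCarrier R deg where
  toFun a := partialMatrix R deg j a 0 1
  map_add' a b := by simp
  map_smul' c a := by simp

lemma partialMatrix_entries (j : Fin N) (a : FreeCarrier R deg) :
    partialMatrix R deg j a 0 0 = R.twist _ (-deg j) a ∧ partialMatrix R deg j a 1 0 = 0 ∧
      partialMatrix R deg j a 1 1 = a := by
  refine free_induction (P := fun a => partialMatrix R deg j a 0 0 = R.twist _ (-deg j) a ∧
    partialMatrix R deg j a 1 0 = 0 ∧ partialMatrix R deg j a 1 1 = a) a ?_ ?_ ?_ ?_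
  · rw [R.twist_homog _ (free_one_coinv R deg), R.chi_zero_left, one_smul, map_one]
    simp
  · rintro a b ⟨h1, h2, h3⟩ ⟨h1', h2', h3'⟩
    simp [h1, h2, h3, h1', h2', h3']
  · rintro c a ⟨h1, h2, h3⟩
    simp [h1, h2, h3]
  · rintro i a ⟨h1, h2, h3⟩
    rw [twist_gen_mul, map_mul]
    have hg : partialMatrix R deg j (gen R deg i) = !![R.chi (deg i) (-deg j) • gen R deg i,
      if i = j then 1 else 0; 0, gen R deg i] := freeLift_gen R deg _ _ i
    simp [Matrix.mul_apply, Fin.sum_univ_two, h1, h2, h3, hg]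

/-- `∂_j x_i = δ_{ij}`. -/
lemma partialD_gen (i j : Fin N) :
    partialD R deg j (gen R deg i) = if i = j then 1 else 0 := by
  have hg : partialMatrix R deg j (gen R deg i) = !![R.chi (deg i) (-deg j) • gen R deg i,
      if i = j then 1 else 0; 0, gen R deg i] := freeLift_gen R deg _ _ i
  change partialMatrix R deg j (gen R deg i) 0 1 = _
  rw [hg]; rfl

/-- `∂_j (a a') = ∂_j(a) a' + R(a₍₋₁₎ ⊗ t_{-m_j}) a₍₀₎ ∂_j(a')`. -/
lemma partialD_mul (j : Fin N) (a b : FreeCarrier R deg) :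
    partialD R deg j (a * b) =
      partialD R deg j a * b + R.twist _ (-deg j) a * partialD R deg j b := by
  change partialMatrix R deg j (a * b) 0 1 = partialMatrix R deg j a 0 1 * b +
    R.twist _ (-deg j) a * partialMatrix R deg j b 0 1
  obtain ⟨h1, -, -⟩ := partialMatrix_entries R deg j a
  obtain ⟨-, -, h3⟩ := partialMatrix_entries R deg j b
  rw [map_mul, Matrix.mul_apply, Fin.sum_univ_two, h1, h3, add_comm]

lemma partialD_one (j : Fin N) : partialD R deg j 1 = 0 := by
  change partialMatrix R deg j 1 0 1 = 0
  rw [map_one]; rfl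

lemma comp_partialD (j : Fin N) (a : FreeCarrier R deg) (q : Wt n) :
    comp K (q - deg j) (partialD R deg j a) = partialD R deg j (comp K q a) := by
  revert q
  refine free_induction (P := fun a => ∀ q : Wt n, comp K (q - deg j) (partialD R deg j a) =
    partialD R deg j (comp K q a)) a ?_ ?_ ?_ ?_
  · intro q
    rw [partialD_one, map_zero, comp_of_homog (free_one_coinv R deg)]
    split_ifs
    · exact (partialD_one R deg j).symm
    · exact (map_zero _).symm
  · intro a b ha hb q; simp only [map_add, ha, hb]
  · intro c a ha q; simp only [map_smul, ha]
  · intro i a ha q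
    rw [comp_gen_mul, partialD_mul, partialD_mul, partialD_gen,
      R.twist_homog _ (gen_homog R deg i), ← ha, map_add, smul_mul_assoc, map_smul, comp_gen_mul,
      smul_mul_assoc, sub_right_comm]
    split_ifs with h
    · subst h; simp
    · simp

lemma partialD_homog (j : Fin N) {q : Wt n} {a : FreeCarrier R deg} (ha : IsHomog (K := K) q a) :
    IsHomog (K := K) (q - deg j) (partialD R deg j a) := by
  have h := comp_partialD R deg j a q
  rw [comp_of_homog ha, if_pos rfl] at h
  rw [← h]
  exact comp_homog _ _

end Partial


namespace Presentation

variable {A : ToricAlg R} (P : Presentation A)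

/-- The vector space underlying `∐_j A[-m_j]`, with elements written `L = ∑_j L_j ∂_j`. -/
def Ambient : Type u := Fin P.N → A

instance : AddCommGroup P.Ambient := inferInstanceAs (AddCommGroup (Fin P.N → A))
instance : Module K P.Ambient := inferInstanceAs (Module K (Fin P.N → A))

/-- The inclusion of the `j`-th summand, `a ↦ a ∂_j`. -/
def inc (j : Fin P.N) : A →ₗ[K] P.Ambient := LinearMap.single K (fun _ : Fin P.N => (A : Type u)) j

/-- The `j`-th component `L ↦ L_j`. -/
def coord (j : Fin P.N) : P.Ambient →ₗ[K] A := LinearMap.proj (φ := fun _ : Fin P.N => (A : Type u)) j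

lemma ambient_sum (L : P.Ambient) : L = ∑ j, P.inc j (P.coord j L) := by
  funext i
  have := Finset.sum_apply i Finset.univ fun j => (P.inc j (P.coord j L) : Fin P.N → A)
  refine Eq.trans ?_ this.symm
  rw [Finset.sum_eq_single i]
  · exact (Pi.single_eq_same (M := fun _ : Fin P.N => (A : Type u)) i _).symm
  · intro j _ hj
    exact Pi.single_eq_of_ne (M := fun _ : Fin P.N => (A : Type u)) (Ne.symm hj) _
  · simp

lemma coord_inc (i j : Fin P.N) (a : A) : P.coord i (P.inc j a) = if i = j then a else 0 := by
  change Pi.single (M := fun _ : Fin P.N => (A : Type u)) j a i = _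
  rw [Pi.single_apply]

/-- The coaction `∑_j L_j ∂_j ↦ ∑_j (L_j)₍₋₁₎ t_{-m_j} ⊗ (L_j)₍₀₎ ∂_j`. -/
def ambientCoact : P.Ambient →ₗ[K] TorusHopf K n ⊗[K] P.Ambient :=
  ∑ j, TensorProduct.map (LinearMap.mulRight K (t K (-P.deg j))) (P.inc j) ∘ₗ
    coact (K := K) (n := n) A ∘ₗ P.coord j

lemma ambientCoact_inc (j : Fin P.N) {p : Wt n} {a : A} (ha : IsHomog (K := K) p a) :
    P.ambientCoact (P.inc j a) = t K (p - P.deg j) ⊗ₜ P.inc j a := by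
  unfold IsHomog at ha
  rw [ambientCoact, LinearMap.sum_apply, Finset.sum_eq_single j]
  · simp only [LinearMap.comp_apply, coord_inc, if_true, ha, TensorProduct.map_tmul,
      LinearMap.mulRight_apply, t_mul, sub_eq_add_neg]
  · intro i _ hi
    simp only [LinearMap.comp_apply, coord_inc, if_neg hi, map_zero]
  · simp

/-- The comodule `∐_j A[-m_j]`. -/
instance ambientComod : Comod K n P.Ambient :=
  Comod.ofSpan _ P.ambientCoact (by
    rw [eq_top_iff]
    rintro L -
    rw [P.ambient_sum L]
    refine Submodule.sum_mem _ fun j _ => ?_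
    refine homog_induction (K := K) (n := n) (P := fun a => P.inc j a ∈ Submodule.span K _)
      (P.coord j L) (by rw [map_zero]; exact zero_mem _)
      (fun x y hx hy => by rw [map_add]; exact add_mem hx hy) fun p a ha => ?_
    exact Submodule.subset_span ⟨_, P.ambientCoact_inc j ha⟩)

lemma inc_homog (j : Fin P.N) {p : Wt n} {a : A} (ha : IsHomog (K := K) p a) :
    IsHomog (K := K) (p - P.deg j) (P.inc j a) := P.ambientCoact_inc j ha

lemma coord_comp (j : Fin P.N) (q : Wt n) (L : P.Ambient) :
    P.coord j (comp K q L) = comp K (q + P.deg j) (P.coord j L) := by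
  rw [P.ambient_sum L]
  simp only [map_sum]
  refine Finset.sum_congr rfl fun i _ => ?_
  refine homog_induction (K := K) (n := n) (P := fun a => P.coord j (comp K q (P.inc i a)) =
    comp K (q + P.deg j) (P.coord j (P.inc i a))) (P.coord i L) (by simp only [map_zero])
      (fun x y hx hy => by simp only [map_add, hx, hy]) fun p a ha => ?_
  rw [comp_of_homog (P.inc_homog i ha), coord_inc]
  by_cases hij : j = i
  · subst hij
    rw [if_pos rfl, comp_of_homog ha]
    by_cases h : p = q + P.deg j
    · rw [if_pos h, if_pos (by rw [h]; abel), coord_inc, if_pos rfl]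
    · rw [if_neg h, if_neg (fun h' => h (by rw [← h']; abel)), map_zero]
  · rw [if_neg hij, map_zero]
    split_ifs
    · rw [coord_inc, if_neg hij]
    · rw [map_zero]

lemma coord_homog (j : Fin P.N) {q : Wt n} {L : P.Ambient} (hL : IsHomog (K := K) q L) :
    IsHomog (K := K) (q + P.deg j) (P.coord j L) := by
  have := P.coord_comp j q L
  rw [comp_of_homog hL, if_pos rfl] at this
  rw [this]
  exact comp_homog _ _

/-- The map `L ⊗ a ↦ ∑_j L_j ∂_j(a)`, for `L` in `∐_j A[-m_j]` and `a` in `F_{m_1,…,m_N}`. -/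
def evFree : P.Ambient →ₗ[K] FreeCarrier R P.deg →ₗ[K] A :=
  ∑ j, ((LinearMap.mul K A).compl₂ (P.proj.toLinearMap ∘ₗ partialD R P.deg j)) ∘ₗ P.coord j

lemma evFree_apply (L : P.Ambient) (a : FreeCarrier R P.deg) :
    P.evFree L a = ∑ j, P.coord j L * P.proj (partialD R P.deg j a) := by
  simp [evFree, LinearMap.sum_apply]

lemma proj_homog {q : Wt n} {a : FreeCarrier R P.deg} (ha : IsHomog (K := K) q a) :
    IsHomog (K := K) q (P.proj a) := P.proj_equivariant.map_homog ha

lemma evFree_homog {p q : Wt n} {L : P.Ambient} {a : FreeCarrier R P.deg}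
    (hL : IsHomog (K := K) p L) (ha : IsHomog (K := K) q a) :
    IsHomog (K := K) (p + q) (P.evFree L a) := by
  rw [evFree_apply]
  refine Finset.sum_induction _ (fun x => IsHomog (K := K) (p + q) x) (fun _ _ h h' => h.add h')
    (by unfold IsHomog; simp) fun j _ => ?_
  have := A.mul_homog (P.coord_homog j hL) (P.proj_homog (partialD_homog R P.deg j ha))
  rwa [show p + P.deg j + (q - P.deg j) = p + q by abel] at this

/-- The subspace of those `L` with `∑_j L_j ∂_j(f_k) = 0` for all `k`. -/
def der : Submodule K P.Ambient where
  carrier := {L | ∀ k, P.evFree L (P.rel k) = 0}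
  add_mem' {a b} ha hb k := by
    rw [map_add, LinearMap.add_apply, ha k, hb k, add_zero]
  zero_mem' k := by rw [map_zero, LinearMap.zero_apply]
  smul_mem' c a ha k := by rw [map_smul, LinearMap.smul_apply, ha k, smul_zero]

lemma comp_mem_der {L : P.Ambient} (hL : L ∈ P.der) (q : Wt n) : comp K q L ∈ P.der := by
  intro k
  have h : comp K (q + P.relDeg k) (P.evFree L (P.rel k)) = P.evFree (comp K q L) (P.rel k) := by
    refine homog_induction (K := K) (n := n) (P := fun L => comp K (q + P.relDeg k)
      (P.evFree L (P.rel k)) = P.evFree (comp K q L) (P.rel k)) L (by simp)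
      (fun x y hx hy => by simp only [map_add, LinearMap.add_apply, hx, hy]) fun p L hL => ?_
    rw [comp_of_homog (P.evFree_homog hL (P.rel_homog k)), comp_of_homog hL]
    by_cases h : p = q
    · rw [if_pos h, if_pos (by rw [h])]
    · rw [if_neg h, if_neg (fun h' => h (add_right_cancel h'))]; simp
  rw [← h, hL k, map_zero]

lemma coact_mem_der (L : P.der) : (coact (K := K) (n := n) P.Ambient ∘ₗ P.der.subtype) L ∈
    LinearMap.range (P.der.subtype.lTensor (TorusHopf K n)) := by
  obtain ⟨s, hs⟩ := tensor_expand (coact (K := K) (n := n) P.Ambient (L : P.Ambient))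
  rw [LinearMap.comp_apply, Submodule.subtype_apply, hs s subset_rfl]
  refine Submodule.sum_mem _ fun m _ =>
    ⟨t K m ⊗ₜ ⟨comp K m (L : P.Ambient), P.comp_mem_der L.2 m⟩, ?_⟩
  rw [LinearMap.lTensor_tmul]; rfl

/-- The comodule `der(A)` of braided derivations: a subcomodule of `∐_j A[-m_j]`. -/
instance derComod : Comod K n P.der := subComod P.der P.coact_mem_der

lemma der_homog_iff {m : Wt n} {L : P.der} :
    IsHomog (K := K) m L ↔ IsHomog (K := K) m (L : P.Ambient) :=
  subComod_homog P.der P.coact_mem_der m L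

lemma evFree_mul {p q : Wt n} {L : P.Ambient} {a : FreeCarrier R P.deg}
    (hL : IsHomog (K := K) p L) (ha : IsHomog (K := K) q a) (b : FreeCarrier R P.deg) :
    P.evFree L (a * b) = P.evFree L a * P.proj b + R.chi q p • (P.proj a * P.evFree L b) := by
  simp only [evFree_apply, Finset.sum_mul, Finset.mul_sum, Finset.smul_sum]
  rw [← Finset.sum_add_distrib]
  refine Finset.sum_congr rfl fun j _ => ?_
  rw [partialD_mul, map_add, map_mul, map_mul, mul_add, mul_assoc, R.twist_homog _ ha, map_smul,
    smul_mul_assoc, mul_smul_comm, ← mul_assoc (P.coord j L) (P.proj a),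
    A.comm_homog (P.coord_homog j hL) (P.proj_homog ha), smul_mul_assoc, smul_smul,
    ← R.chi_add_right, neg_add_cancel_comm_assoc, mul_assoc]

lemma evFree_eq_zero (L : P.der) {a : FreeCarrier R P.deg} (ha : P.proj a = 0) :
    P.evFree L a = 0 := by
  rw [P.proj_eq_zero_iff] at ha
  suffices h : P.proj a = 0 ∧ ∀ L : P.der, P.evFree L a = 0 from h.2 L
  have hspan : ∀ x, x ∈ TwoSidedIdeal.span (Set.range P.rel) → P.proj x = 0 := fun x hx =>
    (P.proj_eq_zero_iff x).2 hx
  refine ⟨hspan a ha, ?_⟩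
  refine TwoSidedIdeal.span_induction (p := fun x _ => ∀ L : P.der, P.evFree L x = 0)
    ?_ ?_ ?_ ?_ ?_ ?_ ha
  · rintro _ ⟨k, rfl⟩ L; exact L.2 k
  · intro L; exact map_zero _
  · intro x y _ _ hx hy L; rw [map_add, hx, hy, add_zero]
  · intro x _ hx L; rw [map_neg, hx, neg_zero]
  · intro b x hx h L
    refine homog_induction (K := K) (n := n) (P := fun L : P.der => P.evFree L (b * x) = 0) L
      (by simp) (fun L L' h h' => by
        rw [Submodule.coe_add, map_add, LinearMap.add_apply, h, h', add_zero]) fun p L hL => ?_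
    refine homog_induction (K := K) (n := n) (P := fun b => P.evFree L (b * x) = 0) b
      (by simp) (fun b b' h h' => by rw [add_mul, map_add, h, h', add_zero]) fun q b hb => ?_
    rw [P.evFree_mul (P.der_homog_iff.1 hL) hb, hspan x hx, h, mul_zero, mul_zero, smul_zero,
      add_zero]
  · intro b x hx h L
    refine homog_induction (K := K) (n := n) (P := fun L : P.der => P.evFree L (x * b) = 0) L
      (by simp) (fun L L' h h' => by
        rw [Submodule.coe_add, map_add, LinearMap.add_apply, h, h', add_zero]) fun p L hL => ?_
    rw [evFree_apply]
    have h0 : ∀ j, P.proj (partialD R P.deg j (x * b)) = P.proj (partialD R P.deg j x) * P.proj b := by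
      intro j
      have htw : P.proj (R.twist (FreeCarrier R P.deg) (-P.deg j) x) = 0 := by
        have := R.twist_equivariant P.proj_equivariant (-P.deg j) x
        rw [AlgHom.toLinearMap_apply, AlgHom.toLinearMap_apply, hspan x hx, map_zero] at this
        exact this
      rw [partialD_mul, map_add, map_mul, map_mul, htw, zero_mul, add_zero]
    simp only [h0, ← mul_assoc]
    rw [← Finset.sum_mul, ← evFree_apply, h, zero_mul]

lemma evFree_congr (L : P.der) {a b : FreeCarrier R P.deg} (h : P.proj a = P.proj b) :
    P.evFree L a = P.evFree L b := by
  rw [← sub_eq_zero, ← map_sub]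
  exact P.evFree_eq_zero L (by rw [map_sub, h, sub_self])

/-- The evaluation `ev(L ⊗ a) = ∑_j L_j ∂_j(a)` of a braided derivation on `a ∈ A`, where `∂_j(a)`
is computed on a representative of `a` in `F_{m_1,…,m_N}`. -/
def ev : P.der →ₗ[K] A →ₗ[K] A :=
  LinearMap.mk₂ K (fun L a => P.evFree L (Function.surjInv P.proj_surjective a))
    (fun L L' a => by rw [Submodule.coe_add, map_add, LinearMap.add_apply])
    (fun c L a => by rw [Submodule.coe_smul, map_smul, LinearMap.smul_apply])
    (fun L a b => by
      rw [← map_add]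
      exact P.evFree_congr L (by simp only [map_add, Function.surjInv_eq]))
    (fun c L a => by
      rw [← map_smul]
      exact P.evFree_congr L (by simp only [map_smul, Function.surjInv_eq]))

lemma ev_proj (L : P.der) (a : FreeCarrier R P.deg) : P.ev L (P.proj a) = P.evFree L a :=
  P.evFree_congr L (Function.surjInv_eq P.proj_surjective _)

lemma proj_comp {q : Wt n} {x : FreeCarrier R P.deg} (hx : IsHomog (K := K) q (P.proj x)) :
    P.proj (comp K q x) = P.proj x := by
  have h1 : P.proj (comp K q x) = comp K q (P.proj x) := by
    refine homog_induction (K := K) (n := n) (P := fun x => P.proj (comp K q x) =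
      comp K q (P.proj x)) x (by simp) (fun x y hx hy => by simp only [map_add, hx, hy])
      fun m x hx => ?_
    rw [comp_of_homog hx, comp_of_homog (P.proj_homog hx)]
    split_ifs <;> simp
  rw [h1, comp_of_homog hx, if_pos rfl]

lemma ev_homog {p q : Wt n} {L : P.der} {a : A} (hL : IsHomog (K := K) p L)
    (ha : IsHomog (K := K) q a) : IsHomog (K := K) (p + q) (P.ev L a) := by
  obtain ⟨x, rfl⟩ := P.proj_surjective a
  have hx := P.proj_comp ha
  rw [← hx, ev_proj]
  exact P.evFree_homog (P.der_homog_iff.1 hL) (comp_homog q x)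

/-- The braided Leibniz rule. -/
lemma ev_mul {p q : Wt n} {L : P.der} {a : A} (hL : IsHomog (K := K) p L)
    (ha : IsHomog (K := K) q a) (b : A) :
    P.ev L (a * b) = P.ev L a * b + R.chi q p • (a * P.ev L b) := by
  obtain ⟨x, rfl⟩ := P.proj_surjective a
  obtain ⟨y, rfl⟩ := P.proj_surjective b
  have hx := P.proj_comp ha
  rw [← hx, ← map_mul, ev_proj, ev_proj, ev_proj,
    P.evFree_mul (P.der_homog_iff.1 hL) (comp_homog q x)]

end Presentation

/-! ### Toric noncommutative spaces and the Zariski topology -/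

/-- The product of the coproduct algebra `A ⊔ B`, whose underlying comodule is `A ⊗ B`:
`(a ⊗ b)(a' ⊗ b') = R(a'₍₋₁₎ ⊗ b₍₋₁₎) (a a'₍₀₎) ⊗ (b₍₀₎ b')`. -/
def coprodMul (A B : ToricAlg R) : A ⊗[K] B →ₗ[K] A ⊗[K] B →ₗ[K] A ⊗[K] B :=
  TensorProduct.curry
    (TensorProduct.map (LinearMap.mul' K A) (LinearMap.mul' K B) ∘ₗ
      (TensorProduct.assoc K A A (B ⊗[K] B)).symm.toLinearMap ∘ₗ
      (TensorProduct.assoc K A B B).toLinearMap.lTensor A ∘ₗ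
      ((R.braid B A).rTensor B).lTensor A ∘ₗ
      (TensorProduct.assoc K B A B).symm.toLinearMap.lTensor A ∘ₗ
      (TensorProduct.assoc K A B (A ⊗[K] B)).toLinearMap)

lemma coprodMul_homog {A B : ToricAlg R} {m p : Wt n} (a : A) {b : B} {a' : A} (b' : B)
    (hb : IsHomog (K := K) m b) (ha' : IsHomog (K := K) p a') :
    coprodMul A B (a ⊗ₜ b) (a' ⊗ₜ b') = R.chi p m • ((a * a') ⊗ₜ (b * b')) := by
  simp [coprodMul, R.braid_homog hb ha', TensorProduct.smul_tmul']

/-- The commutative ring `B^0` of coinvariants. -/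
def coinvAlg (B : ToricAlg R) : Subalgebra K B where
  carrier := {b | IsHomog (K := K) (0 : Wt n) b}
  mul_mem' {a b} ha hb := by
    have := B.mul_homog ha hb
    rwa [add_zero] at this
  add_mem' ha hb := ha.add hb
  algebraMap_mem' r := by
    rw [Set.mem_ofPred_eq, Algebra.algebraMap_eq_smul_one]
    exact B.one_coinv.smul r

lemma coinvAlg_mul_comm (B : ToricAlg R) (a : coinvAlg B) (b : B) : (a : B) * b = b * a := by
  refine homog_induction (K := K) (n := n) (P := fun b => (a : B) * b = b * a) b (by simp)
    (fun x y hx hy => by simp only [mul_add, add_mul, hx, hy]) fun m b hb => ?_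
  rw [B.comm_homog a.2 hb, R.chi_zero_right, one_smul]

lemma coprodMul_left_one {A B : ToricAlg R} (a : A) (w : A ⊗[K] B) :
    coprodMul A B (a ⊗ₜ 1) w = a • w := by
  refine tensor_homog_induction (K := K) (n := n)
    (P := fun w => coprodMul A B (a ⊗ₜ 1) w = a • w) w (by simp)
    (fun x y hx hy => by simp only [map_add, smul_add, hx, hy]) fun m p a' b ha' _ => ?_
  rw [coprodMul_homog a b B.one_coinv ha', R.chi_zero_right, one_smul, one_mul,
    TensorProduct.smul_tmul', smul_eq_mul]

lemma smul_coinv_homog {B : ToricAlg R} {V : Type u} [AddCommGroup V] [Module K V] [Comod K n V]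
    (b : coinvAlg B) {m : Wt n} {w : B ⊗[K] V} (hw : IsHomog (K := K) m w) :
    IsHomog (K := K) m ((b : B) • w) := by
  have key : ∀ w : B ⊗[K] V, ∀ m : Wt n,
      comp K m ((b : B) • w) = (b : B) • comp K m w := by
    intro w m
    refine tensor_homog_induction (K := K) (n := n)
      (P := fun w => comp K m ((b : B) • w) = (b : B) • comp K m w) w (by simp)
      (fun x y hx hy => by simp only [map_add, smul_add, hx, hy]) fun p q b' v hb' hv => ?_
    have h1 : IsHomog (K := K) (p + q) ((b : B) • (b' ⊗ₜ[K] v)) := by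
      rw [TensorProduct.smul_tmul', smul_eq_mul]
      have := (B.mul_homog b.2 hb').tmul hv
      rwa [zero_add] at this
    rw [comp_of_homog h1, comp_of_homog (hb'.tmul hv)]
    split_ifs <;> simp
  have := key w m
  rw [comp_of_homog hw, if_pos rfl] at this
  rw [← this]
  exact comp_homog _ _

/-- The category `ᴴ𝒮` of toric noncommutative spaces: the opposite of the category of finitely
presented algebras. The object `X_A` is written `⟨A, _⟩`. -/
structure ToricSpace (R : Cotriangular K n) where
  /-- the function algebra `A` of `X_A` -/
  alg : ToricAlg R
  finPres : Nonempty (Presentation alg)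

instance : Category.{u} (ToricSpace R) where
  Hom X Y := ToricHom Y.alg X.alg
  id X := ToricHom.id X.alg
  comp f g := ToricHom.comp f g

/-- The algebra morphism `f^* : A → B` of `f : X_B ⟶ X_A`. -/
def pull {X Y : ToricSpace R} (f : X ⟶ Y) : ToricHom Y.alg X.alg := f

/-- The morphism of spaces with given algebra morphism. -/
def ofPull {X Y : ToricSpace R} (f : ToricHom Y.alg X.alg) : X ⟶ Y := f

/-- `ℓ : A → A'` is a localization of `A` at `s`. -/
structure IsLocalizationAt {A A' : ToricAlg R} (s : A) (l : ToricHom A A') : Prop where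
  isUnit : IsUnit (l s)
  existsUnique_lift : ∀ (B : ToricAlg R) (κ : ToricHom A B), IsUnit (κ s) →
    ∃! κ' : ToricHom A' B, κ'.comp l = κ

/-- The Zariski covering families: finite families `X_{A[s_i⁻¹]} ⟶ X_A` with coinvariant `s_i`
such that `∑ a_i s_i = 1` for some `a_i`. -/
def zariskiPrecoverage (R : Cotriangular K n) : Precoverage (ToricSpace R) where
  coverings X := {S | ∃ (k : ℕ) (Y : Fin k → ToricSpace R) (f : ∀ i, Y i ⟶ X) (s a : Fin k → X.alg),
    (∀ i, IsHomog (K := K) (0 : Wt n) (s i)) ∧ (∀ i, IsLocalizationAt (s i) (pull (f i))) ∧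
    ∑ i, a i * s i = 1 ∧ S = Presieve.ofArrows Y f}

/-- The Grothendieck topology on `ᴴ𝒮` generated by the Zariski covering families. The topos `ᴴ𝒢`
consists of the sheaves for this topology. -/
def zariskiTopology (R : Cotriangular K n) : GrothendieckTopology (ToricSpace R) :=
  (zariskiPrecoverage R).toGrothendieck

/-! ### The line object, the functor `j`, and derivations as presheaves of modules -/

/-- The ring homomorphism `A^0 → B^0`. -/
def coinvMap {A B : ToricAlg R} (f : ToricHom A B) : coinvAlg A →+* coinvAlg B where
  toFun a := ⟨f.hom a, f.map_homog a.2⟩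
  map_one' := Subtype.ext (map_one f.hom)
  map_mul' a b := Subtype.ext (map_mul f.hom (a : A) b)
  map_zero' := Subtype.ext (map_zero f.hom)
  map_add' a b := Subtype.ext (map_add f.hom (a : A) b)

/-- The line object with its ring structure, `X_B ↦ Hom(F_0, B) ≅ B^0`. -/
def lineRing (R : Cotriangular K n) : (ToricSpace R)ᵒᵖ ⥤ RingCat.{u} where
  obj X := RingCat.of (coinvAlg X.unop.alg)
  map f := RingCat.ofHom (coinvMap (pull f.unop))

lemma rTensor_smul (V : Type u) [AddCommGroup V] [Module K V] {A B : ToricAlg R} (f : ToricHom A B) (a : A) (w : A ⊗[K] V) :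
    f.hom.toLinearMap.rTensor V (a • w) = f.hom a • f.hom.toLinearMap.rTensor V w := by
  induction w with
  | zero => simp
  | add x y hx hy => simp only [smul_add, map_add, hx, hy]
  | tmul b v => simp [TensorProduct.smul_tmul']

section J

variable (V : Type u) [AddCommGroup V] [Module K V] [Comod K n V]

instance jModule (B : ToricAlg R) : Module (coinvAlg B) (coinv K n (B ⊗[K] V)) where
  smul b w := ⟨(b : B) • (w : B ⊗[K] V), smul_coinv_homog b w.2⟩
  one_smul w := Subtype.ext (one_smul B (w : B ⊗[K] V))
  mul_smul a b w := Subtype.ext (mul_smul (a : B) (b : B) (w : B ⊗[K] V))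
  smul_zero a := Subtype.ext (smul_zero (a : B))
  smul_add a v w := Subtype.ext (smul_add (a : B) (v : B ⊗[K] V) w)
  add_smul a b w := Subtype.ext (add_smul (a : B) (b : B) (w : B ⊗[K] V))
  zero_smul w := Subtype.ext (zero_smul B (w : B ⊗[K] V))

lemma rTensor_equivariant {A B : ToricAlg R} (f : ToricHom A B) :
    IsEquivariant (K := K) (n := n) (f.hom.toLinearMap.rTensor V) := by
  refine LinearMap.ext fun x => ?_
  refine tensor_homog_induction (K := K) (n := n) (P := fun x =>
      ((f.hom.toLinearMap.rTensor V).lTensor (TorusHopf K n) ∘ₗ coact (A ⊗[K] V)) x =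
        (coact (B ⊗[K] V) ∘ₗ f.hom.toLinearMap.rTensor V) x) x (by simp only [map_zero])
      (fun x y hx hy => by simp only [map_add, hx, hy]) fun m p a v ha hv => ?_
  have h := ha.tmul hv
  have h' := (f.map_homog ha).tmul hv
  unfold IsHomog at h h'
  rw [LinearMap.comp_apply, h, LinearMap.lTensor_tmul, LinearMap.comp_apply,
    LinearMap.rTensor_tmul]
  exact h'.symm

/-- The map `f^* ⊗ id : (A ⊗ V)^0 → (B ⊗ V)^0`. -/
def jMap {A B : ToricAlg R} (f : ToricHom A B) :
    coinv K n (A ⊗[K] V) →+ coinv K n (B ⊗[K] V) where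
  toFun w := ⟨f.hom.toLinearMap.rTensor V w, (rTensor_equivariant V f).map_homog w.2⟩
  map_zero' := Subtype.ext (map_zero _)
  map_add' _ _ := Subtype.ext (map_add _ _ _)

/-- The underlying presheaf of abelian groups of `j(V)`, `X_B ↦ (B ⊗ V)^0`. -/
def jAb (R : Cotriangular K n) : (ToricSpace R)ᵒᵖ ⥤ AddCommGrpCat.{u} where
  obj X := AddCommGrpCat.of (coinv K n (X.unop.alg ⊗[K] V))
  map f := AddCommGrpCat.ofHom (jMap V (pull f.unop))
  map_id X := by
    ext w
    exact LinearMap.congr_fun (LinearMap.rTensor_id V (X.unop.alg : Type u)) w.1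
  map_comp f g := by
    ext w
    exact LinearMap.congr_fun (LinearMap.rTensor_comp V
      (pull g.unop).hom.toLinearMap (pull f.unop).hom.toLinearMap) w.1

instance (X : (ToricSpace R)ᵒᵖ) : Module ((lineRing R).obj X) ((jAb V R).obj X) :=
  jModule V X.unop.alg

/-- The presheaf of modules `j(V)`, with `b · (b' ⊗ v) = (b b') ⊗ v`. -/
def jMod (R : Cotriangular K n) : PresheafOfModules.{u} (lineRing R) :=
  PresheafOfModules.ofPresheaf (jAb V R) (fun _ _ f r m =>
    Subtype.ext (rTensor_smul V (pull f.unop) r.1 m.1))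

end J

section Der

variable (A : ToricAlg R)

/-- `ᴴDer(A, B ⊔ A)`: the equivariant linear maps `v : A → B ⊔ A` with
`v(a a') = v(a)(1 ⊗ a') + (1 ⊗ a) v(a')`. -/
def hDer (B : ToricAlg R) : Submodule K (A →ₗ[K] B ⊗[K] A) where
  carrier := {v | IsEquivariant (K := K) (n := n) v ∧ ∀ a a' : A, v (a * a') =
    coprodMul B A (v a) (1 ⊗ₜ a') + coprodMul B A (1 ⊗ₜ a) (v a')}
  add_mem' {v w} hv hw := by
    refine ⟨isEquivariant_of_homog fun m a ha =>
      (hv.1.map_homog ha).add (hw.1.map_homog ha), fun a a' => ?_⟩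
    simp only [LinearMap.add_apply, map_add, hv.2 a a', hw.2 a a']
    abel
  zero_mem' := by
    refine ⟨isEquivariant_of_homog fun m a _ => ?_, fun a a' => by simp⟩
    unfold IsHomog; simp
  smul_mem' c v hv := by
    refine ⟨isEquivariant_of_homog fun m a ha => (hv.1.map_homog ha).smul c, fun a a' => ?_⟩
    simp only [LinearMap.smul_apply, map_smul, hv.2 a a', smul_add]

variable {A}

lemma coprodMul_smul_left {B : ToricAlg R} (b : B) (v w : B ⊗[K] A) :
    coprodMul B A (b • v) w = b • coprodMul B A v w := by
  refine tensor_homog_induction (K := K) (n := n)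
    (P := fun v => coprodMul B A (b • v) w = b • coprodMul B A v w) v (by simp)
    (fun x y hx hy => by simp only [map_add, smul_add, LinearMap.add_apply, hx, hy])
    fun m p b' a _ ha => ?_
  refine tensor_homog_induction (K := K) (n := n)
    (P := fun w => coprodMul B A (b • (b' ⊗ₜ a)) w = b • coprodMul B A (b' ⊗ₜ a) w) w (by simp)
    (fun x y hx hy => by simp only [map_add, smul_add, hx, hy])
    fun m' p' b'' a' hb'' _ => ?_
  rw [TensorProduct.smul_tmul', coprodMul_homog _ _ ha hb'', coprodMul_homog _ _ ha hb'',
    smul_comm (b : B), TensorProduct.smul_tmul' b, smul_eq_mul, smul_eq_mul, mul_assoc]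

lemma coprodMul_smul_right {B : ToricAlg R} (b : coinvAlg B) (v w : B ⊗[K] A) :
    coprodMul B A v ((b : B) • w) = (b : B) • coprodMul B A v w := by
  refine tensor_homog_induction (K := K) (n := n)
    (P := fun v => coprodMul B A v ((b : B) • w) = (b : B) • coprodMul B A v w) v (by simp)
    (fun x y hx hy => by simp only [map_add, smul_add, LinearMap.add_apply, hx, hy])
    fun m p b' a _ ha => ?_
  refine tensor_homog_induction (K := K) (n := n)
    (P := fun w => coprodMul B A (b' ⊗ₜ a) ((b : B) • w) =
      (b : B) • coprodMul B A (b' ⊗ₜ a) w) w (by simp)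
    (fun x y hx hy => by simp only [map_add, smul_add, hx, hy])
    fun m' p' b'' a' hb'' _ => ?_
  have h : IsHomog (K := K) m' ((b : B) * b'') := by
    have := B.mul_homog b.2 hb''
    rwa [zero_add] at this
  rw [TensorProduct.smul_tmul', smul_eq_mul, coprodMul_homog _ _ ha h, coprodMul_homog _ _ ha hb'',
    smul_comm (b : B), TensorProduct.smul_tmul' (b : B), smul_eq_mul, ← mul_assoc, ← mul_assoc,
    coinvAlg_mul_comm B b b']

/-- The action `(b · v)(a) = (b ⊗ 1) v(a)` of `B^0` on `ᴴDer(A, B ⊔ A)`. -/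
def hDerSMul {B : ToricAlg R} (b : coinvAlg B) (v : hDer A B) : hDer A B :=
  ⟨coprodMul B A ((b : B) ⊗ₜ 1) ∘ₗ v.1, by
    refine ⟨isEquivariant_of_homog fun m a ha => ?_, fun a a' => ?_⟩
    · rw [LinearMap.comp_apply, coprodMul_left_one]
      exact smul_coinv_homog b (v.2.1.map_homog ha)
    · simp only [LinearMap.comp_apply, coprodMul_left_one]
      rw [v.2.2, smul_add, coprodMul_smul_left, coprodMul_smul_right]⟩

lemma hDerSMul_apply {B : ToricAlg R} (b : coinvAlg B) (v : hDer A B) (a : A) :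
    (hDerSMul b v).1 a = (b : B) • v.1 a := coprodMul_left_one _ _

instance hDerModule (B : ToricAlg R) : Module (coinvAlg B) (hDer A B) where
  smul := hDerSMul
  one_smul v := Subtype.ext (LinearMap.ext fun a => by
    refine (hDerSMul_apply _ v a).trans (one_smul B _))
  mul_smul b c v := Subtype.ext (LinearMap.ext fun a => by
    refine (hDerSMul_apply _ v a).trans ?_
    refine Eq.trans ?_ (hDerSMul_apply b (hDerSMul c v) a).symm
    rw [hDerSMul_apply]
    exact mul_smul (b : B) (c : B) _)
  smul_zero b := Subtype.ext (LinearMap.ext fun a =>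
    (hDerSMul_apply b 0 a).trans (smul_zero (b : B)))
  smul_add b v w := Subtype.ext (LinearMap.ext fun a => by
    refine (hDerSMul_apply b (v + w) a).trans ?_
    refine Eq.trans (smul_add (b : B) (v.1 a) (w.1 a)) ?_
    exact congrArg₂ _ (hDerSMul_apply b v a).symm (hDerSMul_apply b w a).symm)
  add_smul b c v := Subtype.ext (LinearMap.ext fun a => by
    refine (hDerSMul_apply (b + c) v a).trans ?_
    refine Eq.trans (add_smul (b : B) (c : B) (v.1 a)) ?_
    exact congrArg₂ _ (hDerSMul_apply b v a).symm (hDerSMul_apply c v a).symm)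
  zero_smul v := Subtype.ext (LinearMap.ext fun a =>
    (hDerSMul_apply 0 v a).trans (zero_smul B _))

lemma rTensor_coprodMul {B C : ToricAlg R} (f : ToricHom B C) (v w : B ⊗[K] A) :
    f.hom.toLinearMap.rTensor A (coprodMul B A v w) =
      coprodMul C A (f.hom.toLinearMap.rTensor A v) (f.hom.toLinearMap.rTensor A w) := by
  refine tensor_homog_induction (K := K) (n := n)
    (P := fun v => f.hom.toLinearMap.rTensor A (coprodMul B A v w) =
      coprodMul C A (f.hom.toLinearMap.rTensor A v) (f.hom.toLinearMap.rTensor A w)) v (by simp)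
    (fun x y hx hy => by simp only [map_add, LinearMap.add_apply, hx, hy])
    fun m p b' a _ ha => ?_
  refine tensor_homog_induction (K := K) (n := n)
    (P := fun w => f.hom.toLinearMap.rTensor A (coprodMul B A (b' ⊗ₜ a) w) =
      coprodMul C A (f.hom.toLinearMap.rTensor A (b' ⊗ₜ a)) (f.hom.toLinearMap.rTensor A w))
    w (by simp) (fun x y hx hy => by simp only [map_add, hx, hy])
    fun m' p' b'' a' hb'' _ => ?_
  have h : IsHomog (K := K) m' (f.hom.toLinearMap b'') := f.map_homog hb''
  rw [LinearMap.rTensor_tmul, LinearMap.rTensor_tmul, coprodMul_homog _ _ ha h,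
    coprodMul_homog _ _ ha hb'', map_smul, LinearMap.rTensor_tmul, AlgHom.toLinearMap_apply,
    map_mul]
  rfl

/-- The map `v ↦ (f^* ⊗ id) ∘ v`. -/
def hDerMap {B C : ToricAlg R} (f : ToricHom B C) : hDer A B →+ hDer A C where
  toFun v := ⟨f.hom.toLinearMap.rTensor A ∘ₗ v.1,
    isEquivariant_of_homog fun _ _ ha =>
      (rTensor_equivariant A f).map_homog (v.2.1.map_homog ha), fun a a' => by
    simp only [LinearMap.comp_apply, v.2.2 a a', map_add, rTensor_coprodMul,
      LinearMap.rTensor_tmul, AlgHom.toLinearMap_apply, map_one]⟩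
  map_zero' := Subtype.ext (LinearMap.comp_zero _)
  map_add' v w := Subtype.ext (LinearMap.comp_add _ _ _)

variable (A)

/-- The underlying presheaf of abelian groups of `ᴴDer(A, - ⊔ A)`. -/
def hDerAb : (ToricSpace R)ᵒᵖ ⥤ AddCommGrpCat.{u} where
  obj X := AddCommGrpCat.of (hDer A X.unop.alg)
  map f := AddCommGrpCat.ofHom (hDerMap (pull f.unop))
  map_id X := by
    ext v a
    exact LinearMap.congr_fun (LinearMap.rTensor_id (A : Type u) (X.unop.alg : Type u)) (v.1 a)
  map_comp f g := by
    ext v a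
    exact LinearMap.congr_fun (LinearMap.rTensor_comp (A : Type u)
      (pull g.unop).hom.toLinearMap (pull f.unop).hom.toLinearMap) (v.1 a)

instance (X : (ToricSpace R)ᵒᵖ) : Module ((lineRing R).obj X) ((hDerAb A).obj X) :=
  hDerModule X.unop.alg

/-- The presheaf of modules `ᴴDer(A, - ⊔ A)`. -/
def hDerMod : PresheafOfModules.{u} (lineRing R) :=
  PresheafOfModules.ofPresheaf (hDerAb A) (fun _ _ f r m =>
    Subtype.ext (LinearMap.ext fun a => by
      refine (congrArg _ (hDerSMul_apply r m a)).trans ?_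
      refine (rTensor_smul (A : Type u) (pull f.unop) _ _).trans ?_
      exact (hDerSMul_apply (coinvMap (pull f.unop) r) (hDerMap (pull f.unop) m) a).symm))

end Der

namespace Presentation

variable {A : ToricAlg R} (P : Presentation A)

/-- The linear map `b ⊗ L ↦ (a ↦ b ⊗ ev(L ⊗ a))`. -/
def xiLin (B : ToricAlg R) : B ⊗[K] P.der →ₗ[K] (A →ₗ[K] B ⊗[K] A) :=
  TensorProduct.lift (((LinearMap.llcomp K A A (B ⊗[K] A)).flip ∘ₗ P.ev).flip ∘ₗ
    TensorProduct.mk K B A)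

lemma xiLin_tmul (B : ToricAlg R) (b : B) (L : P.der) (a : A) :
    P.xiLin B (b ⊗ₜ L) a = b ⊗ₜ P.ev L a := by
  simp [xiLin]

lemma xiLin_mem (B : ToricAlg R) (w : coinv K n (B ⊗[K] P.der)) : P.xiLin B w ∈ hDer A B := by
  refine coinv_tensor_induction (K := K) (n := n) (P := fun w => P.xiLin B w ∈ hDer A B) w.1 w.2
    (by rw [map_zero]; exact zero_mem _) (fun x y hx hy => by rw [map_add]; exact add_mem hx hy)
    fun m b L hb hL => ?_
  refine ⟨isEquivariant_of_homog fun q a ha => ?_, fun a a' => ?_⟩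
  · rw [xiLin_tmul]
    have := hb.tmul (P.ev_homog hL ha)
    rwa [neg_add_cancel_left] at this
  · refine homog_induction (K := K) (n := n) (P := fun a => P.xiLin B (b ⊗ₜ L) (a * a') =
      coprodMul B A (P.xiLin B (b ⊗ₜ L) a) (1 ⊗ₜ a') +
        coprodMul B A (1 ⊗ₜ a) (P.xiLin B (b ⊗ₜ L) a')) a (by simp) (fun x y hx hy => by
        simp only [add_mul, map_add, hx, hy, TensorProduct.tmul_add, LinearMap.add_apply]; abel)
      fun q a ha => ?_
    rw [xiLin_tmul, xiLin_tmul, xiLin_tmul, P.ev_mul hL ha,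
      coprodMul_homog _ _ (P.ev_homog hL ha) B.one_coinv, coprodMul_homog _ _ ha hb,
      R.chi_zero_left, one_smul, mul_one, one_mul, R.chi_neg_left, TensorProduct.tmul_add,
      TensorProduct.tmul_smul]

/-- The component `ξ_{X_B} : (B ⊗ der(A))^0 → ᴴDer(A, B ⊔ A)`. -/
def xiApp (B : ToricAlg R) : coinv K n (B ⊗[K] P.der) →+ hDer A B where
  toFun w := ⟨P.xiLin B w, P.xiLin_mem B w⟩
  map_zero' := Subtype.ext (map_zero _)
  map_add' _ _ := Subtype.ext (map_add _ _ _)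

lemma xiLin_rTensor {B C : ToricAlg R} (f : ToricHom B C) (w : B ⊗[K] P.der) (a : A) :
    P.xiLin C (f.hom.toLinearMap.rTensor P.der w) a =
      f.hom.toLinearMap.rTensor A (P.xiLin B w a) := by
  induction w with
  | zero => simp
  | add x y hx hy => simp only [map_add, LinearMap.add_apply, hx, hy]
  | tmul b L => rw [LinearMap.rTensor_tmul, xiLin_tmul, xiLin_tmul, LinearMap.rTensor_tmul]

lemma xiLin_smul {B : ToricAlg R} (b : B) (w : B ⊗[K] P.der) (a : A) :
    P.xiLin B (b • w) a = b • P.xiLin B w a := by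
  induction w with
  | zero => simp
  | add x y hx hy => simp only [smul_add, map_add, LinearMap.add_apply, hx, hy]
  | tmul b' L =>
    rw [TensorProduct.smul_tmul', xiLin_tmul, xiLin_tmul, TensorProduct.smul_tmul']

/-- The morphism `ξ : j(der(A)) → ᴴDer(A, - ⊔ A)` of presheaves of modules over the line object. -/
def xi : jMod P.der R ⟶ hDerMod A :=
  PresheafOfModules.homMk
    { app := fun X => AddCommGrpCat.ofHom (P.xiApp X.unop.alg)
      naturality := fun X Y f => by
        ext w
        exact Subtype.ext (LinearMap.ext fun a => P.xiLin_rTensor (pull f.unop) w.1 a) }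
    (fun X r m => Subtype.ext (LinearMap.ext fun a =>
      (P.xiLin_smul _ _ a).trans (hDerSMul_apply r (P.xiApp X.unop.alg m) a).symm))

/-- `ξ` as a morphism of modules over the line object in the sheaf topos. -/
def xiSheaf (hK : Presheaf.IsSheaf (zariskiTopology R) (lineRing R))
    (hj : Presheaf.IsSheaf (zariskiTopology R) (jMod P.der R).presheaf)
    (hD : Presheaf.IsSheaf (zariskiTopology R) (hDerMod A).presheaf) :
    (⟨jMod P.der R, hj⟩ : SheafOfModules.{u} (J := zariskiTopology R) ⟨lineRing R, hK⟩) ⟶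
      ⟨hDerMod A, hD⟩ where
  val := P.xi

end Presentation

lemma freeLift_equivariant {N : ℕ} (deg : Fin N → Wt n) (B : ToricAlg R) (y : Fin N → B)
    (hy : ∀ i j, y i * y j = R.chi (deg j) (deg i) • (y j * y i))
    (hdeg : ∀ i, IsHomog (K := K) (deg i) (y i)) :
    IsEquivariant (K := K) (n := n) (freeLift R deg y hy).toLinearMap := by
  refine LinearMap.ext fun a => ?_
  change Algebra.TensorProduct.map (AlgHom.id K (TorusHopf K n)) (freeLift R deg y hy)
    (freeCoact R deg a) = coact (K := K) (n := n) B (freeLift R deg y hy a)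
  refine free_induction (P := fun a => Algebra.TensorProduct.map (AlgHom.id K (TorusHopf K n))
    (freeLift R deg y hy) (freeCoact R deg a) =
      coact (K := K) (n := n) B (freeLift R deg y hy a)) a ?_ ?_ ?_ ?_
  · rw [map_one, map_one, map_one]
    exact B.one_coinv.symm
  · intro a a' h h'
    rw [map_add, map_add, map_add, map_add, h, h']
  · intro c a h
    rw [map_smul, map_smul, map_smul, map_smul, h]
  · intro i a h
    have hi := hdeg i
    have hg : freeCoact R deg (gen R deg i) = t K (deg i) ⊗ₜ gen R deg i := freeLift_gen R deg _ _ i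
    unfold IsHomog at hi
    rw [map_mul, map_mul, map_mul, B.coact_mul, h, freeLift_gen, hi, hg,
      Algebra.TensorProduct.map_tmul, freeLift_gen, AlgHom.id_apply]

/-- Evaluation at the generator identifies `Hom(F_0, B)` with `B^0`. -/
def lineEquiv (B : ToricAlg R) :
    ToricHom (freeAlg R (fun _ : Fin 1 => (0 : Wt n))) B ≃ coinvAlg B where
  toFun f := ⟨f.hom (gen R (fun _ : Fin 1 => (0 : Wt n)) 0),
    f.map_homog (gen_homog R (fun _ : Fin 1 => (0 : Wt n)) 0)⟩
  invFun b := ⟨freeLift R (fun _ : Fin 1 => (0 : Wt n)) (fun _ => (b : B)) (fun _ _ => by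
    rw [R.chi_zero_left, one_smul]), freeLift_equivariant _ B _ _ fun _ => b.2⟩
  left_inv f := by
    refine DFunLike.coe_injective (funext fun a => ?_)
    have hy : ∀ i j : Fin 1, f.hom (gen R (fun _ : Fin 1 => (0 : Wt n)) 0) *
        f.hom (gen R (fun _ : Fin 1 => (0 : Wt n)) 0) = R.chi 0 0 •
        (f.hom (gen R (fun _ : Fin 1 => (0 : Wt n)) 0) *
          f.hom (gen R (fun _ : Fin 1 => (0 : Wt n)) 0)) := fun _ _ => by
      rw [R.chi_zero_left, one_smul]
    change freeLift R (fun _ : Fin 1 => (0 : Wt n)) _ hy a = f.hom a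
    refine free_induction (R := R) (deg := fun _ : Fin 1 => (0 : Wt n))
      (P := fun a => freeLift R (fun _ : Fin 1 => (0 : Wt n)) _ hy a = f.hom a) a ?_ ?_ ?_ ?_
    · exact (map_one _).trans (map_one f.hom).symm
    · intro a a' h h'
      exact ((map_add _ a a').trans (congrArg₂ _ h h')).trans (map_add f.hom a a').symm
    · intro c a h
      exact ((map_smul _ c a).trans (congrArg _ h)).trans (map_smul f.hom c a).symm
    · intro i a h
      refine ((map_mul _ _ a).trans (congrArg₂ _ ?_ h)).trans (map_mul f.hom _ a).symm
      obtain rfl := Subsingleton.elim i 0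
      exact freeLift_gen R (fun _ : Fin 1 => (0 : Wt n)) _ hy 0
  right_inv b := Subtype.ext (freeLift_gen R (fun _ : Fin 1 => (0 : Wt n)) (fun _ => (b : B))
    (fun _ _ => by rw [R.chi_zero_left, one_smul]) 0)

/-! ### The automorphism group object and its tangent space at the identity -/

section Dual

/-- The dual numbers `K[ε]` with the trivial coaction. -/
instance dualComod : Comod K n (DualNumber K) :=
  Comod.ofSpan _ (TensorProduct.mk K (TorusHopf K n) (DualNumber K) (t K 0)) (by
    rw [eq_top_iff]
    exact fun v _ => Submodule.subset_span ⟨0, rfl⟩)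

lemma dual_homog (v : DualNumber K) : IsHomog (K := K) (0 : Wt n) v := rfl

lemma dual_weight {m : Wt n} {v : DualNumber K} (h : IsHomog (K := K) m v) : m = 0 ∨ v = 0 := by
  by_cases hm : m = 0
  · exact Or.inl hm
  · have h3 := comp_of_homog h m
    rw [if_pos rfl, comp_of_homog (dual_homog v), if_neg (Ne.symm hm)] at h3
    exact Or.inr h3.symm

lemma dual_eq (v : DualNumber K) :
    TrivSqZeroExt.fst v • (1 : DualNumber K) + TrivSqZeroExt.snd v • DualNumber.eps = v := by
  ext <;> simp

/-- The algebra `K[ε] = F_0 / (x²)`. -/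
def dualAlg (R : Cotriangular K n) : ToricAlg R :=
  ToricAlg.ofHomog R (DualNumber K) (dual_homog 1)
    (fun m p a b ha hb => by
      rcases dual_weight ha with rfl | rfl
      · rcases dual_weight hb with rfl | rfl
        · rw [add_zero]; exact dual_homog _
        · rw [mul_zero]; unfold IsHomog; rw [map_zero, TensorProduct.tmul_zero]
      · rw [zero_mul]; unfold IsHomog; rw [map_zero, TensorProduct.tmul_zero])
    (fun m p a b ha hb => by
      rcases dual_weight ha with rfl | rfl
      · rw [R.chi_zero_right, one_smul, mul_comm]
      · simp)

/-- The generator `ε` of `F_0 / (x²)`, the class of `x`. -/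
def dualEps (R : Cotriangular K n) : dualAlg R := (DualNumber.eps : DualNumber K)

/-- The quotient map `F_0 → K[ε]`, `x ↦ ε`. -/
def dualProj (R : Cotriangular K n) : ToricHom (freeAlg R (fun _ : Fin 1 => (0 : Wt n))) (dualAlg R) :=
  (lineEquiv (dualAlg R)).symm ⟨dualEps R, dual_homog _⟩

/-- The generator `x` of `F_0`. -/
abbrev lineGen (R : Cotriangular K n) : FreeCarrier R (fun _ : Fin 1 => (0 : Wt n)) := gen R _ 0

lemma dualProj_gen (R : Cotriangular K n) :
    (dualProj R).hom (lineGen R) = dualEps R :=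
  congrArg Subtype.val ((lineEquiv (dualAlg R)).apply_symm_apply ⟨dualEps R, dual_homog _⟩)

lemma dualProj_lin (R : Cotriangular K n) (c d : K) :
    ((dualProj R).hom ((c • 1 + d • lineGen R : FreeCarrier R (fun _ : Fin 1 => (0 : Wt n)))) :
      DualNumber K) = c • 1 + d • DualNumber.eps := by
  refine (map_add (dualProj R).hom _ _).trans (congrArg₂ _ ?_ ?_)
  · exact (map_smul (dualProj R).hom c _).trans (congrArg _ (map_one (dualProj R).hom))
  · exact (map_smul (dualProj R).hom d _).trans (congrArg _ (dualProj_gen R))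

lemma dualProj_rel (R : Cotriangular K n) {a : FreeCarrier R (fun _ : Fin 1 => (0 : Wt n))}
    (ha : a ∈ TwoSidedIdeal.span (Set.range fun _ : Fin 1 => lineGen R * lineGen R)) :
    (dualProj R).hom a = 0 := by
  refine TwoSidedIdeal.span_induction (p := fun x _ => (dualProj R).hom x = 0)
    ?_ ?_ ?_ ?_ ?_ ?_ ha
  · rintro _ ⟨k, rfl⟩
    refine (map_mul (dualProj R).hom _ _).trans ?_
    exact (congrArg₂ _ (dualProj_gen R) (dualProj_gen R)).trans DualNumber.eps_mul_eps
  · exact map_zero (dualProj R).hom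
  · intro x y _ _ hx hy
    exact (map_add (dualProj R).hom x y).trans (by rw [hx, hy, add_zero])
  · intro x _ hx
    exact (map_neg (dualProj R).hom x).trans (by rw [hx, neg_zero])
  · intro b x _ hx
    exact (map_mul (dualProj R).hom b x).trans (by rw [hx, mul_zero])
  · intro b x _ hx
    exact (map_mul (dualProj R).hom x b).trans (by rw [hx, zero_mul])

lemma dual_rep (R : Cotriangular K n) (a : FreeCarrier R (fun _ : Fin 1 => (0 : Wt n))) :
    ∃ c d : K, a - (c • 1 + d • lineGen R) ∈
      TwoSidedIdeal.span (Set.range fun _ : Fin 1 => lineGen R * lineGen R) := by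
  refine free_induction (P := fun a => ∃ c d : K, a - (c • 1 + d • lineGen R) ∈
    TwoSidedIdeal.span (Set.range fun _ : Fin 1 => lineGen R * lineGen R)) a ?_ ?_ ?_ ?_
  · exact ⟨1, 0, by simp⟩
  · rintro a b ⟨c, d, h⟩ ⟨c', d', h'⟩
    refine ⟨c + c', d + d', ?_⟩
    have := TwoSidedIdeal.add_mem _ h h'
    convert this using 1
    rw [add_smul, add_smul]; abel
  · rintro r a ⟨c, d, h⟩
    refine ⟨r * c, r * d, ?_⟩
    have := TwoSidedIdeal.mul_mem_left _ (algebraMap K _ r) _ h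
    convert this using 1
    rw [← Algebra.smul_def, smul_sub, smul_add, smul_smul, smul_smul]
  · rintro i a ⟨c, d, h⟩
    refine ⟨0, c, ?_⟩
    have h1 := TwoSidedIdeal.mul_mem_left _ (lineGen R) _ h
    have h2 := TwoSidedIdeal.mul_mem_left _ (algebraMap K _ d) _
      (TwoSidedIdeal.subset_span (s := Set.range fun _ : Fin 1 => lineGen R * lineGen R) ⟨0, rfl⟩)
    have := TwoSidedIdeal.add_mem _ h1 h2
    convert this using 1
    rw [← Algebra.smul_def, Subsingleton.elim i 0, mul_sub, mul_add, mul_smul_comm, mul_smul_comm,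
      mul_one, zero_smul, zero_add]
    abel

/-- The presentation `K[ε] = F_0 / (x²)`. -/
def dualPres (R : Cotriangular K n) : Presentation (dualAlg R) where
  N := 1
  deg := fun _ => 0
  M := 1
  rel := fun _ => lineGen R * lineGen R
  relDeg := fun _ => 0 + 0
  rel_homog := fun _ => free_mul_homog R _ (gen_homog R (fun _ : Fin 1 => (0 : Wt n)) 0)
    (gen_homog R (fun _ : Fin 1 => (0 : Wt n)) 0)
  proj := (dualProj R).hom
  proj_equivariant := (dualProj R).equivariant
  proj_surjective := fun v => ⟨_, (dualProj_lin R _ _).trans (dual_eq v)⟩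
  proj_eq_zero_iff := fun a => by
    refine ⟨fun h => ?_, dualProj_rel R⟩
    obtain ⟨c, d, hcd⟩ := dual_rep R a
    have h1 := dualProj_rel R hcd
    have h2 : (dualProj R).hom (c • 1 + d • lineGen R : FreeCarrier R (fun _ : Fin 1 => (0 : Wt n))) = 0 := by
      have h3 := (map_sub (dualProj R).hom a
        (c • 1 + d • lineGen R : FreeCarrier R (fun _ : Fin 1 => (0 : Wt n)))).symm.trans h1
      exact (sub_eq_zero.1 h3).symm.trans h
    have h4 : (c • 1 + d • DualNumber.eps : DualNumber K) = 0 := (dualProj_lin R c d).symm.trans h2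
    have hc : c = 0 := by simpa using congrArg TrivSqZeroExt.fst h4
    have hd : d = 0 := by simpa using congrArg TrivSqZeroExt.snd h4
    rwa [hc, hd, zero_smul, zero_smul, add_zero, sub_zero] at hcd

/-- The space `D` with function algebra `F_0 / (x²)`. -/
def dualSpace (R : Cotriangular K n) : ToricSpace R := ⟨dualAlg R, ⟨dualPres R⟩⟩

/-- The algebra homomorphism `c + d ε ↦ c 1_B`. -/
def zeroHom (B : ToricAlg R) : DualNumber K →ₐ[K] B :=
  (Algebra.ofId K B).comp (TrivSqZeroExt.fstHom K K K)

lemma zeroHom_homog (B : ToricAlg R) {m : Wt n} {v : DualNumber K} (hv : IsHomog (K := K) m v) :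
    IsHomog (K := K) m (zeroHom B v) := by
  rcases dual_weight hv with rfl | rfl
  · exact (coinvAlg B).algebraMap_mem _
  · rw [map_zero]; unfold IsHomog; rw [map_zero, TensorProduct.tmul_zero]

/-- The composite of `X_B ⟶ {∗}` with the point `0 : {∗} ⟶ D`. -/
def zeroPoint (Y : ToricSpace R) : Y ⟶ dualSpace R :=
  ofPull (Y := dualSpace R) ⟨zeroHom Y.alg, isEquivariant_of_homog fun _ _ hv =>
    zeroHom_homog Y.alg hv⟩

lemma zeroPoint_comp {Y Z : ToricSpace R} (f : Z ⟶ Y) : f ≫ zeroPoint Y = zeroPoint Z :=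
  ToricHom.ext (AlgHom.ext fun _ => (pull f).hom.commutes _)

end Dual

/-- The exponential object `X^X`. Over `Y` its elements are the morphisms `Y × X ⟶ X`, given on
points. -/
abbrev endObj (X : ToricSpace R) : (ToricSpace R)ᵒᵖ ⥤ Type (u + 1) :=
  (yoneda.obj X).functorHom (yoneda.obj X)

/-- The automorphism group `Aut(X)`: the invertible elements of the monoid `X^X`. -/
def autSub (X : ToricSpace R) : Subfunctor (endObj X) where
  obj _ := {g | ∃ g', Functor.HomObj.comp g g' = Functor.HomObj.id _ ∧
    Functor.HomObj.comp g' g = Functor.HomObj.id _}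
  map := by
    rintro Y Z f g ⟨g', h, h'⟩
    refine ⟨(endObj X).map f g', ?_, ?_⟩
    · exact congrArg (fun k => (endObj X).map f k) h
    · exact congrArg (fun k => (endObj X).map f k) h'

/-- The tangent bundle `T G = G^D`. -/
abbrev tangent (G : (ToricSpace R)ᵒᵖ ⥤ Type (u + 1)) : (ToricSpace R)ᵒᵖ ⥤ Type (u + 1) :=
  (uliftYoneda.{u + 1}.obj (dualSpace R)).functorHom G

lemma tangent_restrict (G : (ToricSpace R)ᵒᵖ ⥤ Type (u + 1)) {Y Z : (ToricSpace R)ᵒᵖ} (f : Y ⟶ Z)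
    (g : (tangent G).obj Y) :
    g.app Z f ⟨zeroPoint Z.unop⟩ = G.map f (g.app Y (𝟙 Y) ⟨zeroPoint Y.unop⟩) := by
  have h := ConcreteCategory.congr_hom (g.naturality f (𝟙 Y)) ⟨zeroPoint Y.unop⟩
  refine Eq.trans ?_ h
  have h1 : (coyoneda.obj (Opposite.op Y)).map f (𝟙 Y) = f := Category.id_comp f
  have h2 : (uliftYoneda.{u + 1}.obj (dualSpace R)).map f ⟨zeroPoint Y.unop⟩ =
      ⟨zeroPoint Z.unop⟩ := congrArg ULift.up (zeroPoint_comp f.unop)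
  exact (congrArg₂ (fun a b => g.app Z a b) h1 h2).symm

/-- The projection `π : T G ⟶ G`, restriction along `0 : {∗} ⟶ D`. -/
def tangentProj (G : (ToricSpace R)ᵒᵖ ⥤ Type (u + 1)) : tangent G ⟶ G where
  app Y := ↾fun g => g.app Y (𝟙 Y) ⟨zeroPoint Y.unop⟩
  naturality Y Z f := by
    refine ConcreteCategory.hom_ext _ _ fun g => ?_
    refine Eq.trans ?_ (tangent_restrict G f g)
    exact congrArg (fun a => g.app Z a ⟨zeroPoint Z.unop⟩) (Category.comp_id f)

/-- The identity element `e : {∗} ⟶ Aut(X)`. -/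
def autOne (X : ToricSpace R) (Y : (ToricSpace R)ᵒᵖ) : (autSub X).toFunctor.obj Y :=
  ⟨Functor.HomObj.id _, Functor.HomObj.id _, rfl, rfl⟩

/-- The fibre `T_e Aut(X)` of `π : T Aut(X) ⟶ Aut(X)` over `e`. -/
def tangentAut (X : ToricSpace R) : Subfunctor (tangent (autSub X).toFunctor) where
  obj Y := {g | (tangentProj (autSub X).toFunctor).app Y g = autOne X Y}
  map := by
    rintro Y Z f g hg
    have hg' : (tangentProj (autSub X).toFunctor).app Y g = autOne X Y := hg
    exact (ConcreteCategory.congr_hom ((tangentProj (autSub X).toFunctor).naturality f) g).trans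
      (congrArg ((autSub X).toFunctor.map f) hg')

/-- The point `g(f, d)(x)` of `X`, for `g` in `T_e Aut(X)` over `Y`, points `f : E ⟶ Y` and
`d : E ⟶ D`, and a point `x : E' ⟶ X` over `h : E' ⟶ E`. -/
def tangentAutEval {X Y E E' : ToricSpace R} (g : (tangentAut X).toFunctor.obj (Opposite.op Y))
    (f : E ⟶ Y) (d : E ⟶ dualSpace R) (h : E' ⟶ E) (x : E' ⟶ X) : E' ⟶ X :=
  (((g.1.app (Opposite.op E) f.op ⟨d⟩).1).app (Opposite.op E') h.op) x

end Toric

end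

noncomputable section

namespace Toric

variable {K : Type u} [Field K] {n : ℕ} {R : Cotriangular K n}

/-! ### Homogeneous components -/

section Homogeneous

variable {V W : Type u} [AddCommGroup V] [Module K V] [AddCommGroup W] [Module K W]
  [Comod K n V] [Comod K n W]

/-! A coaction of the torus Hopf algebra is a `ℤⁿ`-grading, so identities can be checked on
homogeneous elements, where the braiding is multiplication by a bicharacter. This scalar is 1 as
soon as one weight is zero, hence coinvariants are central and localizing at them behaves as in
commutative algebra.

Sheaves. Let `s_i` be coinvariants generating the unit ideal. The partition of unity can be moved
into the commutative ring `B^0`, and since `V` is flat over the field, the classical gluing of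
fractions works for `B ⊗ V` (`exists_glue`, `eq_of_res_eq`). It needs a localization whose elements
are fractions and whose kernel is power torsion. `exists_localization` obtains it by adjoining a
weight-zero generator inverse to `s`; the kernel is controlled by comparison with the localization
of `B` as an algebra over its centre. Weight-zero components then give the sheaf property of `j(V)`,
and the line object is `j(K)`.

The map `ξ`. For a coinvariant of `B ⊗ ∐_j A[-m_j]` the weights of the two factors cancel, so the
braided Leibniz rule becomes the rule defining `ᴴDer(A, B ⊔ A)` (`evTensor_mul`). A derivation is
determined by its values on generators, and these may be prescribed as long as the relations are
sent to zero. By flatness, that condition cuts out exactly `B ⊗ der(A)`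
(`mem_range_of_evTensor_rel`). So `ξ` is bijective on sections (`xiApp_bijective`), and the sheaf
property of `ᴴDer(A, - ⊔ A)` is carried over from `j(der(A))`.

The tangent space. A derivation `v` moves a point `y` to `y + ε (f ⊗ y) v`; because `ε² = 0` such
moves add up, so `-v` gives the inverse (`perturb_perturb`). Conversely, by naturality an element of
`T_e Aut(X_A)` over `X_B` is determined by its value at the generic point of `D × X_B × X_A`, whose
function algebra is `K[ε] ⊗ B ⊗ A` (`exists_generic`). This value has the form `a ↦ w₀(a) + ε
w₁(a)`: lying over the identity forces `w₀(a) = 1 ⊗ a`, and equivariance and multiplicativity make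
`w₁` a derivation (`exists_der_of_point`). -/

lemma IsHomog.zero (m : Wt n) : IsHomog (K := K) m (0 : V) := by
  unfold IsHomog; rw [map_zero, TensorProduct.tmul_zero]

lemma IsHomog.neg {m : Wt n} {v : V} (h : IsHomog (K := K) m v) : IsHomog (K := K) m (-v) := by
  rw [← neg_one_smul K v]; exact h.smul _

lemma IsHomog.sum {ι : Type*} {m : Wt n} (s : Finset ι) (v : ι → V)
    (h : ∀ i ∈ s, IsHomog (K := K) m (v i)) : IsHomog (K := K) m (∑ i ∈ s, v i) :=
  Finset.sum_induction _ (fun x => IsHomog (K := K) m x) (fun _ _ h h' => h.add h') (.zero m) h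

lemma IsHomog.comp_eq {m : Wt n} {v : V} (h : IsHomog (K := K) m v) : comp K m v = v := by
  rw [comp_of_homog h, if_pos rfl]

lemma IsEquivariant.map_comp {L : V →ₗ[K] W} (hL : IsEquivariant (K := K) (n := n) L) (m : Wt n)
    (v : V) : L (comp K m v) = comp K m (L v) := by
  refine homog_induction (K := K) (n := n) (P := fun v => L (comp K m v) = comp K m (L v)) v
    (by simp only [map_zero]) (fun x y hx hy => by simp only [map_add, hx, hy]) fun p x hx => ?_
  rw [comp_of_homog hx, comp_of_homog (hL.map_homog hx)]
  split_ifs <;> simp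

/-- An equivariant map commutes with taking components, so `v` and its component of weight `m` have
the same image. -/
lemma IsEquivariant.homog_of_injective {L : V →ₗ[K] W} (hL : IsEquivariant (K := K) (n := n) L)
    (hi : Function.Injective L) {m : Wt n} {v : V} (h : IsHomog (K := K) m (L v)) :
    IsHomog (K := K) m v := by
  have : comp K m v = v := hi (by rw [hL.map_comp, h.comp_eq])
  rw [← this]
  exact comp_homog m v

/-- The weight-`m` component of any preimage is again a preimage. -/
lemma IsEquivariant.exists_homog {L : V →ₗ[K] W} (hL : IsEquivariant (K := K) (n := n) L)
    {m : Wt n} {v : V} (h : IsHomog (K := K) m (L v)) :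
    ∃ v', IsHomog (K := K) m v' ∧ L v' = L v :=
  ⟨comp K m v, comp_homog m v, by rw [hL.map_comp, h.comp_eq]⟩

/-- The comodule structure on a quotient of a comodule by a subcomodule. -/
@[reducible] def quotComod (U : Type u) [AddCommGroup U] [Module K U] (p : V →ₗ[K] U)
    (hp : Function.Surjective p) (h : ∀ v, p v = 0 → ∀ m : Wt n, p (comp K m v) = 0) :
    Comod K n U :=
  let s := Classical.choose (p.exists_rightInverse_of_surjective (LinearMap.range_eq_top.2 hp))
  have hs : p ∘ₗ s = LinearMap.id :=
    Classical.choose_spec (p.exists_rightInverse_of_surjective (LinearMap.range_eq_top.2 hp))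
  Comod.ofSpan U (p.lTensor (TorusHopf K n) ∘ₗ coact V ∘ₗ s) (by
    rw [eq_top_iff]
    rintro u -
    obtain ⟨v, rfl⟩ := hp u
    refine homog_induction (K := K) (n := n) (P := fun v => p v ∈ Submodule.span K _) v
      (by rw [map_zero]; exact zero_mem _)
      (fun x y hx hy => by rw [map_add]; exact add_mem hx hy) fun m x hx => ?_
    refine Submodule.subset_span ⟨m, ?_⟩
    -- The coaction is computed through a linear section `s`, which returns `x` only up to the
    -- kernel of `p`.
    have h0 : p (s (p x) - x) = 0 := by
      rw [map_sub, sub_eq_zero]; exact LinearMap.congr_fun hs (p x)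
    -- All components of a kernel element lie in the kernel, so its coaction dies in `H ⊗ U` and the
    -- choice of lift is immaterial.
    have h1 : p.lTensor (TorusHopf K n) (coact V (s (p x) - x)) = 0 := by
      obtain ⟨S, hS⟩ := tensor_expand (coact (K := K) (n := n) V (s (p x) - x))
      rw [hS S subset_rfl, map_sum]
      refine Finset.sum_eq_zero fun m _ => ?_
      rw [LinearMap.lTensor_tmul]
      have := h _ h0 m
      rw [comp, LinearMap.comp_apply] at this
      rw [this, TensorProduct.tmul_zero]
    rw [map_sub, map_sub, sub_eq_zero] at h1
    rw [LinearMap.comp_apply, LinearMap.comp_apply, h1]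
    unfold IsHomog at hx
    rw [hx, LinearMap.lTensor_tmul])

/-- The coaction on the quotient does not depend on the section used to define it, so it can be
computed from the homogeneous lift `x`. -/
lemma quotComod_homog {U : Type u} [AddCommGroup U] [Module K U] (p : V →ₗ[K] U)
    (hp : Function.Surjective p) (h : ∀ v, p v = 0 → ∀ m : Wt n, p (comp K m v) = 0)
    {m : Wt n} {x : V} (hx : IsHomog (K := K) m x) :
    letI := quotComod U p hp h
    IsHomog (K := K) m (p x) := by
  have hs : p ∘ₗ Classical.choose (p.exists_rightInverse_of_surjective
      (LinearMap.range_eq_top.2 hp)) = LinearMap.id :=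
    Classical.choose_spec (p.exists_rightInverse_of_surjective (LinearMap.range_eq_top.2 hp))
  change p.lTensor (TorusHopf K n) (coact V (Classical.choose
    (p.exists_rightInverse_of_surjective (LinearMap.range_eq_top.2 hp)) (p x))) = _
  set s := Classical.choose (p.exists_rightInverse_of_surjective (LinearMap.range_eq_top.2 hp))
  have h0 : p (s (p x) - x) = 0 := by
    rw [map_sub, sub_eq_zero]; exact LinearMap.congr_fun hs (p x)
  have h1 : p.lTensor (TorusHopf K n) (coact V (s (p x) - x)) = 0 := by
    obtain ⟨S, hS⟩ := tensor_expand (coact (K := K) (n := n) V (s (p x) - x))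
    rw [hS S subset_rfl, map_sum]
    refine Finset.sum_eq_zero fun m _ => ?_
    rw [LinearMap.lTensor_tmul]
    have := h _ h0 m
    rw [comp, LinearMap.comp_apply] at this
    rw [this, TensorProduct.tmul_zero]
  rw [map_sub, map_sub, sub_eq_zero] at h1
  unfold IsHomog at hx
  rw [h1, hx, LinearMap.lTensor_tmul]

end Homogeneous

/-! ### Components of products, and coinvariants as central elements -/

section Algebra

lemma ToricAlg.comp_mul_left (A : ToricAlg R) {q : Wt n} {b : A} (hb : IsHomog (K := K) q b)
    (m : Wt n) (x : A) : comp K m (b * x) = b * comp K (m - q) x := by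
  refine homog_induction (K := K) (n := n)
    (P := fun x => comp K m (b * x) = b * comp K (m - q) x) x
    (by simp) (fun x y hx hy => by simp only [mul_add, map_add, hx, hy]) fun p x hx => ?_
  rw [comp_of_homog (A.mul_homog hb hx), comp_of_homog hx]
  by_cases h : p = m - q
  · rw [if_pos h, if_pos (by rw [h]; abel)]
  · rw [if_neg h, if_neg (fun h' => h (by rw [← h']; abel)), mul_zero]

lemma ToricAlg.comp_mul_right (A : ToricAlg R) {q : Wt n} {b : A} (hb : IsHomog (K := K) q b)
    (m : Wt n) (x : A) : comp K m (x * b) = comp K (m - q) x * b := by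
  refine homog_induction (K := K) (n := n)
    (P := fun x => comp K m (x * b) = comp K (m - q) x * b) x
    (by simp) (fun x y hx hy => by simp only [add_mul, map_add, hx, hy]) fun p x hx => ?_
  rw [comp_of_homog (A.mul_homog hx hb), comp_of_homog hx]
  by_cases h : p = m - q
  · rw [if_pos h, if_pos (by rw [h]; abel)]
  · rw [if_neg h, if_neg (fun h' => h (by rw [← h']; abel)), zero_mul]

lemma ToricAlg.coinv_comm (A : ToricAlg R) {s : A} (hs : IsHomog (K := K) (0 : Wt n) s) (a : A) :
    s * a = a * s := coinvAlg_mul_comm A ⟨s, hs⟩ a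

/-- A coinvariant with an inverse has a coinvariant inverse. -/
lemma ToricAlg.exists_coinv_inverse (A : ToricAlg R) {s : A}
    (hs : IsHomog (K := K) (0 : Wt n) s) (hu : IsUnit s) :
    ∃ y : A, IsHomog (K := K) (0 : Wt n) y ∧ y * s = 1 ∧ s * y = 1 := by
  obtain ⟨y, hy⟩ := hu.exists_left_inv
  -- The weight-zero part of `y * s = 1` shows that the weight-zero component of `y` is already an
  -- inverse.
  have h := A.comp_mul_right hs 0 y
  rw [hy, A.one_coinv.comp_eq, sub_zero] at h
  exact ⟨_, comp_homog 0 y, h.symm, by rw [A.coinv_comm hs, ← h]⟩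

end Algebra

/-! ### Algebras given by generators and relations -/

section Presented

variable (R) {N M : ℕ} (deg : Fin N → Wt n) (rel : Fin M → FreeCarrier R deg)

/-- The algebra underlying `F_{m_1,…,m_N} / (f_1,…,f_M)`. -/
abbrev PresCarrier : Type u := (TwoSidedIdeal.span (Set.range rel)).ringCon.Quotient

/-- The quotient map `F_{m_1,…,m_N} → F_{m_1,…,m_N} / (f_1,…,f_M)`. -/
def presProj : FreeCarrier R deg →ₐ[K] PresCarrier R deg rel :=
  RingCon.mkₐ K (TwoSidedIdeal.span (Set.range rel)).ringCon

lemma presProj_surjective : Function.Surjective (presProj R deg rel) :=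
  RingCon.mkₐ_surjective _

lemma presProj_eq_zero_iff (a : FreeCarrier R deg) :
    presProj R deg rel a = 0 ↔ a ∈ TwoSidedIdeal.span (Set.range rel) :=
  (RingCon.eq _).trans (TwoSidedIdeal.mem_iff _ a).symm

variable {R deg rel} (relDeg : Fin M → Wt n) (hrel : ∀ k, IsHomog (K := K) (relDeg k) (rel k))

include hrel in
-- A two-sided ideal with homogeneous generators is graded: in the steps that multiply by `b`,
-- splitting `b` into homogeneous parts only shifts the weight of the component taken.
lemma comp_mem_span {a : FreeCarrier R deg} (ha : a ∈ TwoSidedIdeal.span (Set.range rel)) :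
    ∀ m : Wt n, comp K m a ∈ TwoSidedIdeal.span (Set.range rel) := by
  refine TwoSidedIdeal.span_induction
    (p := fun x _ => ∀ m : Wt n, comp K m x ∈ TwoSidedIdeal.span (Set.range rel))
    ?_ ?_ ?_ ?_ ?_ ?_ ha
  · rintro _ ⟨k, rfl⟩ m
    rw [comp_of_homog (hrel k)]
    split_ifs
    · exact TwoSidedIdeal.subset_span ⟨k, rfl⟩
    · exact zero_mem _
  · intro m; rw [map_zero]; exact zero_mem _
  · intro x y _ _ hx hy m; rw [map_add]; exact add_mem (hx m) (hy m)
  · intro x _ hx m; rw [map_neg]; exact neg_mem (hx m)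
  · intro b x _ hx m
    refine homog_induction (K := K) (n := n)
      (P := fun b => comp K m (b * x) ∈ TwoSidedIdeal.span (Set.range rel)) b
      (by rw [zero_mul, map_zero]; exact zero_mem _)
      (fun b c hb hc => by rw [add_mul, map_add]; exact add_mem hb hc) fun q b hb => ?_
    have := (freeAlg R deg).comp_mul_left hb m x
    refine (congrArg (· ∈ TwoSidedIdeal.span (Set.range rel)) this).mpr ?_
    exact TwoSidedIdeal.mul_mem_left _ _ _ (hx _)
  · intro b x _ hx m
    refine homog_induction (K := K) (n := n)
      (P := fun b => comp K m (x * b) ∈ TwoSidedIdeal.span (Set.range rel)) b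
      (by rw [mul_zero, map_zero]; exact zero_mem _)
      (fun b c hb hc => by rw [mul_add, map_add]; exact add_mem hb hc) fun q b hb => ?_
    have := (freeAlg R deg).comp_mul_right hb m x
    refine (congrArg (· ∈ TwoSidedIdeal.span (Set.range rel)) this).mpr ?_
    exact TwoSidedIdeal.mul_mem_right _ _ _ (hx _)

include hrel in
lemma presProj_comp_eq_zero (a : FreeCarrier R deg) (ha : (presProj R deg rel).toLinearMap a = 0)
    (m : Wt n) : (presProj R deg rel).toLinearMap (comp K m a) = 0 :=
  (presProj_eq_zero_iff R deg rel _).2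
    (comp_mem_span relDeg hrel ((presProj_eq_zero_iff R deg rel _).1 ha) m)

/-- The comodule structure on `F_{m_1,…,m_N} / (f_1,…,f_M)`. -/
@[reducible] def presComod : Comod K n (PresCarrier R deg rel) :=
  quotComod _ (presProj R deg rel).toLinearMap (presProj_surjective R deg rel)
    (presProj_comp_eq_zero relDeg hrel)

lemma presProj_equivariant :
    letI := presComod relDeg hrel
    IsEquivariant (K := K) (n := n) (presProj R deg rel).toLinearMap :=
  let := presComod relDeg hrel
  isEquivariant_of_homog fun _ _ hx => quotComod_homog _ _ _ hx

/-- Homogeneous lifts let the axioms of `ToricAlg` descend from the free algebra to the quotient. -/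
lemma exists_homog_presProj {m : Wt n} {a : PresCarrier R deg rel}
    (ha : letI := presComod relDeg hrel; IsHomog (K := K) m a) :
    ∃ x, IsHomog (K := K) m x ∧ presProj R deg rel x = a := by
  let := presComod relDeg hrel
  obtain ⟨x, rfl⟩ := presProj_surjective R deg rel a
  exact (presProj_equivariant relDeg hrel).exists_homog ha

/-- The algebra `F_{m_1,…,m_N} / (f_1,…,f_M)`. -/
def presAlg : ToricAlg R :=
  let := presComod relDeg hrel
  ToricAlg.ofHomog R (PresCarrier R deg rel)
    (by
      rw [← map_one (presProj R deg rel)]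
      exact (presProj_equivariant relDeg hrel).map_homog (free_one_coinv R deg))
    (fun m p a b ha hb => by
      obtain ⟨x, hx, rfl⟩ := exists_homog_presProj relDeg hrel ha
      obtain ⟨y, hy, rfl⟩ := exists_homog_presProj relDeg hrel hb
      rw [← map_mul]
      exact (presProj_equivariant relDeg hrel).map_homog (free_mul_homog R deg hx hy))
    (fun m p a b ha hb => by
      obtain ⟨x, hx, rfl⟩ := exists_homog_presProj relDeg hrel ha
      obtain ⟨y, hy, rfl⟩ := exists_homog_presProj relDeg hrel hb
      rw [← map_mul, free_comm_homog R deg hx hy, map_smul, map_mul])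

/-- The tautological presentation of `F_{m_1,…,m_N} / (f_1,…,f_M)`. -/
def presPres : Presentation (presAlg relDeg hrel) where
  N := N
  deg := deg
  M := M
  rel := rel
  relDeg := relDeg
  rel_homog := hrel
  proj := presProj R deg rel
  proj_equivariant := presProj_equivariant relDeg hrel
  proj_surjective := presProj_surjective R deg rel
  proj_eq_zero_iff := presProj_eq_zero_iff R deg rel

end Presented

/-! ### Maps out of a presented algebra -/

namespace Presentation

variable {A : ToricAlg R} (P : Presentation A)

/-- The image of a generator in the presented algebra. -/
def x (i : Fin P.N) : A := P.proj (gen R P.deg i)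

lemma x_homog (i : Fin P.N) : IsHomog (K := K) (P.deg i) (P.x i) := P.proj_homog (gen_homog R _ i)

lemma induction {p : A → Prop} (a : A) (h1 : p 1) (hadd : ∀ a b, p a → p b → p (a + b))
    (hsmul : ∀ (c : K) a, p a → p (c • a)) (hx : ∀ i a, p a → p (P.x i * a)) : p a := by
  obtain ⟨a, rfl⟩ := P.proj_surjective a
  refine free_induction (P := fun a => p (P.proj a)) a (by rwa [map_one])
    (fun a b ha hb => by rw [map_add]; exact hadd _ _ ha hb)
    (fun c a ha => by rw [map_smul]; exact hsmul _ _ ha)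
    fun i a ha => by rw [map_mul]; exact hx _ _ ha

/-- The kernel of `f` is a two-sided ideal containing the relations. -/
lemma freeLift_eq_zero {C : Type u} [Ring C] [Algebra K C] (f : FreeCarrier R P.deg →ₐ[K] C)
    (h : ∀ k, f (P.rel k) = 0) {a : FreeCarrier R P.deg} (ha : P.proj a = 0) : f a = 0 := by
  have hs : TwoSidedIdeal.span (Set.range P.rel) ≤ TwoSidedIdeal.ker f :=
    TwoSidedIdeal.span_le.2 (by
      rintro _ ⟨k, rfl⟩
      exact (TwoSidedIdeal.mem_ker _).2 (h k))
  exact (TwoSidedIdeal.mem_ker _).1 (hs ((P.proj_eq_zero_iff a).1 ha))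

/-- A map out of the free algebra that kills the relations factors through the quotient. -/
lemma exists_lift {C : Type u} [Ring C] [Algebra K C] (f : FreeCarrier R P.deg →ₐ[K] C)
    (h : ∀ k, f (P.rel k) = 0) : ∃ g : A →ₐ[K] C, ∀ a, g (P.proj a) = f a := by
  have key : ∀ {a b}, P.proj a = P.proj b → f a = f b := fun {a b} hab => by
    have := P.freeLift_eq_zero f h (a := a - b) (by rw [map_sub, hab, sub_self])
    rwa [map_sub, sub_eq_zero] at this
  have hinv := Function.surjInv_eq P.proj_surjective
  -- Representatives are chosen arbitrarily; `key` makes the values independent of the choice, hence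
  -- linear.
  let g : A →ₗ[K] C :=
    { toFun := fun a => f (Function.surjInv P.proj_surjective a)
      map_add' := fun a b => (key (by rw [map_add, hinv, hinv, hinv])).trans (map_add f _ _)
      map_smul' := fun c a => (key (by rw [map_smul, hinv, hinv])).trans (map_smul f c _) }
  have hg : ∀ a, g (P.proj a) = f a := fun a => key (hinv _)
  refine ⟨AlgHom.ofLinearMap g ?_ fun a b => ?_, hg⟩
  · rw [← map_one P.proj, hg, map_one]
  · obtain ⟨a, rfl⟩ := P.proj_surjective a
    obtain ⟨b, rfl⟩ := P.proj_surjective b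
    rw [← map_mul, hg, hg, hg, map_mul]

lemma algHom_ext {C : Type u} [Ring C] [Algebra K C] {f g : A →ₐ[K] C}
    (h : ∀ i, f (P.x i) = g (P.x i)) : f = g := by
  refine AlgHom.ext fun a => P.induction (p := fun a => f a = g a) a
    ((map_one f).trans (map_one g).symm) ?_ ?_ ?_
  · intro a b ha hb; rw [map_add, map_add, ha, hb]
  · intro c a ha; rw [map_smul, map_smul, ha]
  · intro i a ha; rw [map_mul, map_mul, ha, h]

/-- The coaction is multiplicative, so compatibility with it propagates from the generators to all
monomials. -/
lemma equivariant_of_gen {C : ToricAlg R} (f : A →ₐ[K] C)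
    (h : ∀ i, IsHomog (K := K) (P.deg i) (f (P.x i))) :
    IsEquivariant (K := K) (n := n) f.toLinearMap := by
  have hc : ∀ a, coact (K := K) (n := n) C (f a) =
      f.toLinearMap.lTensor (TorusHopf K n) (coact A a) := fun a => by
    refine P.induction (p := fun a => coact (K := K) (n := n) C (f a) =
      f.toLinearMap.lTensor (TorusHopf K n) (coact A a)) a ?_ ?_ ?_ ?_
    · have h1 := A.one_coinv
      have h2 := C.one_coinv
      unfold IsHomog at h1 h2
      rw [map_one, h1, h2, LinearMap.lTensor_tmul, AlgHom.toLinearMap_apply, map_one]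
    · intro a b ha hb; simp only [map_add, ha, hb]
    · intro c a ha; simp only [map_smul, ha]
    · intro i a ha
      have h1 := P.x_homog i
      have h2 := h i
      unfold IsHomog at h1 h2
      rw [map_mul, C.coact_mul, A.coact_mul, h1, h2, ha]
      -- What remains is linear in the coaction of `a`, so it is checked on pure tensors.
      generalize coact (K := K) (n := n) A a = z
      induction z with
      | zero => simp
      | add x y hx hy => simp only [map_add, mul_add, hx, hy]
      | tmul z b => simp
  exact LinearMap.ext fun a => (hc a).symm

end Presentation

lemma ToricAlg.gens_comm {N : ℕ} {deg : Fin N → Wt n} (C : ToricAlg R) {y : Fin N → C}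
    (hy : ∀ i, IsHomog (K := K) (deg i) (y i)) (i j : Fin N) :
    y i * y j = R.chi (deg j) (deg i) • (y j * y i) := C.comm_homog (hy i) (hy j)

/-! ### Localization at a coinvariant -/

lemma free_algHom_ext {N : ℕ} {deg : Fin N → Wt n} {C : Type u} [Ring C] [Algebra K C]
    {f g : FreeCarrier R deg →ₐ[K] C} (h : ∀ i, f (gen R deg i) = g (gen R deg i)) : f = g := by
  refine AlgHom.ext fun a => free_induction (P := fun a => f a = g a) a
    ((map_one f).trans (map_one g).symm) ?_ ?_ ?_
  · intro a b ha hb; rw [map_add, map_add, ha, hb]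
  · intro c a ha; rw [map_smul, map_smul, ha]
  · intro i a ha; rw [map_mul, map_mul, ha, h]

/-- A central element of an algebra can be inverted by a map whose kernel is its power torsion. -/
lemma exists_central_localization {B : Type u} [Ring B] [Algebra K B] (s : B)
    (hs : ∀ b, s * b = b * s) :
    ∃ (C : Type u) (_ : Ring C) (_ : Algebra K C) (f : B →ₐ[K] C) (c : C),
      c * f s = 1 ∧ (∀ b, c * f b = f b * c) ∧ ∀ b, f b = 0 → ∃ k : ℕ, s ^ k * b = 0 := by
  -- Seen in the centre, `s` generates a submonoid of a commutative ring. Localizing `B` as an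
  -- algebra over that ring keeps its noncommutative product.
  let z : Subalgebra.center K B := ⟨s, Subalgebra.mem_center_iff.2 fun b => (hs b).symm⟩
  let S := Submonoid.powers z
  let : Algebra (Subalgebra.center K B) B :=
    Algebra.ofModule (fun r x y => mul_assoc (r : B) x y) fun r x y => by
      rw [Subalgebra.smul_def, Subalgebra.smul_def, smul_eq_mul, smul_eq_mul, ← mul_assoc,
        ← mul_assoc, Subalgebra.mem_center_iff.1 r.2 x]
  let : Algebra K (LocalizedModule S B) :=
    Algebra.compHom _ (algebraMap K (Subalgebra.center K B))
  let f : B →ₐ[K] LocalizedModule S B :=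
    { LocalizedModule.numeratorRingHom with
      commutes' := fun _ => congrArg (LocalizedModule.mk · 1) (mul_one _).symm }
  have hf : ∀ b, f b = LocalizedModule.mk b 1 := fun _ => rfl
  -- The element `c` is the fraction `1 / s`.
  refine ⟨LocalizedModule S B, inferInstance, inferInstance, f,
    LocalizedModule.mk 1 ⟨z, Submonoid.mem_powers z⟩, ?_, fun b => ?_, fun b hb => ?_⟩
  · rw [hf, LocalizedModule.mk_mul_mk, one_mul, mul_one]
    have := LocalizedModule.mk_cancel (⟨z, Submonoid.mem_powers z⟩ : S) (1 : B)
    rw [Submonoid.smul_def, Subalgebra.smul_def, smul_eq_mul, mul_one] at this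
    exact this.trans OreLocalization.one_def.symm
  · rw [hf, LocalizedModule.mk_mul_mk, LocalizedModule.mk_mul_mk, one_mul, mul_one, one_mul,
      mul_one]
  · rw [hf, ← LocalizedModule.zero_mk (1 : S), LocalizedModule.mk_eq] at hb
    obtain ⟨⟨_, k, rfl⟩, hu⟩ := hb
    refine ⟨k, ?_⟩
    simpa [Submonoid.smul_def, Subalgebra.smul_def, z] using hu

namespace Presentation

variable {B : ToricAlg R} (P : Presentation B)

/-- The generators of a localization of `B`: one new generator of weight zero. -/
def locDeg : Fin (P.N + 1) → Wt n := Fin.cons 0 P.deg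

/-- The inclusion of the generators of `B` into the generators of a localization. -/
def locEmb : FreeCarrier R P.deg →ₐ[K] FreeCarrier R P.locDeg :=
  freeLift R P.deg (fun i => gen R P.locDeg i.succ) fun i j => gen_comm R P.locDeg i.succ j.succ

lemma locEmb_gen (i : Fin P.N) : P.locEmb (gen R P.deg i) = gen R P.locDeg i.succ :=
  freeLift_gen R _ _ _ i

lemma locEmb_homog {m : Wt n} {a : FreeCarrier R P.deg} (ha : IsHomog (K := K) m a) :
    IsHomog (K := K) m (P.locEmb a) :=
  IsEquivariant.map_homog (freeLift_equivariant (R := R) P.deg (freeAlg R P.locDeg)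
    (fun i => gen R P.locDeg i.succ) (fun i j => gen_comm R P.locDeg i.succ j.succ)
    (fun i => gen_homog R P.locDeg i.succ)) ha

/-- The relations of the localization at the image of `r`: the new generator inverts `r`. -/
def locRel (r : FreeCarrier R P.deg) : Fin (P.M + 1) → FreeCarrier R P.locDeg :=
  Fin.cons (gen R P.locDeg 0 * P.locEmb r - 1) fun k => P.locEmb (P.rel k)

lemma locRel_homog {r : FreeCarrier R P.deg} (hr : IsHomog (K := K) (0 : Wt n) r)
    (k : Fin (P.M + 1)) :
    IsHomog (K := K) ((Fin.cons 0 P.relDeg : Fin (P.M + 1) → Wt n) k) (P.locRel r k) := by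
  refine Fin.cases ?_ (fun k => P.locEmb_homog (P.rel_homog k)) k
  have h1 := free_mul_homog R P.locDeg (gen_homog R P.locDeg 0) (P.locEmb_homog hr)
  have h2 := (free_one_coinv R P.locDeg).neg
  have h3 : P.locDeg 0 + 0 = 0 := add_zero _
  rw [h3] at h1
  have h4 := h1.add h2
  rw [← sub_eq_add_neg] at h4
  exact h4

/-- The localization of `B` at the image of `r`. -/
def loc {r : FreeCarrier R P.deg} (hr : IsHomog (K := K) (0 : Wt n) r) : ToricAlg R :=
  presAlg (Fin.cons 0 P.relDeg) (P.locRel_homog hr)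

/-- The presentation of the localization. -/
def locPres {r : FreeCarrier R P.deg} (hr : IsHomog (K := K) (0 : Wt n) r) :
    Presentation (P.loc hr) :=
  presPres (Fin.cons 0 P.relDeg) (P.locRel_homog hr)

/-- The quotient map onto the localization. -/
def locProj {r : FreeCarrier R P.deg} (hr : IsHomog (K := K) (0 : Wt n) r) :
    FreeCarrier R P.locDeg →ₐ[K] P.loc hr := (P.locPres hr).proj

section

variable {r : FreeCarrier R P.deg} (hr : IsHomog (K := K) (0 : Wt n) r)

lemma loc_proj_rel (k : Fin P.M) : P.locProj hr (P.locEmb (P.rel k)) = 0 :=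
  ((P.locPres hr).proj_eq_zero_iff _).2 (TwoSidedIdeal.subset_span ⟨k.succ, rfl⟩)

lemma exists_locMap : ∃ l : ToricHom B (P.loc hr), ∀ a, l.hom (P.proj a) =
    P.locProj hr (P.locEmb a) := by
  obtain ⟨g, hg⟩ := P.exists_lift ((P.locProj hr).comp P.locEmb) fun k => P.loc_proj_rel hr k
  refine ⟨⟨g, P.equivariant_of_gen g fun i => ?_⟩, hg⟩
  refine (congrArg (IsHomog (K := K) (P.deg i)) (hg _)).mpr ?_
  exact (P.locPres hr).proj_homog (P.locEmb_homog (gen_homog R P.deg i))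

/-- The map from `B` to its localization. -/
def locMap : ToricHom B (P.loc hr) := Classical.choose (P.exists_locMap hr)

lemma locMap_proj (a : FreeCarrier R P.deg) :
    (P.locMap hr).hom (P.proj a) = P.locProj hr (P.locEmb a) :=
  Classical.choose_spec (P.exists_locMap hr) a

/-- The inverse of the image of `r` in the localization. -/
def locInv : P.loc hr := (P.locPres hr).x (0 : Fin (P.N + 1))

lemma x_succ (i : Fin P.N) : (P.locPres hr).x i.succ = (P.locMap hr).hom (P.x i) :=
  (congrArg (P.locProj hr) (P.locEmb_gen i).symm).trans (P.locMap_proj hr _).symm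

lemma locInv_mul : P.locInv hr * (P.locMap hr).hom (P.proj r) = 1 := by
  have h : P.locProj hr (gen R P.locDeg 0 * P.locEmb r - 1) = 0 :=
    ((P.locPres hr).proj_eq_zero_iff _).2 (TwoSidedIdeal.subset_span ⟨(0 : Fin (P.M + 1)), rfl⟩)
  rw [locMap_proj]
  have h2 := (map_sub (P.locProj hr) _ _).symm.trans h
  rw [sub_eq_zero] at h2
  exact (map_mul (P.locProj hr) _ _).symm.trans (h2.trans (map_one _))

/-- The new generator has weight zero, so its commutation relations have scalar 1 and say only that
`c` commutes with the image of `f`. The target is an arbitrary algebra, so that the central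
localization, which is given no coaction, can serve as one. -/
lemma exists_locLift {C : Type u} [Ring C] [Algebra K C] (f : B →ₐ[K] C) (c : C)
    (h1 : c * f (P.proj r) = 1) (h2 : ∀ b, c * f b = f b * c) :
    ∃ g : P.loc hr →ₐ[K] C, g.comp (P.locMap hr).hom = f ∧ g (P.locInv hr) = c := by
  let y : Fin (P.N + 1) → C := Fin.cons c fun i => f (P.x i)
  have hy : ∀ i j, y i * y j = R.chi (P.locDeg j) (P.locDeg i) • (y j * y i) := by
    intro i j
    refine Fin.cases ?_ (fun i => ?_) i <;> refine Fin.cases ?_ (fun j => ?_) j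
    · exact (one_smul K _).symm.trans (congrArg (· • (c * c)) (R.chi_zero_left 0).symm)
    · refine (h2 (P.x j)).trans ?_
      exact (one_smul K _).symm.trans (congrArg (· • (f (P.x j) * c)) (R.chi_zero_right _).symm)
    · refine (h2 (P.x i)).symm.trans ?_
      exact (one_smul K _).symm.trans (congrArg (· • (c * f (P.x i))) (R.chi_zero_left _).symm)
    · change f (P.x i) * f (P.x j) = R.chi (P.deg j) (P.deg i) • (f (P.x j) * f (P.x i))
      rw [← map_mul, B.gens_comm P.x_homog i j, map_smul, map_mul]
  have he : (freeLift R P.locDeg y hy).comp P.locEmb = f.comp P.proj :=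
    free_algHom_ext fun i => by
      rw [AlgHom.comp_apply, locEmb_gen, freeLift_gen]; rfl
  obtain ⟨g, hg⟩ := (P.locPres hr).exists_lift (freeLift R P.locDeg y hy) (by
    intro k
    refine Fin.cases ?_ (fun k => ?_) k
    · change freeLift R P.locDeg y hy (gen R P.locDeg 0 * P.locEmb r - 1) = 0
      have := AlgHom.congr_fun he r
      rw [AlgHom.comp_apply, AlgHom.comp_apply] at this
      rw [map_sub, map_mul, this, freeLift_gen, map_one, sub_eq_zero]
      exact h1
    · change freeLift R P.locDeg y hy (P.locEmb (P.rel k)) = 0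
      refine (AlgHom.congr_fun he (P.rel k)).trans ?_
      rw [AlgHom.comp_apply, (P.proj_eq_zero_iff _).2 (TwoSidedIdeal.subset_span ⟨k, rfl⟩),
        map_zero])
  refine ⟨g, ?_, (hg _).trans (freeLift_gen R _ _ _ 0)⟩
  refine P.algHom_ext fun i => ?_
  rw [AlgHom.comp_apply, ← x_succ]
  exact (hg _).trans (freeLift_gen R _ _ _ i.succ)

/-- Every element of the localization is a fraction. The set of fractions contains 1, is closed
under addition because denominators are central, and is stable under left multiplication by each
generator. -/
lemma exists_pow_mul_eq (z : P.loc hr) :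
    ∃ (k : ℕ) (y : B), (P.locMap hr).hom (P.proj r) ^ k * z = (P.locMap hr).hom y := by
  have hs := (P.locMap hr).map_homog (P.proj_homog hr)
  have hc := (P.loc hr).coinv_comm hs
  have hinv := P.locInv_mul hr
  change ∀ a, (P.locMap hr).hom (P.proj r) * a = a * (P.locMap hr).hom (P.proj r) at hc
  rw [← hc] at hinv
  set σ := (P.locMap hr).hom (P.proj r) with hσ
  have hck : ∀ (k : ℕ) a, σ ^ k * a = a * σ ^ k := fun k a =>
    (show Commute σ a from hc a).pow_left k
  refine (P.locPres hr).induction (p := fun z => ∃ (k : ℕ) (y : B),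
    σ ^ k * z = (P.locMap hr).hom y) z ⟨0, 1, ?_⟩ ?_ ?_ ?_
  · rw [pow_zero, one_mul, map_one]
  · rintro a b ⟨k, y, h⟩ ⟨k', y', h'⟩
    refine ⟨k + k', P.proj r ^ k' * y + P.proj r ^ k * y', ?_⟩
    rw [map_add, map_mul, map_mul, map_pow, map_pow, ← hσ, ← h, ← h', mul_add, ← mul_assoc,
      ← mul_assoc, ← pow_add, ← pow_add, add_comm k' k]
  · rintro c a ⟨k, y, h⟩
    exact ⟨k, c • y, by rw [mul_smul_comm, h, map_smul]⟩
  · rintro i a ⟨k, y, h⟩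
    revert i
    -- The adjoined inverse costs one more power of `s` in the denominator; the old generators cost
    -- none.
    refine Fin.cases ⟨k + 1, y, ?_⟩ fun i => ⟨k, P.x i * y, ?_⟩
    · change σ ^ (k + 1) * (P.locInv hr * a) = _
      rw [pow_succ, mul_assoc, ← mul_assoc σ, hinv, one_mul, h]
    · rw [x_succ, ← mul_assoc, hck, mul_assoc, h, map_mul]

/-- The presented localization maps, compatibly with `B`, to the central localization. Whatever dies
in the former dies in the latter, where the kernel is known to be power torsion. -/
lemma exists_pow_mul_eq_zero (y : B) (hy : (P.locMap hr).hom y = 0) :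
    ∃ k : ℕ, P.proj r ^ k * y = 0 := by
  obtain ⟨C, _, _, f, c, h1, h2, h3⟩ :=
    exists_central_localization (K := K) (P.proj r) (B.coinv_comm (P.proj_homog hr))
  obtain ⟨g, hg, -⟩ := P.exists_locLift hr f c h1 h2
  exact h3 y (by rw [← hg, AlgHom.comp_apply, hy, map_zero])

end

end Presentation

/-- Localizations of finitely presented algebras at coinvariants. -/
lemma exists_localization (Y : ToricSpace R) {s : Y.alg} (hs : IsHomog (K := K) (0 : Wt n) s) :
    ∃ (Z : ToricSpace R) (l : Z ⟶ Y), IsUnit ((pull l).hom s) ∧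
      (∀ (W : ToricSpace R) (g : W ⟶ Y), IsUnit ((pull g).hom s) → ∃ g' : W ⟶ Z, g' ≫ l = g) ∧
      (∀ z : Z.alg, ∃ (k : ℕ) (y : Y.alg), (pull l).hom s ^ k * z = (pull l).hom y) ∧
      ∀ y : Y.alg, (pull l).hom y = 0 → ∃ k : ℕ, s ^ k * y = 0 := by
  obtain ⟨P⟩ := Y.finPres
  obtain ⟨r, hr, rfl⟩ : ∃ r, IsHomog (K := K) (0 : Wt n) r ∧ P.proj r = s := by
    obtain ⟨r, rfl⟩ := P.proj_surjective s
    -- The added relation must be homogeneous, so the representative of `s` is replaced by its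
    -- weight-zero part.
    exact ⟨comp K 0 r, comp_homog 0 r, P.proj_comp hs⟩
  have hl0 := (P.locMap hr).map_homog hs
  have hinv := P.locInv_mul hr
  have hinv' : (P.locMap hr).hom (P.proj r) * P.locInv hr = 1 :=
    ((P.loc hr).coinv_comm hl0 _).trans hinv
  refine ⟨⟨P.loc hr, ⟨P.locPres hr⟩⟩, ofPull (P.locMap hr), ?_, ?_, ?_, ?_⟩
  · exact ⟨⟨_, _, hinv', hinv⟩, rfl⟩
  · intro W g hg
    -- The new generator has weight zero, so for the lift to be equivariant it has to go to a
    -- coinvariant inverse.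
    obtain ⟨c, hc, hc1, -⟩ := W.alg.exists_coinv_inverse ((pull g).map_homog hs) hg
    obtain ⟨f, hf, hfc⟩ := P.exists_locLift hr (pull g).hom c hc1 fun b => W.alg.coinv_comm hc _
    refine ⟨ofPull ⟨f, (P.locPres hr).equivariant_of_gen f fun i => ?_⟩, ToricHom.ext hf⟩
    refine Fin.cases ?_ (fun i => ?_) i
    · exact (show IsHomog (K := K) (0 : Wt n) (f (P.locInv hr)) from hfc ▸ hc)
    · refine (congrArg (IsHomog (K := K) (P.deg i))
        ((congrArg f (P.x_succ hr i)).trans (AlgHom.congr_fun hf _))).mpr ?_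
      exact (pull g).map_homog (P.x_homog i)
  · exact P.exists_pow_mul_eq hr
  · exact P.exists_pow_mul_eq_zero hr

/-! ### Sheaves of abelian groups and rings -/

section Forget

universe v w

variable {C : Type w} [Category.{v} C] {J : GrothendieckTopology C}

/-- Amalgamate the family at each element of the test group. Uniqueness of amalgamations makes the
resulting map additive, and no limit over the site is formed. -/
lemma isSheaf_of_isSheaf_forget_addCommGrp {P : Cᵒᵖ ⥤ AddCommGrpCat.{u}}
    (h : Presieve.IsSheaf J (P ⋙ forget AddCommGrpCat.{u})) : Presheaf.IsSheaf J P := by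
  intro E X S hS x hx
  have hS := h S hS
  have hx' : ∀ e : E, Presieve.FamilyOfElements.Compatible
      (P := P ⋙ forget AddCommGrpCat.{u}) (fun Y f (hf : S f) => (x f hf).hom e) :=
    fun e Y₁ Y₂ Z g₁ g₂ f₁ f₂ h₁ h₂ hc =>
      congrArg (fun k : E ⟶ P.obj (Opposite.op Z) => k.hom e) (hx g₁ g₂ h₁ h₂ hc)
  choose t ht hu using fun e => hS _ (hx' e)
  have ht' : ∀ (e : E) (Y : C) (f : Y ⟶ X) (hf : S f), (P.map f.op).hom (t e) = (x f hf).hom e :=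
    fun e Y f hf => ht e f hf
  have ext : ∀ y y' : P.obj (Opposite.op X),
      (∀ (Y : C) (f : Y ⟶ X), S f → (P.map f.op).hom y = (P.map f.op).hom y') → y = y' :=
    fun y y' hy => hS.isSeparatedFor.ext fun Y f hf => hy Y f hf
  let T : E →+ P.obj (Opposite.op X) :=
    { toFun := t
      map_zero' := ext _ _ fun Y f hf => by rw [ht' _ Y f hf, map_zero, map_zero]
      map_add' := fun a b => ext _ _ fun Y f hf => by rw [ht' _ Y f hf, map_add, map_add, ht' _ Y f hf, ht' _ Y f hf] }
  refine ⟨AddCommGrpCat.ofHom T, fun Y f hf => ?_, fun T' hT' => ?_⟩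
  · exact AddCommGrpCat.hom_ext (AddMonoidHom.ext fun e => ht' e Y f hf)
  · refine AddCommGrpCat.hom_ext (AddMonoidHom.ext fun e => ext _ _ fun Y f hf => ?_)
    exact (congrArg (fun k : E ⟶ P.obj (Opposite.op Y) => k.hom e) (hT' f hf)).trans
      (ht' e Y f hf).symm

/-- As for abelian groups: uniqueness of amalgamations also forces compatibility with products and
units. -/
lemma isSheaf_of_isSheaf_forget_ring {P : Cᵒᵖ ⥤ RingCat.{u}}
    (h : Presieve.IsSheaf J (P ⋙ forget RingCat.{u})) : Presheaf.IsSheaf J P := by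
  intro E X S hS x hx
  have hS := h S hS
  have hx' : ∀ e : E, Presieve.FamilyOfElements.Compatible
      (P := P ⋙ forget RingCat.{u}) (fun Y f (hf : S f) => (x f hf).hom e) :=
    fun e Y₁ Y₂ Z g₁ g₂ f₁ f₂ h₁ h₂ hc =>
      congrArg (fun k : E ⟶ P.obj (Opposite.op Z) => k.hom e) (hx g₁ g₂ h₁ h₂ hc)
  choose t ht hu using fun e => hS _ (hx' e)
  have ht' : ∀ (e : E) (Y : C) (f : Y ⟶ X) (hf : S f), (P.map f.op).hom (t e) = (x f hf).hom e :=
    fun e Y f hf => ht e f hf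
  have ext : ∀ y y' : P.obj (Opposite.op X),
      (∀ (Y : C) (f : Y ⟶ X), S f → (P.map f.op).hom y = (P.map f.op).hom y') → y = y' :=
    fun y y' hy => hS.isSeparatedFor.ext fun Y f hf => hy Y f hf
  let T : E →+* P.obj (Opposite.op X) :=
    { toFun := t
      map_zero' := ext _ _ fun Y f hf => by rw [ht' _ Y f hf, map_zero, map_zero]
      map_add' := fun a b => ext _ _ fun Y f hf => by rw [ht' _ Y f hf, map_add, map_add, ht' _ Y f hf, ht' _ Y f hf]
      map_one' := ext _ _ fun Y f hf => by rw [ht' _ Y f hf, map_one, map_one]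
      map_mul' := fun a b => ext _ _ fun Y f hf => by rw [ht' _ Y f hf, map_mul, map_mul, ht' _ Y f hf, ht' _ Y f hf] }
  refine ⟨RingCat.ofHom T, fun Y f hf => ?_, fun T' hT' => ?_⟩
  · exact RingCat.hom_ext (RingHom.ext fun e => ht' e Y f hf)
  · refine RingCat.hom_ext (RingHom.ext fun e => ext _ _ fun Y f hf => ?_)
    exact (congrArg (fun k : E ⟶ P.obj (Opposite.op Y) => k.hom e) (hT' f hf)).trans
      (ht' e Y f hf).symm

end Forget

/-! ### Descent along localizations -/

section Descent

variable (V : Type u) [AddCommGroup V] [Module K V]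

/-- Restriction of functions with values in `V`. -/
def res {Y Z : ToricSpace R} (f : Z ⟶ Y) : Y.alg ⊗[K] V →ₗ[K] Z.alg ⊗[K] V :=
  (pull f).hom.toLinearMap.rTensor V

lemma res_comp {Y Z W : ToricSpace R} (g : W ⟶ Z) (f : Z ⟶ Y) (x : Y.alg ⊗[K] V) :
    res V (g ≫ f) x = res V g (res V f x) :=
  LinearMap.congr_fun (LinearMap.rTensor_comp V (pull g).hom.toLinearMap
    (pull f).hom.toLinearMap) x

lemma res_smul {Y Z : ToricSpace R} (f : Z ⟶ Y) (a : Y.alg) (x : Y.alg ⊗[K] V) :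
    res V f (a • x) = (pull f).hom a • res V f x := rTensor_smul V (pull f) a x

lemma coinv_smul_comm {A : ToricAlg R} {s : A} (hs : IsHomog (K := K) (0 : Wt n) s) (a : A)
    (x : A ⊗[K] V) : s • a • x = a • s • x := by
  rw [smul_smul, A.coinv_comm hs, mul_smul]

lemma coinv_pow {A : ToricAlg R} {s : A} (hs : IsHomog (K := K) (0 : Wt n) s) (k : ℕ) :
    IsHomog (K := K) (0 : Wt n) (s ^ k) := (coinvAlg A).pow_mem hs k

variable {V} in
-- Clears the denominators of the finitely many terms of a tensor. Allowing every large exponent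
-- lets finitely many tensors share one.
lemma exists_pow_smul_eq {Y Z : ToricSpace R} {l : Z ⟶ Y} {s : Y.alg}
    (hl : ∀ z : Z.alg, ∃ (k : ℕ) (y : Y.alg), (pull l).hom s ^ k * z = (pull l).hom y)
    (w : Z.alg ⊗[K] V) : ∃ k0 : ℕ, ∀ k, k0 ≤ k → ∃ x, (pull l).hom s ^ k • w = res V l x := by
  suffices h : ∃ (k0 : ℕ) (x : _), (pull l).hom s ^ k0 • w = res V l x by
    obtain ⟨k0, x, hx⟩ := h
    refine ⟨k0, fun k hk => ⟨s ^ (k - k0) • x, ?_⟩⟩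
    rw [res_smul, ← hx, smul_smul, map_pow, ← pow_add, Nat.sub_add_cancel hk]
  induction w with
  | zero => exact ⟨0, 0, by simp⟩
  | tmul z v =>
    obtain ⟨k, y, hy⟩ := hl z
    refine ⟨k, y ⊗ₜ v, ?_⟩
    rw [TensorProduct.smul_tmul', smul_eq_mul, hy]
    exact (LinearMap.rTensor_tmul V (pull l).hom.toLinearMap v y).symm
  | add w w' h h' =>
    obtain ⟨k, x, hx⟩ := h
    obtain ⟨k', x', hx'⟩ := h'
    refine ⟨k' + k, s ^ k' • x + s ^ k • x', ?_⟩
    rw [map_add, res_smul, res_smul, ← hx, ← hx', smul_smul, smul_smul, map_pow, map_pow,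
      ← pow_add, ← pow_add, smul_add, add_comm k k']

variable {V} in
-- Flatness over the field identifies the kernel of `l^* ⊗ V` with the image of `ker l^* ⊗ V`, where
-- each pure tensor is killed by a power of `s`.
lemma exists_pow_smul_eq_zero {Y Z : ToricSpace R} {l : Z ⟶ Y} {s : Y.alg}
    (hl : ∀ y : Y.alg, (pull l).hom y = 0 → ∃ k : ℕ, s ^ k * y = 0) {x : Y.alg ⊗[K] V}
    (hx : res V l x = 0) : ∃ k0 : ℕ, ∀ k, k0 ≤ k → s ^ k • x = 0 := by
  suffices h : ∃ k0 : ℕ, s ^ k0 • x = 0 by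
    obtain ⟨k0, hx⟩ := h
    refine ⟨k0, fun k hk => ?_⟩
    rw [← Nat.sub_add_cancel hk, pow_add, mul_smul, hx, smul_zero]
  have hex := Module.Flat.rTensor_exact V (pull l).hom.toLinearMap.exact_subtype_ker_map
  obtain ⟨y, rfl⟩ := (hex x).1 hx
  clear hx
  induction y with
  | zero => exact ⟨0, by simp⟩
  | tmul y v =>
    obtain ⟨k, hk⟩ := hl y y.2
    refine ⟨k, ?_⟩
    rw [LinearMap.rTensor_tmul, Submodule.subtype_apply, TensorProduct.smul_tmul', smul_eq_mul, hk,
      TensorProduct.zero_tmul]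
  | add x y hx hy =>
    obtain ⟨k, hk⟩ := hx
    obtain ⟨k', hk'⟩ := hy
    refine ⟨k' + k, ?_⟩
    rw [map_add, smul_add, pow_add, mul_smul, hk, smul_zero, ← pow_add, add_comm k' k, pow_add,
      mul_smul, hk', smul_zero, zero_add]

/-- Taking weight-zero parts of the coefficients puts the relation into the commutative ring of
coinvariants, where powers of generators of the unit ideal again generate it. -/
lemma exists_pow_partition {A : ToricAlg R} {k : ℕ} {s a : Fin k → A}
    (hs : ∀ i, IsHomog (K := K) (0 : Wt n) (s i)) (h : ∑ i, a i * s i = 1) (N : ℕ) :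
    ∃ c : Fin k → A, ∑ i, c i * s i ^ N = 1 := by
  let : CommRing (coinvAlg A) :=
    { (inferInstance : Ring (coinvAlg A)) with
      mul_comm := fun x y => Subtype.ext (coinvAlg_mul_comm A x y) }
  let s' : Fin k → coinvAlg A := fun i => ⟨s i, hs i⟩
  have h1 : Ideal.span (Set.range s') = ⊤ := by
    rw [Ideal.eq_top_iff_one]
    refine (Ideal.mem_span_range_iff_exists_fun).2 ⟨fun i => ⟨comp K 0 (a i), comp_homog 0 _⟩, ?_⟩
    refine Subtype.ext ?_
    have h2 := congrArg (comp K (0 : Wt n)) h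
    rw [A.one_coinv.comp_eq, map_sum] at h2
    refine (map_sum (coinvAlg A).val _ _).trans (Eq.trans ?_ h2)
    refine Finset.sum_congr rfl fun i _ => ?_
    rw [A.comp_mul_right (hs i), sub_zero]
    rfl
  have h2 := Ideal.span_pow_eq_top _ h1 N
  rw [← Set.range_comp, Ideal.eq_top_iff_one] at h2
  obtain ⟨c, hc⟩ := (Ideal.mem_span_range_iff_exists_fun).1 h2
  refine ⟨fun i => c i, Eq.trans ?_ (congrArg Subtype.val hc)⟩
  exact (map_sum (coinvAlg A).val (fun i => c i * s' i ^ N) Finset.univ).symm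

lemma exists_forall_of_finite {ι : Type*} [Finite ι] {p : ι → ℕ → Prop}
    (h : ∀ i, ∃ k0, ∀ k, k0 ≤ k → p i k) : ∃ k, ∀ i, p i k := by
  choose f hf using h
  obtain ⟨N, hN⟩ := Finite.exists_le f
  exact ⟨N, fun i => hf i N (hN i)⟩

variable {V} in
/-- Elements of `B ⊗ V` that agree after inverting each of the `s_i` are equal. -/
lemma eq_of_res_eq {Y : ToricSpace R} {k : ℕ} {s a : Fin k → Y.alg}
    (hs : ∀ i, IsHomog (K := K) (0 : Wt n) (s i)) (h : ∑ i, a i * s i = 1) {x x' : Y.alg ⊗[K] V}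
    (hx : ∀ (i : Fin k) (Z : ToricSpace R) (g : Z ⟶ Y), IsUnit ((pull g).hom (s i)) →
      res V g x = res V g x') : x = x' := by
  have h0 : ∀ i, ∃ k0, ∀ k, k0 ≤ k → s i ^ k • (x - x') = 0 := by
    intro i
    obtain ⟨Z, l, hu, -, -, hl⟩ := exists_localization Y (hs i)
    exact exists_pow_smul_eq_zero hl (by rw [map_sub, hx i Z l hu, sub_self])
  obtain ⟨N, hN⟩ := exists_forall_of_finite h0
  obtain ⟨c, hc⟩ := exists_pow_partition hs h N
  -- One exponent `N` kills the difference for every `s_i`, and the `N`-th powers of the `s_i`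
  -- generate the unit ideal.
  rw [← sub_eq_zero, ← one_smul Y.alg (x - x'), ← hc, Finset.sum_smul]
  exact Finset.sum_eq_zero fun i _ => by rw [mul_smul, hN i, smul_zero]

variable {V} in
/-- Elements of the `B[s_i⁻¹] ⊗ V` that agree on overlaps come from an element of `B ⊗ V`. -/
lemma exists_glue {Y : ToricSpace R} {k : ℕ} {s a : Fin k → Y.alg}
    (hs : ∀ i, IsHomog (K := K) (0 : Wt n) (s i)) (h : ∑ i, a i * s i = 1)
    {Z : Fin k → ToricSpace R} {l : ∀ i, Z i ⟶ Y} (hu : ∀ i, IsUnit ((pull (l i)).hom (s i)))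
    (hl : ∀ i, ∀ z : (Z i).alg, ∃ (k : ℕ) (y : Y.alg),
      (pull (l i)).hom (s i) ^ k * z = (pull (l i)).hom y)
    (w : ∀ i, (Z i).alg ⊗[K] V)
    (hw : ∀ i j, ∃ (W : ToricSpace R) (p : W ⟶ Z i) (q : W ⟶ Z j), p ≫ l i = q ≫ l j ∧
      (∀ y : Y.alg, (pull (p ≫ l i)).hom y = 0 → ∃ k : ℕ, (s i * s j) ^ k * y = 0) ∧
      res V p (w i) = res V q (w j)) :
    ∃ x : Y.alg ⊗[K] V, ∀ i, res V (l i) x = w i := by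
  obtain ⟨N, hN⟩ := exists_forall_of_finite fun i => exists_pow_smul_eq (hl i) (w i)
  -- The local section `w i` is the fraction `m i / s_i ^ N`, with the same exponent for all `i`.
  choose m hm using hN
  -- Agreement on overlaps makes the cross-multiplied numerators equal up to torsion for `s_i s_j`.
  have h0 : ∀ ij : Fin k × Fin k, ∃ k0, ∀ k, k0 ≤ k →
      (s ij.1 * s ij.2) ^ k • (s ij.2 ^ N • m ij.1 - s ij.1 ^ N • m ij.2) = 0 := by
    rintro ⟨i, j⟩
    obtain ⟨W, p, q, hpq, hker, hwpq⟩ := hw i j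
    refine exists_pow_smul_eq_zero hker ?_
    have hp : ∀ y, (pull (p ≫ l i)).hom y = (pull p).hom ((pull (l i)).hom y) := fun _ => rfl
    have hq : ∀ y, (pull (p ≫ l i)).hom y = (pull q).hom ((pull (l j)).hom y) := fun y => by
      rw [hpq]; rfl
    rw [map_sub, res_smul, res_smul, sub_eq_zero]
    conv_lhs => rw [res_comp, ← hm i, res_smul]
    conv_rhs => rw [hpq, res_comp, ← hm j, res_smul, ← hpq]
    rw [← hwpq, map_pow, map_pow, map_pow, map_pow, ← hp, ← hq]
    exact coinv_smul_comm V (coinv_pow ((pull (p ≫ l i)).map_homog (hs j)) N) _ _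
  obtain ⟨N', hN'⟩ := exists_forall_of_finite h0
  -- Enlarging numerator and denominator by `s_i ^ N'` absorbs the torsion, so the cross relations
  -- hold exactly in `B ⊗ V`.
  have key : ∀ i j, s i ^ (N + N') • s j ^ N' • m j = s j ^ (N + N') • s i ^ N' • m i := by
    intro i j
    have h1 := hN' (i, j)
    have hc : Commute (s i) (s j) := Y.alg.coinv_comm (hs i) (s j)
    rw [smul_sub, sub_eq_zero, hc.mul_pow, smul_smul, smul_smul] at h1
    have hi := hc.pow_pow N' N'
    rw [smul_smul, smul_smul]
    convert h1.symm using 2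
    · rw [mul_assoc, (hc.symm.pow_pow N' N).eq, ← mul_assoc, ← pow_add, add_comm N' N]
    · rw [hi.eq, mul_assoc, (hc.pow_pow N' N).eq, ← mul_assoc, ← pow_add, add_comm N' N]
  obtain ⟨c, hc⟩ := exists_pow_partition hs h (N + N')
  -- The usual gluing formula: numerators weighted by a partition of unity in the denominators `s_j
  -- ^ (N + N')`.
  refine ⟨∑ j, c j • s j ^ N' • m j, fun i => ?_⟩
  have h1 : s i ^ (N + N') • ∑ j, c j • s j ^ N' • m j = s i ^ N' • m i := by
    rw [Finset.smul_sum]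
    conv_rhs => rw [← one_smul Y.alg (s i ^ N' • m i), ← hc, Finset.sum_smul]
    refine Finset.sum_congr rfl fun j _ => ?_
    rw [coinv_smul_comm V (coinv_pow (hs i) _), key, mul_smul]
  have h2 := congrArg (res V (l i)) h1
  rw [res_smul, res_smul, ← hm i, smul_smul, map_pow, map_pow, ← pow_add, add_comm N' N] at h2
  exact ((hu i).pow _).smul_left_cancel.1 h2

/-! ### Zariski sieves and the sheaf property of `j(V)` -/

variable [Comod K n V]

/-- A sieve on `X_B` that contains every morphism along which some `s_i` becomes invertible, for
coinvariants `s_i` generating the unit ideal. -/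
def IsZariskiSieve {Y : ToricSpace R} (T : Sieve Y) : Prop :=
  ∃ (k : ℕ) (s a : Fin k → Y.alg), (∀ i, IsHomog (K := K) (0 : Wt n) (s i)) ∧
    ∑ i, a i * s i = 1 ∧
    ∀ (i : Fin k) (Z : ToricSpace R) (g : Z ⟶ Y), IsUnit ((pull g).hom (s i)) → T g

/-- A partition of unity stays one under `f^*`. For the generated topology the sheaf condition has
to be tested on all pullbacks of covers. -/
lemma IsZariskiSieve.pullback {Y Z : ToricSpace R} {T : Sieve Y} (hT : IsZariskiSieve T)
    (f : Z ⟶ Y) : IsZariskiSieve (T.pullback f) := by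
  obtain ⟨k, s, a, hs, h, hT⟩ := hT
  refine ⟨k, fun i => (pull f).hom (s i), fun i => (pull f).hom (a i),
    fun i => (pull f).map_homog (hs i), ?_, fun i W g hg => hT i W (g ≫ f) hg⟩
  have := congrArg (pull f).hom h
  rw [map_sum, map_one] at this
  rw [← this]
  exact Finset.sum_congr rfl fun i _ => (map_mul (pull f).hom _ _).symm

/-- Only the existence half of the universal property matters: a morphism inverting `s_i` factors
through the corresponding member of the cover. -/
lemma isZariskiSieve_generate {Y : ToricSpace R} {S : Presieve Y}
    (hS : S ∈ (zariskiPrecoverage R).coverings Y) : IsZariskiSieve (Sieve.generate S) := by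
  obtain ⟨k, Z, f, s, a, hs, hf, h, rfl⟩ := hS
  refine ⟨k, s, a, hs, h, fun i W g hg => ?_⟩
  obtain ⟨g', hg', -⟩ := (hf i).existsUnique_lift W.alg (pull g) hg
  exact ⟨Z i, ofPull g', f i, Presieve.ofArrows.mk i, hg'⟩

/-- The localizations at the `s_i` belong to the sieve, and every other member becomes a morphism
into one of them once `s_i` is inverted on it. Gluing over the localizations is therefore enough. -/
lemma isSheafFor_jAb {Y : ToricSpace R} {T : Sieve Y} (hT : IsZariskiSieve T) :
    Presieve.IsSheafFor (jAb V R ⋙ forget AddCommGrpCat.{u}) T.arrows := by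
  obtain ⟨k, s, a, hs, h, hT⟩ := hT
  intro x hx
  have hx' : ∀ {Z W U : ToricSpace R} (f : Z ⟶ Y) (g : W ⟶ Y) (p : U ⟶ Z) (q : U ⟶ W)
      (hf : T f) (hg : T g), p ≫ f = q ≫ g → res V p (x f hf).1 = res V q (x g hg).1 :=
    fun f g p q hf hg hc => congrArg Subtype.val (hx p q hf hg hc)
  choose Z l hu hlift hl hker using fun i => exists_localization Y (hs i)
  have hw : ∀ i j, ∃ (W : ToricSpace R) (p : W ⟶ Z i) (q : W ⟶ Z j), p ≫ l i = q ≫ l j ∧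
      (∀ y : Y.alg, (pull (p ≫ l i)).hom y = 0 → ∃ k : ℕ, (s i * s j) ^ k * y = 0) ∧
      res V p (x (l i) (hT i _ _ (hu i))).1 = res V q (x (l j) (hT j _ _ (hu j))).1 := by
    intro i j
    have hsij : IsHomog (K := K) (0 : Wt n) (s i * s j) := (coinvAlg Y.alg).mul_mem (hs i) (hs j)
    -- The localization at `s_i s_j` plays the role of the overlap: it inverts both factors, so it
    -- maps to both pieces.
    obtain ⟨W, lij, huij, -, -, hkij⟩ := exists_localization Y hsij
    have hcomm : Commute ((pull lij).hom (s i)) ((pull lij).hom (s j)) :=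
      W.alg.coinv_comm ((pull lij).map_homog (hs i)) _
    rw [map_mul, hcomm.isUnit_mul_iff] at huij
    obtain ⟨p, hp⟩ := hlift i W lij huij.1
    obtain ⟨q, hq⟩ := hlift j W lij huij.2
    exact ⟨W, p, q, hp.trans hq.symm, by rwa [hp], hx' _ _ _ _ _ _ (hp.trans hq.symm)⟩
  obtain ⟨y, hy⟩ := exists_glue hs h hu hl (fun i => (x (l i) (hT i _ _ (hu i))).1) hw
  -- The glued element need not be coinvariant, but its weight-zero part has the same restrictions
  -- because those are coinvariant.
  have hy' : ∀ i, res V (l i) (comp K 0 y) = (x (l i) (hT i _ _ (hu i))).1 := fun i => by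
    have h1 : res V (l i) (comp K 0 y) = comp K (0 : Wt n) (res V (l i) y) :=
      (rTensor_equivariant V (pull (l i))).map_comp 0 y
    rw [h1, hy i]
    exact IsHomog.comp_eq (x (l i) (hT i _ _ (hu i))).2
  refine ⟨(⟨comp K 0 y, comp_homog 0 y⟩ : coinv K n (Y.alg ⊗[K] V)), fun W g hg => ?_, ?_⟩
  · refine Subtype.ext ?_
    obtain ⟨k', hk'⟩ : ∃ a' : Fin k → W.alg, ∑ i, a' i * (pull g).hom (s i) = 1 := by
      refine ⟨fun i => (pull g).hom (a i), ?_⟩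
      have := congrArg (pull g).hom h
      rw [map_sum, map_one] at this
      rw [← this]
      exact Finset.sum_congr rfl fun i _ => (map_mul (pull g).hom _ _).symm
    -- On an arbitrary member `g` of the sieve, equality is tested after inverting the pulled-back
    -- `s_i`, where `g` factors through a localization.
    refine eq_of_res_eq (V := V) (fun i => (pull g).map_homog (hs i)) hk' fun i U f hf => ?_
    obtain ⟨f', hf'⟩ := hlift i U (f ≫ g) hf
    refine (res_comp V f g (comp K 0 y)).symm.trans ?_
    rw [← hf', res_comp, hy']
    exact hx' _ _ _ _ _ _ hf'
  · intro t ht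
    refine Subtype.ext (eq_of_res_eq (V := V) hs h fun i U f hf => ?_)
    obtain ⟨f', hf'⟩ := hlift i U f hf
    rw [← hf', res_comp, res_comp, hy']
    exact congrArg (fun z => res V f' z.1) (ht (l i) (hT i _ _ (hu i)))

lemma isSheaf_jAb_forget :
    Presieve.IsSheaf (zariskiTopology R) (jAb V R ⋙ forget AddCommGrpCat.{u}) :=
  (Precoverage.isSheaf_toGrothendieck_iff _).2 fun _ hS =>
    isSheafFor_jAb V ((isZariskiSieve_generate hS).pullback _)

lemma isSheaf_jMod : Presheaf.IsSheaf (zariskiTopology R) (jMod V R).presheaf :=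
  isSheaf_of_isSheaf_forget_addCommGrp (isSheaf_jAb_forget V)

end Descent

/-! ### The line object as `j` of the ground field -/

section Line

/-- The ground field with the trivial coaction. -/
@[reducible] def trivialComod (K : Type u) [Field K] (n : ℕ) : Comod K n K :=
  Comod.ofSpan _ (TensorProduct.mk K (TorusHopf K n) K (t K 0)) (by
    rw [eq_top_iff]
    exact fun v _ => Submodule.subset_span ⟨0, rfl⟩)

attribute [local instance] trivialComod

lemma tmul_one_homog_iff (B : ToricAlg R) (b : B) :
    IsHomog (K := K) (0 : Wt n) (b ⊗ₜ[K] (1 : K)) ↔ IsHomog (K := K) (0 : Wt n) b := by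
  have h1 : IsHomog (K := K) (0 : Wt n) (1 : K) := rfl
  have he : IsEquivariant (K := K) (n := n) ((TensorProduct.mk K B K).flip 1) :=
    isEquivariant_of_homog fun m b hb => by
      have := hb.tmul h1
      rwa [add_zero] at this
  exact ⟨he.homog_of_injective (TensorProduct.rid K B).symm.injective, he.map_homog⟩

/-- The line object is the functor `j` of the ground field. -/
def lineEquivJ (B : ToricAlg R) : coinvAlg B ≃ coinv K n (B ⊗[K] K) where
  toFun b := ⟨(b : B) ⊗ₜ 1, (tmul_one_homog_iff B _).2 b.2⟩
  invFun w := ⟨TensorProduct.rid K B w.1, by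
    refine (tmul_one_homog_iff B _).1 ?_
    have := (TensorProduct.rid K B).symm_apply_apply w.1
    rw [TensorProduct.rid_symm_apply] at this
    rw [this]
    exact w.2⟩
  left_inv b := Subtype.ext (by simp)
  right_inv w := Subtype.ext ((TensorProduct.rid_symm_apply _).symm.trans
    ((TensorProduct.rid K B).symm_apply_apply w.1))

lemma isSheaf_lineRing : Presheaf.IsSheaf (zariskiTopology R) (lineRing R) := by
  refine isSheaf_of_isSheaf_forget_ring ?_
  refine (Presieve.isSheaf_iff_of_nat_equiv (P₁ := lineRing R ⋙ forget RingCat.{u})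
    (P₂ := jAb K R ⋙ forget AddCommGrpCat.{u}) (fun X => lineEquivJ X.alg)
    fun X Y f b => ?_).2 (isSheaf_jAb_forget K)
  exact Subtype.ext (LinearMap.rTensor_tmul K (pull f).hom.toLinearMap (1 : K)
    (show coinvAlg Y.alg from b).1).symm

end Line

/-! ### Braided derivations with coefficients -/

lemma coprodMul_right_one {A B : ToricAlg R} (w : A ⊗[K] B) :
    coprodMul A B w (1 ⊗ₜ 1) = w := by
  refine tensor_homog_induction (K := K) (n := n)
    (P := fun w => coprodMul A B w (1 ⊗ₜ 1) = w) w (by simp)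
    (fun x y hx hy => by simp only [map_add, LinearMap.add_apply, hx, hy])
    fun m p a b _ hb => ?_
  rw [coprodMul_homog a 1 hb A.one_coinv, R.chi_zero_left, one_smul, mul_one, mul_one]

/-- The Leibniz rule for `1 * 1` reads `v(1) = v(1) + v(1)`. -/
lemma hDer_one {A B : ToricAlg R} (v : hDer A B) : v.1 1 = 0 := by
  have h := v.2.2 1 1
  rw [coprodMul_right_one, coprodMul_left_one, one_smul, mul_one] at h
  exact left_eq_add.1 h

namespace Presentation

variable {A : ToricAlg R} (P : Presentation A) (B : ToricAlg R)

/-- The action of `B ⊗ ∐_j A[-m_j]` on the free algebra, with values in `B ⊗ A`. -/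
def evTensor (a : FreeCarrier R P.deg) : B ⊗[K] P.Ambient →ₗ[K] B ⊗[K] A :=
  (P.evFree.flip a).lTensor B

variable {B}

lemma evTensor_tmul (a : FreeCarrier R P.deg) (b : B) (L : P.Ambient) :
    P.evTensor B a (b ⊗ₜ L) = b ⊗ₜ P.evFree L a := rfl

lemma evTensor_add (a a' : FreeCarrier R P.deg) (w : B ⊗[K] P.Ambient) :
    P.evTensor B (a + a') w = P.evTensor B a w + P.evTensor B a' w := by
  rw [evTensor, map_add, LinearMap.lTensor_add]; rfl

lemma evTensor_smul (c : K) (a : FreeCarrier R P.deg) (w : B ⊗[K] P.Ambient) :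
    P.evTensor B (c • a) w = c • P.evTensor B a w := by
  rw [evTensor, map_smul, LinearMap.lTensor_smul]; rfl

/-- For `b ⊗ L` with `b` of weight `-m` and `L` of weight `m`, the scalar for moving `L` past `a`
equals the one for moving `a` past `b` in `B ⊔ A`. The braided Leibniz rule thus becomes the rule
defining `hDer`. -/
lemma evTensor_mul {w : B ⊗[K] P.Ambient} (hw : IsHomog (K := K) (0 : Wt n) w)
    (a a' : FreeCarrier R P.deg) :
    P.evTensor B (a * a') w = coprodMul B A (P.evTensor B a w) (1 ⊗ₜ P.proj a') +
      coprodMul B A (1 ⊗ₜ P.proj a) (P.evTensor B a' w) := by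
  refine coinv_tensor_induction (K := K) (n := n) (P := fun w => P.evTensor B (a * a') w =
    coprodMul B A (P.evTensor B a w) (1 ⊗ₜ P.proj a') +
      coprodMul B A (1 ⊗ₜ P.proj a) (P.evTensor B a' w)) w hw
    (by simp) (fun x y hx hy => by
      simp only [map_add, LinearMap.add_apply, hx, hy]; abel) fun m b L hb hL => ?_
  refine homog_induction (K := K) (n := n) (P := fun a => P.evTensor B (a * a') (b ⊗ₜ L) =
    coprodMul B A (P.evTensor B a (b ⊗ₜ L)) (1 ⊗ₜ P.proj a') +
      coprodMul B A (1 ⊗ₜ P.proj a) (P.evTensor B a' (b ⊗ₜ L))) a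
    (by simp [evTensor_tmul]) (fun x y hx hy => by
      simp only [add_mul, evTensor_add, map_add, hx, hy, TensorProduct.tmul_add,
        LinearMap.add_apply]; abel) fun q a ha => ?_
  rw [evTensor_tmul, evTensor_tmul, evTensor_tmul, P.evFree_mul hL ha,
    coprodMul_homog _ _ (P.evFree_homog hL ha) B.one_coinv,
    coprodMul_homog _ _ (P.proj_homog ha) hb,
    R.chi_zero_left, one_smul, mul_one, one_mul, R.chi_neg_left, TensorProduct.tmul_add,
    TensorProduct.tmul_smul]

lemma evFree_gen (i : Fin P.N) (L : P.Ambient) : P.evFree L (gen R P.deg i) = P.coord i L := by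
  rw [evFree_apply, Finset.sum_eq_single i]
  · rw [partialD_gen, if_pos rfl, map_one, mul_one]
  · intro j _ hj
    rw [partialD_gen, if_neg (Ne.symm hj), map_zero, mul_zero]
  · simp

lemma evTensor_gen (i : Fin P.N) : P.evTensor B (gen R P.deg i) = (P.coord i).lTensor B :=
  congrArg (LinearMap.lTensor (B : Type u)) (LinearMap.ext (P.evFree_gen i))

/-- The coordinates of an element are its values on the generators, so it is recovered from them. -/
lemma ambient_tensor_sum (w : B ⊗[K] P.Ambient) :
    w = ∑ j, (P.inc j).lTensor B (P.evTensor B (gen R P.deg j) w) := by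
  simp only [evTensor_gen]
  induction w with
  | zero => simp
  | add x y hx hy => simp only [map_add, Finset.sum_add_distrib]; rw [← hx, ← hy]
  | tmul b L =>
    simp only [LinearMap.lTensor_tmul]
    rw [← TensorProduct.tmul_sum, ← ambient_sum]

/-- Values on the generators can be prescribed freely before the relations are imposed. -/
lemma evTensor_gen_sum (u : Fin P.N → B ⊗[K] A) (i : Fin P.N) :
    P.evTensor B (gen R P.deg i) (∑ j, (P.inc j).lTensor B (u j)) = u i := by
  rw [evTensor_gen, map_sum, Finset.sum_eq_single i]
  · rw [← LinearMap.comp_apply, ← LinearMap.lTensor_comp]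
    have : P.coord i ∘ₗ P.inc i = LinearMap.id :=
      LinearMap.ext fun a => (P.coord_inc i i a).trans (if_pos rfl)
    rw [this, LinearMap.lTensor_id, LinearMap.id_apply]
  · intro j _ hj
    rw [← LinearMap.comp_apply, ← LinearMap.lTensor_comp]
    have : P.coord i ∘ₗ P.inc j = 0 :=
      LinearMap.ext fun a => (P.coord_inc i j a).trans (if_neg (Ne.symm hj))
    rw [this, LinearMap.lTensor_zero, LinearMap.zero_apply]
  · simp

lemma lTensor_inc_homog (j : Fin P.N) {m : Wt n} {u : B ⊗[K] A} (hu : IsHomog (K := K) m u) :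
    IsHomog (K := K) (m - P.deg j) ((P.inc j).lTensor B u) := by
  have key : comp K (m - P.deg j) ((P.inc j).lTensor B u) = (P.inc j).lTensor B (comp K m u) := by
    refine tensor_homog_induction (K := K) (n := n)
      (P := fun u => comp K (m - P.deg j) ((P.inc j).lTensor B u) =
        (P.inc j).lTensor B (comp K m u)) u (by simp)
      (fun x y hx hy => by simp only [map_add, hx, hy]) fun p q b a hb ha => ?_
    rw [LinearMap.lTensor_tmul, comp_of_homog (hb.tmul (P.inc_homog j ha)),
      comp_of_homog (hb.tmul ha)]
    by_cases h : p + q = m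
    · rw [if_pos h, if_pos (by rw [← h]; abel), LinearMap.lTensor_tmul]
    · rw [if_neg h, if_neg (fun h' => h (by rw [← add_sub_assoc] at h'; exact sub_left_injective h')),
        map_zero]
  rw [hu.comp_eq] at key
  rw [← key]
  exact comp_homog _ _

/-- Allows `ξ` to be computed in the ambient comodule, on representatives in the free algebra. -/
lemma xiLin_proj (z : B ⊗[K] P.der) (a : FreeCarrier R P.deg) :
    P.xiLin B z (P.proj a) = P.evTensor B a (P.der.subtype.lTensor B z) := by
  induction z with
  | zero => simp
  | add x y hx hy => simp only [map_add, LinearMap.add_apply, hx, hy]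
  | tmul b L => rw [xiLin_tmul, ev_proj, LinearMap.lTensor_tmul, evTensor_tmul]; rfl

lemma der_lTensor_injective : Function.Injective (P.der.subtype.lTensor (B : Type u)) :=
  Module.Flat.lTensor_preserves_injective_linearMap _ P.der.injective_subtype

lemma der_lTensor_equivariant :
    IsEquivariant (K := K) (n := n) (P.der.subtype.lTensor (B : Type u)) := by
  refine isEquivariant_of_homog fun m z hz => ?_
  have key : comp K m (P.der.subtype.lTensor (B : Type u) z) =
      P.der.subtype.lTensor (B : Type u) (comp K m z) := by
    refine tensor_homog_induction (K := K) (n := n)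
      (P := fun z => comp K m (P.der.subtype.lTensor (B : Type u) z) =
        P.der.subtype.lTensor (B : Type u) (comp K m z)) z (by simp)
      (fun x y hx hy => by simp only [map_add, hx, hy]) fun p q b L hb hL => ?_
    rw [LinearMap.lTensor_tmul, Submodule.subtype_apply,
      comp_of_homog (hb.tmul (P.der_homog_iff.1 hL)),
      comp_of_homog (hb.tmul hL)]
    split_ifs
    · rw [LinearMap.lTensor_tmul]; rfl
    · rw [map_zero]
  rw [hz.comp_eq] at key
  rw [← key]
  exact comp_homog _ _

/-- Evaluation on all the relations at once. -/
def evRel : P.Ambient →ₗ[K] (Fin P.M → A) := LinearMap.pi fun k => P.evFree.flip (P.rel k)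

lemma exact_der_evRel : Function.Exact P.der.subtype P.evRel := fun L => by
  constructor
  · intro h
    exact ⟨⟨L, fun k => congrFun h k⟩, rfl⟩
  · rintro ⟨L, rfl⟩
    exact funext fun k => L.2 k

/-- `der(A)` is the kernel of evaluation on all the relations, and tensoring with `B` over a field
preserves this kernel. -/
lemma mem_range_of_evTensor_rel {w : B ⊗[K] P.Ambient}
    (hw : ∀ k, P.evTensor B (P.rel k) w = 0) :
    ∃ z, P.der.subtype.lTensor (B : Type u) z = w := by
  refine (Module.Flat.lTensor_exact (B : Type u) P.exact_der_evRel w).1 ?_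
  -- There are finitely many relations, so vanishing in `B ⊗ A^M` can be tested one relation at a
  -- time.
  refine (TensorProduct.piRight K K B fun _ : Fin P.M => (A : Type u)).injective ?_
  rw [map_zero]
  funext k
  rw [Pi.zero_apply, ← hw k]
  clear hw
  induction w with
  | zero => simp
  | add x y hx hy => simp only [map_add, Pi.add_apply, hx, hy]
  | tmul b L => rfl

/-- Injectivity: the values on the generators determine an element of `B ⊗ der(A)`. Surjectivity:
the ambient element with the generator values of `v` acts as `v` by the Leibniz rule, so it kills
the relations and comes from `B ⊗ der(A)`. -/
lemma xiApp_bijective (B : ToricAlg R) : Function.Bijective (P.xiApp B) := by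
  constructor
  · rw [injective_iff_map_eq_zero]
    intro z hz
    refine Subtype.ext (P.der_lTensor_injective ?_)
    have hz' : P.xiLin B z.1 = 0 := congrArg Subtype.val hz
    rw [P.ambient_tensor_sum (P.der.subtype.lTensor (B : Type u) z.1)]
    simp only [← xiLin_proj, hz', LinearMap.zero_apply, map_zero, Finset.sum_const_zero]
    exact (map_zero _).symm
  · intro v
    -- The candidate `∑_j v(x_j) ∂_j`; its weight is zero because `∂_j` has weight opposite to
    -- `x_j`.
    set w := ∑ j, (P.inc j).lTensor (B : Type u) (v.1 (P.x j)) with hwdef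
    have hw : IsHomog (K := K) (0 : Wt n) w := by
      refine IsHomog.sum _ _ fun j _ => ?_
      have := P.lTensor_inc_homog j (v.2.1.map_homog (P.x_homog j))
      rwa [sub_self] at this
    have hev : ∀ a, P.evTensor B a w = v.1 (P.proj a) := by
      intro a
      have h1 : P.evTensor B 1 w = 0 := by
        have := P.evTensor_mul hw 1 1
        rw [map_one, coprodMul_right_one, coprodMul_left_one, one_smul, mul_one] at this
        exact left_eq_add.1 this
      refine free_induction (P := fun a => P.evTensor B a w = v.1 (P.proj a)) a ?_ ?_ ?_ ?_
      · rw [h1, map_one, hDer_one]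
      · intro a b ha hb; rw [evTensor_add, map_add, map_add, ha, hb]
      · intro c a ha; rw [evTensor_smul, map_smul, map_smul, ha]
      · intro i a ha
        rw [P.evTensor_mul hw, map_mul, v.2.2, ha, hwdef, evTensor_gen_sum]; rfl
    obtain ⟨z, hz⟩ := P.mem_range_of_evTensor_rel (w := w) fun k => by
      rw [hev, (P.proj_eq_zero_iff _).2 (TwoSidedIdeal.subset_span ⟨k, rfl⟩), map_zero]
    refine ⟨⟨z, P.der_lTensor_equivariant.homog_of_injective P.der_lTensor_injective
      (by rw [hz]; exact hw)⟩, Subtype.ext (LinearMap.ext fun a => ?_)⟩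
    obtain ⟨a, rfl⟩ := P.proj_surjective a
    exact (P.xiLin_proj z a).trans (by rw [hz, hev])

instance : IsIso P.xi := by
  have : IsIso ((PresheafOfModules.toPresheaf (lineRing R)).map P.xi) := by
    rw [NatTrans.isIso_iff_isIso_app]
    intro X
    exact (ConcreteCategory.isIso_iff_bijective _).2 (P.xiApp_bijective X.unop.alg)
  exact isIso_of_reflects_iso P.xi (PresheafOfModules.toPresheaf (lineRing R))

include P in
-- Derivations are not glued directly: the sheaf property is transported along `ξ`, an isomorphism
-- of presheaves.
lemma isSheaf_hDerMod : Presheaf.IsSheaf (zariskiTopology R) (hDerMod A).presheaf :=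
  (Presheaf.isSheaf_of_iso_iff
    ((PresheafOfModules.toPresheaf (lineRing R)).mapIso (asIso P.xi))).1 (isSheaf_jMod P.der)

lemma isIso_xiSheaf (hK : Presheaf.IsSheaf (zariskiTopology R) (lineRing R))
    (hj : Presheaf.IsSheaf (zariskiTopology R) (jMod P.der R).presheaf)
    (hD : Presheaf.IsSheaf (zariskiTopology R) (hDerMod A).presheaf) :
    IsIso (P.xiSheaf hK hj hD) := by
  exact ⟨⟨inv P.xi⟩, SheafOfModules.Hom.ext (IsIso.hom_inv_id P.xi),
    SheafOfModules.Hom.ext (IsIso.inv_hom_id P.xi)⟩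

end Presentation

/-! ### Products of spaces -/

/-- The left multiplication of `A` on `B ⊔ A`. -/
def coprodRight (B A : ToricAlg R) : A →ₐ[K] Module.End K (B ⊗[K] A) :=
  AlgHom.ofLinearMap (coprodMul B A ∘ₗ TensorProduct.mk K B A 1)
    (LinearMap.ext fun w => (coprodMul_left_one 1 w).trans (one_smul B w)) (by
      intro a a'
      refine LinearMap.ext fun w => ?_
      refine homog_induction (K := K) (n := n) (P := fun a =>
        coprodMul B A (1 ⊗ₜ (a * a')) w = coprodMul B A (1 ⊗ₜ a) (coprodMul B A (1 ⊗ₜ a') w)) a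
        (by simp) (fun x y hx hy => by
          simp only [add_mul, TensorProduct.tmul_add, map_add, LinearMap.add_apply, hx, hy])
        fun m a ha => ?_
      refine homog_induction (K := K) (n := n) (P := fun a' =>
        coprodMul B A (1 ⊗ₜ (a * a')) w = coprodMul B A (1 ⊗ₜ a) (coprodMul B A (1 ⊗ₜ a') w)) a'
        (by simp) (fun x y hx hy => by
          simp only [mul_add, TensorProduct.tmul_add, map_add, LinearMap.add_apply, hx, hy])
        fun m' a' ha' => ?_
      refine tensor_homog_induction (K := K) (n := n) (P := fun w =>
        coprodMul B A (1 ⊗ₜ (a * a')) w = coprodMul B A (1 ⊗ₜ a) (coprodMul B A (1 ⊗ₜ a') w)) w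
        (by simp) (fun x y hx hy => by simp only [map_add, hx, hy]) fun p q b c hb _ => ?_
      rw [coprodMul_homog _ _ (A.mul_homog ha ha') hb, coprodMul_homog _ _ ha' hb, map_smul,
        one_mul, coprodMul_homog _ _ ha hb, one_mul, smul_smul, R.chi_add_right, mul_assoc,
        mul_comm (R.chi p m)])

lemma coprodRight_apply (B A : ToricAlg R) (a : A) (w : B ⊗[K] A) :
    coprodRight B A a w = coprodMul B A (1 ⊗ₜ a) w := rfl

/-- Multiplications by `b` and by `a` on `B ⊗ A` satisfy the mixed relations of `B ⊔ A`, so the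
presented coproduct acts on `B ⊗ A`. -/
lemma coprodRight_comm {B A : ToricAlg R} {m p : Wt n} {b : B} {a : A}
    (hb : IsHomog (K := K) m b) (ha : IsHomog (K := K) p a) :
    Algebra.lsmul K K (B ⊗[K] A) b * coprodRight B A a =
      R.chi p m • (coprodRight B A a * Algebra.lsmul K K (B ⊗[K] A) b) := by
  refine LinearMap.ext fun w => ?_
  change b • coprodMul B A (1 ⊗ₜ a) w = R.chi p m • coprodMul B A (1 ⊗ₜ a) (b • w)
  refine tensor_homog_induction (K := K) (n := n) (P := fun w =>
    b • coprodMul B A (1 ⊗ₜ a) w = R.chi p m • coprodMul B A (1 ⊗ₜ a) (b • w)) w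
    (by simp) (fun x y hx hy => by simp only [map_add, smul_add, hx, hy]) fun q _ b' c hb' _ => ?_
  rw [TensorProduct.smul_tmul', smul_eq_mul, coprodMul_homog _ _ ha hb',
    coprodMul_homog _ _ ha (B.mul_homog hb hb'), smul_smul, R.chi_add_left, ← mul_assoc,
    R.chi_symm, one_mul, one_mul, one_mul, smul_comm, TensorProduct.smul_tmul', smul_eq_mul]

namespace Presentation

variable {A B : ToricAlg R} (P : Presentation B) (Q : Presentation A)

/-- The weights of the generators of `B ⊔ A`. -/
def prodDeg : Fin (P.N + Q.N) → Wt n := Fin.append P.deg Q.deg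

lemma prodDeg_left (i : Fin P.N) : P.prodDeg Q (Fin.castAdd Q.N i) = P.deg i :=
  Fin.append_left _ _ i

lemma prodDeg_right (i : Fin Q.N) : P.prodDeg Q (Fin.natAdd P.N i) = Q.deg i :=
  Fin.append_right _ _ i

lemma prod_gens_comm_left (i j : Fin P.N) :
    gen R (P.prodDeg Q) (Fin.castAdd Q.N i) * gen R (P.prodDeg Q) (Fin.castAdd Q.N j) =
      R.chi (P.deg j) (P.deg i) •
        (gen R (P.prodDeg Q) (Fin.castAdd Q.N j) * gen R (P.prodDeg Q) (Fin.castAdd Q.N i)) := by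
  rw [gen_comm, prodDeg_left, prodDeg_left]

lemma prod_gens_comm_right (i j : Fin Q.N) :
    gen R (P.prodDeg Q) (Fin.natAdd P.N i) * gen R (P.prodDeg Q) (Fin.natAdd P.N j) =
      R.chi (Q.deg j) (Q.deg i) •
        (gen R (P.prodDeg Q) (Fin.natAdd P.N j) * gen R (P.prodDeg Q) (Fin.natAdd P.N i)) := by
  rw [gen_comm, prodDeg_right, prodDeg_right]

/-- The inclusion of the free algebra of the first factor. -/
def embLeft : FreeCarrier R P.deg →ₐ[K] FreeCarrier R (P.prodDeg Q) :=
  freeLift R P.deg (fun i => gen R (P.prodDeg Q) (Fin.castAdd Q.N i)) (P.prod_gens_comm_left Q)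

/-- The inclusion of the free algebra of the second factor. -/
def embRight : FreeCarrier R Q.deg →ₐ[K] FreeCarrier R (P.prodDeg Q) :=
  freeLift R Q.deg (fun i => gen R (P.prodDeg Q) (Fin.natAdd P.N i)) (P.prod_gens_comm_right Q)

lemma embLeft_gen (i : Fin P.N) :
    P.embLeft Q (gen R P.deg i) = gen R (P.prodDeg Q) (Fin.castAdd Q.N i) :=
  freeLift_gen R _ _ _ i

lemma embRight_gen (i : Fin Q.N) :
    P.embRight Q (gen R Q.deg i) = gen R (P.prodDeg Q) (Fin.natAdd P.N i) :=
  freeLift_gen R _ _ _ i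

lemma embLeft_homog {m : Wt n} {a : FreeCarrier R P.deg} (ha : IsHomog (K := K) m a) :
    IsHomog (K := K) m (P.embLeft Q a) :=
  IsEquivariant.map_homog (freeLift_equivariant (R := R) P.deg (freeAlg R (P.prodDeg Q))
    (fun i => gen R (P.prodDeg Q) (Fin.castAdd Q.N i)) (P.prod_gens_comm_left Q)
    (fun i => by rw [← P.prodDeg_left Q]; exact gen_homog R (P.prodDeg Q) _)) ha

lemma embRight_homog {m : Wt n} {a : FreeCarrier R Q.deg} (ha : IsHomog (K := K) m a) :
    IsHomog (K := K) m (P.embRight Q a) :=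
  IsEquivariant.map_homog (freeLift_equivariant (R := R) Q.deg (freeAlg R (P.prodDeg Q))
    (fun i => gen R (P.prodDeg Q) (Fin.natAdd P.N i)) (P.prod_gens_comm_right Q)
    (fun i => by rw [← P.prodDeg_right Q]; exact gen_homog R (P.prodDeg Q) _)) ha

/-- The relations of `B ⊔ A`. -/
def prodRel : Fin (P.M + Q.M) → FreeCarrier R (P.prodDeg Q) :=
  Fin.append (fun k => P.embLeft Q (P.rel k)) fun k => P.embRight Q (Q.rel k)

lemma prodRel_homog (k : Fin (P.M + Q.M)) :
    IsHomog (K := K) (Fin.append P.relDeg Q.relDeg k) (P.prodRel Q k) := by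
  refine Fin.addCases (fun k => ?_) (fun k => ?_) k
  · rw [prodRel, Fin.append_left, Fin.append_left]
    exact P.embLeft_homog Q (P.rel_homog k)
  · rw [prodRel, Fin.append_right, Fin.append_right]
    exact P.embRight_homog Q (Q.rel_homog k)

/-- The coproduct `B ⊔ A`, by generators and relations. -/
def prod : ToricAlg R := presAlg (Fin.append P.relDeg Q.relDeg) (P.prodRel_homog Q)

/-- The presentation of `B ⊔ A`. -/
def prodPres : Presentation (P.prod Q) := presPres (Fin.append P.relDeg Q.relDeg) (P.prodRel_homog Q)

/-- The quotient map onto `B ⊔ A`. -/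
def prodProj : FreeCarrier R (P.prodDeg Q) →ₐ[K] P.prod Q := (P.prodPres Q).proj

lemma prodProj_rel (k : Fin (P.M + Q.M)) : P.prodProj Q (P.prodRel Q k) = 0 :=
  ((P.prodPres Q).proj_eq_zero_iff _).2 (TwoSidedIdeal.subset_span ⟨k, rfl⟩)

lemma exists_inl : ∃ l : ToricHom B (P.prod Q), ∀ a, l.hom (P.proj a) =
    P.prodProj Q (P.embLeft Q a) := by
  obtain ⟨g, hg⟩ := P.exists_lift ((P.prodProj Q).comp (P.embLeft Q)) fun k => by
    have := P.prodProj_rel Q (Fin.castAdd Q.M k)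
    rwa [prodRel, Fin.append_left] at this
  refine ⟨⟨g, P.equivariant_of_gen g fun i => ?_⟩, hg⟩
  refine (congrArg (IsHomog (K := K) (P.deg i)) (hg _)).mpr ?_
  exact (P.prodPres Q).proj_homog (P.embLeft_homog Q (gen_homog R P.deg i))

lemma exists_inr : ∃ l : ToricHom A (P.prod Q), ∀ a, l.hom (Q.proj a) =
    P.prodProj Q (P.embRight Q a) := by
  obtain ⟨g, hg⟩ := Q.exists_lift ((P.prodProj Q).comp (P.embRight Q)) fun k => by
    have := P.prodProj_rel Q (Fin.natAdd P.M k)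
    rwa [prodRel, Fin.append_right] at this
  refine ⟨⟨g, Q.equivariant_of_gen g fun i => ?_⟩, hg⟩
  refine (congrArg (IsHomog (K := K) (Q.deg i)) (hg _)).mpr ?_
  exact (P.prodPres Q).proj_homog (P.embRight_homog Q (gen_homog R Q.deg i))

/-- The inclusion of the first summand of a coproduct. -/
def inl : ToricHom B (P.prod Q) := Classical.choose (P.exists_inl Q)

/-- The inclusion of the second summand of a coproduct. -/
def inr : ToricHom A (P.prod Q) := Classical.choose (P.exists_inr Q)

lemma inl_x (i : Fin P.N) :
    (P.inl Q).hom (P.x i) = P.prodProj Q (gen R (P.prodDeg Q) (Fin.castAdd Q.N i)) :=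
  (Classical.choose_spec (P.exists_inl Q) _).trans (congrArg _ (P.embLeft_gen Q i))

lemma inr_x (i : Fin Q.N) :
    (P.inr Q).hom (Q.x i) = P.prodProj Q (gen R (P.prodDeg Q) (Fin.natAdd P.N i)) :=
  (Classical.choose_spec (P.exists_inr Q) _).trans (congrArg _ (P.embRight_gen Q i))

/-- Relations within each factor are inherited from `f` and `g`, so only mixed commutation of
generators is needed. The target is an arbitrary algebra in order to include the endomorphisms of `B
⊗ A`. -/
lemma exists_prodLift {C : Type u} [Ring C] [Algebra K C] (f : B →ₐ[K] C) (g : A →ₐ[K] C)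
    (h : ∀ i j, f (P.x i) * g (Q.x j) = R.chi (Q.deg j) (P.deg i) • (g (Q.x j) * f (P.x i))) :
    ∃ k : P.prod Q →ₐ[K] C, k.comp (P.inl Q).hom = f ∧ k.comp (P.inr Q).hom = g := by
  let y : Fin (P.N + Q.N) → C := Fin.append (fun i => f (P.x i)) fun i => g (Q.x i)
  have hyl : ∀ i, y (Fin.castAdd Q.N i) = f (P.x i) := fun i => Fin.append_left _ _ i
  have hyr : ∀ i, y (Fin.natAdd P.N i) = g (Q.x i) := fun i => Fin.append_right _ _ i
  have hy : ∀ i j, y i * y j = R.chi (P.prodDeg Q j) (P.prodDeg Q i) • (y j * y i) := by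
    intro i j
    refine Fin.addCases (fun i => ?_) (fun i => ?_) i <;>
      refine Fin.addCases (fun j => ?_) (fun j => ?_) j
    · rw [hyl, hyl, prodDeg_left, prodDeg_left, ← map_mul, B.gens_comm P.x_homog i j, map_smul,
        map_mul]
    · rw [hyl, hyr, prodDeg_left, prodDeg_right, h]
    · rw [hyl, hyr, prodDeg_left, prodDeg_right, h, smul_smul, R.chi_symm, one_smul]
    · rw [hyr, hyr, prodDeg_right, prodDeg_right, ← map_mul, A.gens_comm Q.x_homog i j, map_smul,
        map_mul]
  have hl : (freeLift R (P.prodDeg Q) y hy).comp (P.embLeft Q) = f.comp P.proj :=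
    free_algHom_ext fun i => by
      rw [AlgHom.comp_apply, embLeft_gen, freeLift_gen, hyl]; rfl
  have hr : (freeLift R (P.prodDeg Q) y hy).comp (P.embRight Q) = g.comp Q.proj :=
    free_algHom_ext fun i => by
      rw [AlgHom.comp_apply, embRight_gen, freeLift_gen, hyr]; rfl
  obtain ⟨k, hk⟩ := (P.prodPres Q).exists_lift (freeLift R (P.prodDeg Q) y hy) (by
    change ∀ k : Fin (P.M + Q.M), freeLift R (P.prodDeg Q) y hy (P.prodRel Q k) = 0
    intro k
    refine Fin.addCases (fun k => ?_) (fun k => ?_) k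
    · rw [prodRel, Fin.append_left]
      refine (AlgHom.congr_fun hl (P.rel k)).trans ?_
      rw [AlgHom.comp_apply, (P.proj_eq_zero_iff _).2 (TwoSidedIdeal.subset_span ⟨k, rfl⟩),
        map_zero]
    · rw [prodRel, Fin.append_right]
      refine (AlgHom.congr_fun hr (Q.rel k)).trans ?_
      rw [AlgHom.comp_apply, (Q.proj_eq_zero_iff _).2 (TwoSidedIdeal.subset_span ⟨k, rfl⟩),
        map_zero])
  refine ⟨k, P.algHom_ext fun i => ?_, Q.algHom_ext fun i => ?_⟩
  · rw [AlgHom.comp_apply, inl_x]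
    exact (hk _).trans ((freeLift_gen R _ _ _ _).trans (hyl i))
  · rw [AlgHom.comp_apply, inr_x]
    exact (hk _).trans ((freeLift_gen R _ _ _ _).trans (hyr i))

/-- The linear map `B ⊗ A → B ⊔ A`. -/
def prodMap : B ⊗[K] A →ₗ[K] P.prod Q :=
  LinearMap.mul' K (P.prod Q) ∘ₗ
    TensorProduct.map (P.inl Q).hom.toLinearMap (P.inr Q).hom.toLinearMap

lemma prodMap_tmul (b : B) (a : A) :
    P.prodMap Q (b ⊗ₜ a) = (P.inl Q).hom b * (P.inr Q).hom a := rfl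

/-- Let the presented coproduct act on `B ⊗ A`; applying the action to `1 ⊗ 1` gives a left inverse.
-/
lemma prodMap_injective : Function.Injective (P.prodMap Q) := by
  obtain ⟨θ, hl, hr⟩ := P.exists_prodLift Q (Algebra.lsmul K K (B ⊗[K] A)) (coprodRight B A)
    fun i j => coprodRight_comm (P.x_homog i) (Q.x_homog j)
  have h : ∀ w, θ (P.prodMap Q w) (1 ⊗ₜ 1) = w := fun w => by
    induction w with
    | zero => simp
    | add x y hx hy => rw [map_add, map_add, LinearMap.add_apply, hx, hy]
    | tmul b a =>
      have h1 := AlgHom.congr_fun hl b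
      have h2 := AlgHom.congr_fun hr a
      rw [AlgHom.comp_apply] at h1 h2
      rw [prodMap_tmul, map_mul, h1, h2, Module.End.mul_apply, coprodRight_apply,
        coprodMul_right_one]
      change b • ((1 : B) ⊗ₜ[K] a) = b ⊗ₜ a
      rw [TensorProduct.smul_tmul', smul_eq_mul, mul_one]
  intro w w' hw
  rw [← h w, ← h w', hw]

/-- The image contains 1 and is stable under left multiplication by every generator. -/
lemma prodMap_surjective : Function.Surjective (P.prodMap Q) := by
  intro z
  refine (P.prodPres Q).induction (p := fun z => ∃ w, P.prodMap Q w = z) z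
    ⟨1 ⊗ₜ 1, by rw [prodMap_tmul, map_one, map_one, one_mul]⟩ ?_ ?_ ?_
  · rintro _ _ ⟨w, rfl⟩ ⟨w', rfl⟩; exact ⟨w + w', map_add _ _ _⟩
  · rintro c _ ⟨w, rfl⟩; exact ⟨c • w, map_smul _ _ _⟩
  · rintro i _ ⟨w, rfl⟩
    revert i
    refine Fin.addCases (fun i => ⟨P.x i • w, ?_⟩) (fun i => ⟨coprodMul B A (1 ⊗ₜ Q.x i) w, ?_⟩)
    · refine Eq.trans ?_ (congrArg (· * P.prodMap Q w) (P.inl_x Q i))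
      induction w with
      | zero => simp
      | add x y hx hy => simp only [smul_add, map_add, mul_add] at *; rw [hx, hy]
      | tmul b a =>
        rw [TensorProduct.smul_tmul', smul_eq_mul, prodMap_tmul, prodMap_tmul, map_mul, mul_assoc]
    · refine Eq.trans ?_ (congrArg (· * P.prodMap Q w) (P.inr_x Q i))
      refine tensor_homog_induction (K := K) (n := n) (P := fun w =>
        P.prodMap Q (coprodMul B A (1 ⊗ₜ Q.x i) w) = (P.inr Q).hom (Q.x i) * P.prodMap Q w) w
        (by simp) (fun x y hx hy => by simp only [map_add, mul_add, hx, hy])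
        fun p _ b a hb _ => ?_
      -- Moving a generator of `A` past `b` costs the same scalar in the presented algebra as in
      -- `coprodMul`.
      have hc := (P.prod Q).comm_homog ((P.inr Q).map_homog (Q.x_homog i)) ((P.inl Q).map_homog hb)
      change (P.inr Q).hom (Q.x i) * (P.inl Q).hom b =
        R.chi p (Q.deg i) • ((P.inl Q).hom b * (P.inr Q).hom (Q.x i)) at hc
      rw [coprodMul_homog _ _ (Q.x_homog i) hb, map_smul, prodMap_tmul, prodMap_tmul, ← mul_assoc,
        hc, one_mul, map_mul, smul_mul_assoc, mul_assoc]

end Presentation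

/-- Products of spaces: the function algebra of `X × Y` is `B ⊔ A`. -/
lemma exists_prod (X Y : ToricSpace R) :
    ∃ (Z : ToricSpace R) (p : Z ⟶ X) (q : Z ⟶ Y),
      (∀ (W : ToricSpace R) (f : W ⟶ X) (g : W ⟶ Y), ∃ h : W ⟶ Z, h ≫ p = f ∧ h ≫ q = g) ∧
      Function.Bijective (LinearMap.mul' K Z.alg ∘ₗ
        TensorProduct.map (pull p).hom.toLinearMap (pull q).hom.toLinearMap) := by
  obtain ⟨P⟩ := X.finPres
  obtain ⟨Q⟩ := Y.finPres
  refine ⟨⟨P.prod Q, ⟨P.prodPres Q⟩⟩, ofPull (P.inl Q), ofPull (P.inr Q), fun W f g => ?_,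
    P.prodMap_injective Q, P.prodMap_surjective Q⟩
  obtain ⟨k, hl, hr⟩ := P.exists_prodLift Q (pull f).hom (pull g).hom fun i j =>
    W.alg.comm_homog ((pull f).map_homog (P.x_homog i)) ((pull g).map_homog (Q.x_homog j))
  refine ⟨ofPull ⟨k, (P.prodPres Q).equivariant_of_gen k ?_⟩, ToricHom.ext hl, ToricHom.ext hr⟩
  change ∀ i : Fin (P.N + Q.N), IsHomog (K := K) (P.prodDeg Q i)
    (k (P.prodProj Q (gen R (P.prodDeg Q) i)))
  refine Fin.addCases (fun i => ?_) (fun i => ?_)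
  · rw [← P.inl_x, P.prodDeg_left]
    have h := AlgHom.congr_fun hl (P.x i)
    rw [AlgHom.comp_apply] at h
    rw [h]
    exact (pull f).map_homog (P.x_homog i)
  · rw [← P.inr_x, P.prodDeg_right]
    have h := AlgHom.congr_fun hr (Q.x i)
    rw [AlgHom.comp_apply] at h
    rw [h]
    exact (pull g).map_homog (Q.x_homog i)

/-! ### Infinitesimal perturbations of points -/

/-- The algebra map `B ⊔ A → C` with components `φ` and `y`. -/
def coprodDesc {A B C : ToricAlg R} (φ : ToricHom B C) (y : ToricHom A C) : B ⊗[K] A →ₗ[K] C :=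
  LinearMap.mul' K C ∘ₗ TensorProduct.map φ.hom.toLinearMap y.hom.toLinearMap

section Perturb

variable {A B C : ToricAlg R} (φ : ToricHom B C) (y : ToricHom A C)

lemma coprodDesc_tmul (b : B) (a : A) : coprodDesc φ y (b ⊗ₜ a) = φ.hom b * y.hom a := rfl

/-- The scalar in the product of `B ⊔ A` is the one by which `y(a)` and `φ(b')` commute in `C`. -/
lemma coprodDesc_mul (w w' : B ⊗[K] A) :
    coprodDesc φ y (coprodMul B A w w') = coprodDesc φ y w * coprodDesc φ y w' := by
  refine tensor_homog_induction (K := K) (n := n)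
    (P := fun w => coprodDesc φ y (coprodMul B A w w') = coprodDesc φ y w * coprodDesc φ y w') w
    (by simp) (fun x y hx hy => by simp only [map_add, LinearMap.add_apply, add_mul, hx, hy])
    fun m p b a _ ha => ?_
  refine tensor_homog_induction (K := K) (n := n)
    (P := fun w' => coprodDesc φ y (coprodMul B A (b ⊗ₜ a) w') =
      coprodDesc φ y (b ⊗ₜ a) * coprodDesc φ y w') w'
    (by simp) (fun x y hx hy => by simp only [map_add, mul_add, hx, hy])
    fun m' p' b' a' hb' _ => ?_
  have hc := C.comm_homog (y.map_homog ha) (φ.map_homog hb')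
  change y.hom a * φ.hom b' = R.chi m' p • (φ.hom b' * y.hom a) at hc
  have hr : φ.hom b * y.hom a * (φ.hom b' * y.hom a') =
      R.chi m' p • (φ.hom b * φ.hom b' * (y.hom a * y.hom a')) := by
    rw [mul_assoc (φ.hom b), ← mul_assoc (y.hom a), hc, smul_mul_assoc, mul_smul_comm, mul_assoc,
      mul_assoc]
  rw [coprodMul_homog _ _ ha hb', map_smul, coprodDesc_tmul, coprodDesc_tmul, coprodDesc_tmul,
    map_mul, map_mul, hr]

lemma coprodDesc_equivariant : IsEquivariant (K := K) (n := n) (coprodDesc φ y) := by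
  refine isEquivariant_of_homog fun m w hw => ?_
  have key : comp K m (coprodDesc φ y w) = coprodDesc φ y (comp K m w) := by
    refine tensor_homog_induction (K := K) (n := n)
      (P := fun w => comp K m (coprodDesc φ y w) = coprodDesc φ y (comp K m w)) w
      (by simp) (fun x y hx hy => by simp only [map_add, hx, hy]) fun p q b a hb ha => ?_
    have h := C.mul_homog (φ.map_homog hb) (y.map_homog ha)
    rw [comp_of_homog (hb.tmul ha), coprodDesc_tmul]
    refine (comp_of_homog h m).trans ?_
    split_ifs
    · rfl
    · exact (map_zero _).symm
  rw [hw.comp_eq] at key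
  rw [← key]
  exact comp_homog _ _

lemma coprodDesc_comp {C' : ToricAlg R} (k : ToricHom C C') (w : B ⊗[K] A) :
    coprodDesc (k.comp φ) (k.comp y) w = k.hom (coprodDesc φ y w) := by
  induction w with
  | zero => simp
  | add x y hx hy => simp only [map_add, hx, hy]
  | tmul b a => exact (map_mul k.hom _ _).symm

lemma coprodDesc_rTensor {B' : ToricAlg R} (k : ToricHom B' B) (w : B' ⊗[K] A) :
    coprodDesc φ y (k.hom.toLinearMap.rTensor A w) = coprodDesc (φ.comp k) y w := by
  induction w with
  | zero => simp
  | add x y hx hy => simp only [map_add, hx, hy]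
  | tmul b a => rfl

variable {e : C} (he : IsHomog (K := K) (0 : Wt n) e) (h2 : e * e = 0) (v : hDer A B)

/-- The point `a ↦ y(a) + e (φ ⊗ y)(v(a))`. -/
def perturb : ToricHom A C where
  hom := AlgHom.ofLinearMap
    (y.hom.toLinearMap + LinearMap.mulLeft K e ∘ₗ coprodDesc φ y ∘ₗ v.1)
    (by
      change y.hom 1 + e * coprodDesc φ y (v.1 1) = 1
      rw [hDer_one, map_zero, mul_zero, add_zero, map_one])
    (fun a a' => by
      change y.hom (a * a') + e * coprodDesc φ y (v.1 (a * a')) =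
        (y.hom a + e * coprodDesc φ y (v.1 a)) * (y.hom a' + e * coprodDesc φ y (v.1 a'))
      have hc := C.coinv_comm he
      rw [v.2.2, map_add, coprodDesc_mul, coprodDesc_mul, coprodDesc_tmul, coprodDesc_tmul,
        map_one, one_mul, one_mul, map_mul]
      generalize coprodDesc φ y (v.1 a) = p
      generalize coprodDesc φ y (v.1 a') = q
      -- The coinvariant `e` is central, so the quadratic term contains `e * e = 0`; the linear
      -- terms are the Leibniz rule.
      have h3 : e * p * (e * q) = 0 := by
        rw [hc p, mul_assoc, ← mul_assoc e, h2, zero_mul, mul_zero]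
      have h4 : y.hom a * (e * q) = e * (y.hom a * q) := by
        rw [← mul_assoc, ← hc, mul_assoc]
      rw [add_mul, mul_add (y.hom a), mul_add (e * p), h3, h4, add_zero, mul_add, mul_assoc e p]
      abel)
  equivariant := isEquivariant_of_homog fun m a ha => by
    change IsHomog m (y.hom a + e * coprodDesc φ y (v.1 a))
    have h := C.mul_homog he ((coprodDesc_equivariant φ y).map_homog (v.2.1.map_homog ha))
    rw [zero_add] at h
    exact IsHomog.add (y.map_homog ha) h

lemma perturb_apply (a : A) :
    (perturb φ y he h2 v).hom a = y.hom a + e * coprodDesc φ y (v.1 a) := rfl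

/-- Moving the base point changes the value by a multiple of `e`, which a further factor `e` kills.
-/
lemma mul_coprodDesc_perturb (w : B ⊗[K] A) :
    e * coprodDesc φ (perturb φ y he h2 v) w = e * coprodDesc φ y w := by
  induction w with
  | zero => simp
  | add x y hx hy => simp only [map_add, mul_add, hx, hy]
  | tmul b a =>
    have hc := C.coinv_comm he
    rw [coprodDesc_tmul, coprodDesc_tmul, perturb_apply, mul_add, mul_add, ← mul_assoc (φ.hom b) e,
      ← hc, mul_assoc e (φ.hom b), ← mul_assoc e e, h2, zero_mul, add_zero]

/-- To first order, perturbations compose by adding derivations; this makes them invertible. -/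
lemma perturb_perturb (v' : hDer A B) :
    perturb φ (perturb φ y he h2 v) he h2 v' = perturb φ y he h2 (v + v') := by
  refine ToricHom.ext (AlgHom.ext fun a => ?_)
  rw [perturb_apply, mul_coprodDesc_perturb, perturb_apply, perturb_apply, Submodule.coe_add,
    LinearMap.add_apply, map_add, mul_add, add_assoc]

lemma perturb_zero : perturb φ y he h2 0 = y :=
  ToricHom.ext (AlgHom.ext fun a => by
    rw [perturb_apply, Submodule.coe_zero, LinearMap.zero_apply, map_zero, mul_zero, add_zero])

end Perturb

/-! ### Derivations as infinitesimal automorphisms -/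

section Tangent

/-- The coordinate `d^*(ε)` of a point of `D`. -/
def dualValue {E : ToricSpace R} (d : E ⟶ dualSpace R) : E.alg := (pull d).hom (dualEps R)

lemma dualValue_homog {E : ToricSpace R} (d : E ⟶ dualSpace R) :
    IsHomog (K := K) (0 : Wt n) (dualValue d) := (pull d).map_homog (dual_homog _)

lemma dualValue_mul_self {E : ToricSpace R} (d : E ⟶ dualSpace R) :
    dualValue d * dualValue d = 0 := by
  have h : (dualEps R * dualEps R : dualAlg R) = 0 := DualNumber.eps_mul_eps
  exact (map_mul (pull d).hom _ _).symm.trans ((congrArg (pull d).hom h).trans (map_zero _))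

lemma dualValue_zeroPoint (E : ToricSpace R) : dualValue (zeroPoint E) = 0 := by
  change algebraMap K E.alg (TrivSqZeroExt.fst (DualNumber.eps : DualNumber K)) = 0
  simp

variable {X Y : ToricSpace R}

/-- The point `y^* + d^*(ε) (f^* ⊗ y^*) v` of `X`. -/
def perturbPoint (v : hDer X.alg Y.alg) {E : ToricSpace R} (f : E ⟶ Y) (d : E ⟶ dualSpace R)
    (y : E ⟶ X) : E ⟶ X :=
  ofPull (perturb (pull f) (pull y) (dualValue_homog d) (dualValue_mul_self d) v)

lemma perturbPoint_apply (v : hDer X.alg Y.alg) {E : ToricSpace R} (f : E ⟶ Y)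
    (d : E ⟶ dualSpace R) (y : E ⟶ X) (a : X.alg) :
    (pull (perturbPoint v f d y)).hom a = (pull y).hom a +
      dualValue d * coprodDesc (pull f) (pull y) (v.1 a) := rfl

lemma space_hom_ext {E : ToricSpace R} {y y' : E ⟶ X}
    (h : ∀ a, (pull y).hom a = (pull y').hom a) : y = y' :=
  ToricHom.ext (AlgHom.ext h)

lemma perturbPoint_comp (v : hDer X.alg Y.alg) {E E' : ToricSpace R} (k : E' ⟶ E) (f : E ⟶ Y)
    (d : E ⟶ dualSpace R) (y : E ⟶ X) :
    perturbPoint v (k ≫ f) (k ≫ d) (k ≫ y) = k ≫ perturbPoint v f d y := by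
  refine space_hom_ext fun a => ?_
  rw [perturbPoint_apply]
  refine Eq.trans ?_ (map_add (pull k).hom _ _).symm
  refine congrArg (_ + ·) (Eq.trans ?_ (map_mul (pull k).hom _ _).symm)
  exact congrArg (_ * ·) (coprodDesc_comp (pull f) (pull y) (pull k) _)

lemma perturbPoint_neg (v : hDer X.alg Y.alg) {E : ToricSpace R} (f : E ⟶ Y)
    (d : E ⟶ dualSpace R) (y : E ⟶ X) : perturbPoint (-v) f d (perturbPoint v f d y) = y := by
  refine (perturb_perturb (pull f) (pull y) (dualValue_homog d) (dualValue_mul_self d) v (-v)).trans ?_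
  exact (congrArg (perturb (pull f) (pull y) (dualValue_homog d) (dualValue_mul_self d))
    (add_neg_cancel v)).trans (perturb_zero _ _ _ _)

lemma perturbPoint_zeroPoint (v : hDer X.alg Y.alg) {E : ToricSpace R} (f : E ⟶ Y) (y : E ⟶ X) :
    perturbPoint v f (zeroPoint E) y = y := by
  refine space_hom_ext fun a => ?_
  rw [perturbPoint_apply, dualValue_zeroPoint, zero_mul, add_zero]

/-- The endomorphism of `X` over `E` defined by perturbing points. -/
def perturbEnd (v : hDer X.alg Y.alg) {E : ToricSpace R} (f : E ⟶ Y) (d : E ⟶ dualSpace R) :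
    (endObj X).obj (Opposite.op E) where
  app _ h := ↾fun y => perturbPoint v (h.unop ≫ f) (h.unop ≫ d) y
  naturality {_ _} k h := ConcreteCategory.hom_ext _ _ fun y =>
    perturbPoint_comp v k.unop (h.unop ≫ f) (h.unop ≫ d) y

lemma perturbEnd_comp_neg (v : hDer X.alg Y.alg) {E : ToricSpace R} (f : E ⟶ Y)
    (d : E ⟶ dualSpace R) :
    Functor.HomObj.comp (perturbEnd v f d) (perturbEnd (-v) f d) = Functor.HomObj.id _ :=
  Functor.functorHom_ext fun _ h => ConcreteCategory.hom_ext _ _ fun y =>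
    perturbPoint_neg v (h.unop ≫ f) (h.unop ≫ d) y

/-- The automorphism of `X` over `E` defined by perturbing points. -/
def perturbAut (v : hDer X.alg Y.alg) {E : ToricSpace R} (f : E ⟶ Y) (d : E ⟶ dualSpace R) :
    (autSub X).toFunctor.obj (Opposite.op E) :=
  ⟨perturbEnd v f d, perturbEnd (-v) f d, perturbEnd_comp_neg v f d, by
    have h := perturbEnd_comp_neg (-v) f d
    rwa [show - -v = v from neg_neg v] at h⟩

/-- The tangent vector at the identity of `Aut(X)` defined by a derivation. -/
def tangentOfDer (v : hDer X.alg Y.alg) : (tangentAut X).toFunctor.obj (Opposite.op Y) :=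
  ⟨{ app := fun _ f => ↾fun d => perturbAut v f.unop d.down
     naturality := fun _ _ => ConcreteCategory.hom_ext _ _ fun _ => rfl },
    -- The fibre condition: at the zero point of `D` the parameter `ε` is zero, so no point moves.
    Subtype.ext (Functor.functorHom_ext fun _ h => ConcreteCategory.hom_ext _ _ fun y => by
      refine Eq.trans ?_ (perturbPoint_zeroPoint v (h.unop ≫ 𝟙 Y) y)
      exact congrArg (fun d => perturbPoint v (h.unop ≫ 𝟙 Y) d y) (zeroPoint_comp h.unop))⟩

lemma tangentAutEval_tangentOfDer (v : hDer X.alg Y.alg) {E E' : ToricSpace R} (f : E ⟶ Y)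
    (d : E ⟶ dualSpace R) (h : E' ⟶ E) (x : E' ⟶ X) :
    tangentAutEval (tangentOfDer v) f d h x = perturbPoint v (h ≫ f) (h ≫ d) x := rfl

lemma tangentAut_ext {g g' : (tangentAut X).toFunctor.obj (Opposite.op Y)}
    (h : ∀ (E E' : ToricSpace R) (f : E ⟶ Y) (d : E ⟶ dualSpace R) (h : E' ⟶ E) (x : E' ⟶ X),
      tangentAutEval g f d h x = tangentAutEval g' f d h x) : g = g' :=
  Subtype.ext (Functor.functorHom_ext fun _ f => ConcreteCategory.hom_ext _ _ fun d =>
    Subtype.ext (Functor.functorHom_ext fun _ k => ConcreteCategory.hom_ext _ _ fun x =>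
      h _ _ f.unop d.down k.unop x))

/-- Naturality in the stage `E` of the pair `(f, d)`. -/
lemma tangentAutEval_comp (g : (tangentAut X).toFunctor.obj (Opposite.op Y)) {E E' E'' : ToricSpace R}
    (k : E' ⟶ E) (f : E ⟶ Y) (d : E ⟶ dualSpace R) (h : E'' ⟶ E') (x : E'' ⟶ X) :
    tangentAutEval g (k ≫ f) (k ≫ d) h x = tangentAutEval g f d (h ≫ k) x := by
  have h1 := ConcreteCategory.congr_hom (g.1.naturality k.op f.op) ⟨d⟩
  exact congrArg (fun z : (autSub X).toFunctor.obj (Opposite.op E') =>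
    (z.1.app (Opposite.op E'') h.op) x) h1

/-- Naturality in the stage `E'` of the point of `X`. With `tangentAutEval_comp`, it reduces all
values to the one at the generic point. -/
lemma tangentAutEval_naturality (g : (tangentAut X).toFunctor.obj (Opposite.op Y))
    {E E' E'' : ToricSpace R} (f : E ⟶ Y) (d : E ⟶ dualSpace R) (k : E'' ⟶ E') (h : E' ⟶ E)
    (x : E' ⟶ X) :
    tangentAutEval g f d (k ≫ h) (k ≫ x) = k ≫ tangentAutEval g f d h x :=
  ConcreteCategory.congr_hom ((g.1.app (Opposite.op E) f.op ⟨d⟩).1.naturality k.op h.op) x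

/-- The fibre condition is stated over `Y` only; `tangent_restrict` carries it along `f`. -/
lemma tangentAutEval_zeroPoint (g : (tangentAut X).toFunctor.obj (Opposite.op Y))
    {E E' : ToricSpace R} (f : E ⟶ Y) (h : E' ⟶ E) (x : E' ⟶ X) :
    tangentAutEval g f (zeroPoint E) h x = x := by
  have h1 := tangent_restrict (autSub X).toFunctor f.op g.1
  have h2 : g.1.app (Opposite.op Y) (𝟙 _) ⟨zeroPoint Y⟩ = autOne X (Opposite.op Y) := g.2
  have h3 := h1.trans (congrArg ((autSub X).toFunctor.map f.op) h2)
  exact congrArg (fun z : (autSub X).toFunctor.obj (Opposite.op E) =>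
    (z.1.app (Opposite.op E') h.op) x) h3

lemma tangentOfDer_map (v : hDer X.alg Y.alg) {Z : ToricSpace R} (k : Z ⟶ Y) :
    tangentOfDer (hDerMap (pull k) v) = (tangentAut X).toFunctor.map k.op (tangentOfDer v) :=
  tangentAut_ext fun _ _ f d h x => space_hom_ext fun a =>
    congrArg (fun z => (pull x).hom a + dualValue (h ≫ d) * z)
      (coprodDesc_rTensor (pull (h ≫ f)) (pull x) (pull k) (v.1 a))

end Tangent

/-! ### The generic points -/

/-- `K[ε] ⊗ W = W ⊕ ε W`, which makes the coefficient of `ε` well defined. -/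
lemma dualNumber_tensor_bijective (W : Type u) [AddCommGroup W] [Module K W] :
    Function.Bijective ((TensorProduct.mk K (DualNumber K) W 1).coprod
      (TensorProduct.mk K (DualNumber K) W DualNumber.eps)) := by
  let g : (W × W) ≃ₗ[K] (DualNumber K) ⊗[K] W :=
    ((TensorProduct.lid K W).prodCongr (TensorProduct.lid K W)).symm ≪≫ₗ
      (TensorProduct.prodLeft K K K K W).symm
  have h : ((TensorProduct.mk K (DualNumber K) W 1).coprod
      (TensorProduct.mk K (DualNumber K) W DualNumber.eps)) = g.toLinearMap := by
    refine LinearMap.ext fun w => ?_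
    refine (LinearEquiv.symm_apply_eq (TensorProduct.prodLeft K K K K W)).2 ?_ |>.symm
    refine (Prod.ext ?_ ?_ : _ = (_, _))
    · change 1 ⊗ₜ w.1 = (1 : K) ⊗ₜ[K] w.1 + (0 : K) ⊗ₜ w.2
      rw [TensorProduct.zero_tmul, add_zero]
    · change 1 ⊗ₜ w.2 = (0 : K) ⊗ₜ[K] w.1 + (1 : K) ⊗ₜ w.2
      rw [TensorProduct.zero_tmul, zero_add]
  rw [h]
  exact g.bijective

section Generic

variable {X Y : ToricSpace R}

/-- The linear map `(w₀, w₁) ↦ (f^* ⊗ y^*) w₀ + d^*(ε) (f^* ⊗ y^*) w₁`. -/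
def perturbMap {E : ToricSpace R} (f : E ⟶ Y) (d : E ⟶ dualSpace R) (y : E ⟶ X) :
    (Y.alg ⊗[K] X.alg) × (Y.alg ⊗[K] X.alg) →ₗ[K] E.alg :=
  (coprodDesc (pull f) (pull y)).coprod
    (LinearMap.mulLeft K (dualValue d) ∘ₗ coprodDesc (pull f) (pull y))

lemma perturbMap_apply {E : ToricSpace R} (f : E ⟶ Y) (d : E ⟶ dualSpace R) (y : E ⟶ X)
    (w w' : Y.alg ⊗[K] X.alg) : perturbMap f d y (w, w') =
      coprodDesc (pull f) (pull y) w + dualValue d * coprodDesc (pull f) (pull y) w' := rfl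

variable (X Y) in
/-- The generic points of `D × Y` and of `D × Y × X`. -/
lemma exists_generic : ∃ (E E' : ToricSpace R) (d : E ⟶ dualSpace R) (f : E ⟶ Y) (h : E' ⟶ E)
    (x : E' ⟶ X),
    (∀ (W : ToricSpace R) (d' : W ⟶ dualSpace R) (f' : W ⟶ Y), ∃ k : W ⟶ E, k ≫ d = d' ∧ k ≫ f = f') ∧
    (∀ (W : ToricSpace R) (h' : W ⟶ E) (x' : W ⟶ X), ∃ k : W ⟶ E', k ≫ h = h' ∧ k ≫ x = x') ∧
    Function.Bijective (perturbMap (h ≫ f) (h ≫ d) x) := by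
  obtain ⟨E, d, f, hE, hb⟩ := exists_prod (dualSpace R) Y
  obtain ⟨E', h, x, hE', hb'⟩ := exists_prod E X
  refine ⟨E, E', d, f, h, x, hE, hE', ?_⟩
  let m : DualNumber K ⊗[K] Y.alg →ₗ[K] E.alg := coprodDesc (pull d) (pull f)
  let m' : E.alg ⊗[K] X.alg →ₗ[K] E'.alg := coprodDesc (pull h) (pull x)
  let e : DualNumber K ⊗[K] Y.alg ≃ₗ[K] E.alg := LinearEquiv.ofBijective m hb
  -- The chain `K[ε] ⊗ (B ⊗ A) ≅ (K[ε] ⊗ B) ⊗ A ≅ E ⊗ A ≅ E'`.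
  let g := (TensorProduct.assoc K (DualNumber K) Y.alg X.alg).symm ≪≫ₗ
    TensorProduct.congr e (LinearEquiv.refl K X.alg) ≪≫ₗ LinearEquiv.ofBijective m' hb'
  have hg : ∀ (c : DualNumber K) (w : Y.alg ⊗[K] X.alg), g (c ⊗ₜ w) =
      (pull h).hom ((pull d).hom c) * coprodDesc (pull (h ≫ f)) (pull x) w := fun c w => by
    induction w with
    | zero => simp
    | add w w' hw hw' => rw [TensorProduct.tmul_add, map_add, hw, hw', map_add, mul_add]
    | tmul b a =>
      refine Eq.trans ?_ (mul_assoc _ _ _)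
      exact congrArg (· * (pull x).hom a) (map_mul (pull h).hom _ _)
  have key : perturbMap (h ≫ f) (h ≫ d) x = g.toLinearMap ∘ₗ
      ((TensorProduct.mk K (DualNumber K) (Y.alg ⊗[K] X.alg) 1).coprod
      (TensorProduct.mk K (DualNumber K) (Y.alg ⊗[K] X.alg) DualNumber.eps)) := by
    refine LinearMap.ext fun w => ?_
    refine Eq.trans ?_ (map_add g _ _).symm
    refine Eq.trans ?_ (congrArg₂ _ (hg _ _) (hg _ _)).symm
    refine congrArg (fun z : E'.alg => z + _) ?_
    refine (one_mul _).symm.trans (congrArg (fun z : E'.alg => z * _) ?_)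
    exact ((congrArg (pull h).hom (map_one (pull d).hom)).trans (map_one _)).symm
  rw [key]
  exact g.bijective.comp (dualNumber_tensor_bijective _)

/-- At the generic point the coefficient of `ε` is the derivation itself. -/
lemma tangentOfDer_injective : Function.Injective
    (tangentOfDer : hDer X.alg Y.alg → (tangentAut X).toFunctor.obj (Opposite.op Y)) := by
  intro v v' hv
  obtain ⟨E, E', d, f, h, x, -, -, hb⟩ := exists_generic X Y
  refine Subtype.ext (LinearMap.ext fun a => ?_)
  have h1 := congrArg (fun g => (pull (tangentAutEval g f d h x)).hom a) hv
  have h2 : perturbMap (h ≫ f) (h ≫ d) x (1 ⊗ₜ a, v.1 a) =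
      perturbMap (h ≫ f) (h ≫ d) x (1 ⊗ₜ a, v'.1 a) := by
    rw [perturbMap_apply, perturbMap_apply, coprodDesc_tmul, map_one, one_mul]
    exact h1
  exact congrArg Prod.snd (hb.1 h2)

variable {E : ToricSpace R} {f : E ⟶ Y} {d : E ⟶ dualSpace R} {x : E ⟶ X}

/-- A point of `X` that agrees with the generic one to zeroth order is a perturbation of it. -/
lemma exists_der_of_point (hb : Function.Bijective (perturbMap f d x)) (u : E ⟶ X)
    (w : X.alg →ₗ[K] Y.alg ⊗[K] X.alg) (hw : ∀ a, (pull u).hom a =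
      (pull x).hom a + dualValue d * coprodDesc (pull f) (pull x) (w a)) :
    ∃ v : hDer X.alg Y.alg, perturbPoint v f d x = u := by
  -- Multiplication by `ε` is injective on the copy of `B ⊗ A`, so both defining properties of
  -- `hDer` can be read off the coefficient of `ε`.
  have hinj : ∀ z z', dualValue d * coprodDesc (pull f) (pull x) z =
      dualValue d * coprodDesc (pull f) (pull x) z' → z = z' := fun z z' h => by
    have h2 : perturbMap f d x (0, z) = perturbMap f d x (0, z') := by
      rw [perturbMap_apply, perturbMap_apply, h]
    exact congrArg Prod.snd (hb.1 h2)
  have hc := E.alg.coinv_comm (dualValue_homog d)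
  have he := dualValue_mul_self d
  refine ⟨⟨w, isEquivariant_of_homog fun m a ha => ?_, fun a a' => ?_⟩,
    space_hom_ext fun a => (hw a).symm⟩
  · have h1 : dualValue d * coprodDesc (pull f) (pull x) (w a) =
        (pull u).hom a - (pull x).hom a := by rw [hw, add_sub_cancel_left]
    have h2 : IsHomog (K := K) m (dualValue d * coprodDesc (pull f) (pull x) (w a)) := by
      rw [h1, sub_eq_add_neg]
      exact IsHomog.add ((pull u).map_homog ha) (((pull x).map_homog ha).neg)
    have h3 : comp K m (w a) = w a := by
      have h4 := E.alg.comp_mul_left (dualValue_homog d) m (coprodDesc (pull f) (pull x) (w a))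
      rw [sub_zero, h2.comp_eq, ← (coprodDesc_equivariant (pull f) (pull x)).map_comp] at h4
      exact hinj _ _ h4.symm
    rw [← h3]
    exact comp_homog _ _
  · refine hinj _ _ ?_
    have h := map_mul (pull u).hom a a'
    rw [hw, hw, hw, map_mul] at h
    rw [map_add, coprodDesc_mul, coprodDesc_mul, coprodDesc_tmul, coprodDesc_tmul,
      map_one, one_mul, one_mul]
    generalize coprodDesc (pull f) (pull x) (w a) = p at *
    generalize coprodDesc (pull f) (pull x) (w a') = q at *
    have h3 : dualValue d * p * (dualValue d * q) = 0 := by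
      rw [hc p, mul_assoc, ← mul_assoc (dualValue d), he, zero_mul, mul_zero]
    have h4 : (pull x).hom a * (dualValue d * q) = dualValue d * ((pull x).hom a * q) := by
      rw [← mul_assoc, ← hc, mul_assoc]
    -- Zeroth-order terms of the multiplicativity of `u` cancel, leaving the Leibniz rule multiplied
    -- by `ε`.
    rw [add_mul, mul_add ((pull x).hom a), mul_add (dualValue d * p), h3, h4, add_zero, add_assoc,
      add_right_inj] at h
    rw [h, mul_add, mul_assoc, add_comm]

/-- Evaluate `g` at the generic point. The fibre condition fixes the part of order zero, the part of
order one is a derivation, and naturality carries the equality to all points. -/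
lemma tangentOfDer_surjective : Function.Surjective
    (tangentOfDer : hDer X.alg Y.alg → (tangentAut X).toFunctor.obj (Opposite.op Y)) := by
  intro g
  obtain ⟨E, E', d, f, h, x, hE, hE', hb⟩ := exists_generic X Y
  let N := LinearEquiv.ofBijective (perturbMap (h ≫ f) (h ≫ d) x) hb
  let u : E' ⟶ X := tangentAutEval g f d h x
  let w : X.alg →ₗ[K] (Y.alg ⊗[K] X.alg) × (Y.alg ⊗[K] X.alg) :=
    N.symm.toLinearMap ∘ₗ (pull u).hom.toLinearMap
  have hw : ∀ a, (pull u).hom a = coprodDesc (pull (h ≫ f)) (pull x) (w a).1 +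
      dualValue (h ≫ d) * coprodDesc (pull (h ≫ f)) (pull x) (w a).2 :=
    fun a => (N.apply_symm_apply ((pull u).hom a)).symm
  -- The self-map of `D × Y` that sets the `D`-coordinate to zero; the next line lifts it to `D × Y
  -- × X` without changing `X`.
  obtain ⟨k, hkd, hkf⟩ := hE E (zeroPoint E) f
  obtain ⟨k', hkh, hkx⟩ := hE' E' (h ≫ k) x
  have hu : k' ≫ u = x := by
    change k' ≫ tangentAutEval g f d h x = x
    rw [← tangentAutEval_naturality, hkh, hkx, ← tangentAutEval_comp, hkd, hkf,
      tangentAutEval_zeroPoint]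
  have hf : k' ≫ h ≫ f = h ≫ f := by
    rw [← Category.assoc, hkh, Category.assoc, hkf]
  have hd : k' ≫ h ≫ d = zeroPoint E' := by
    rw [← Category.assoc, hkh, Category.assoc, hkd, zeroPoint_comp]
  -- The retraction `k'` fixes the coordinates of `Y` and `X`, hence the copy of `B ⊗ A`.
  have hk : ∀ z, (pull k').hom (coprodDesc (pull (h ≫ f)) (pull x) z) =
      coprodDesc (pull (h ≫ f)) (pull x) z := fun z => by
    refine (coprodDesc_comp (pull (h ≫ f)) (pull x) (pull k') z).symm.trans ?_
    change coprodDesc (pull (k' ≫ h ≫ f)) (pull (k' ≫ x)) z = _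
    rw [hf, hkx]
  -- Pulling back along `k'` sets `ε` to zero and isolates the order-zero part of `u`, which the
  -- fibre condition identifies with `x`.
  have h0 : ∀ a, coprodDesc (pull (h ≫ f)) (pull x) (w a).1 = (pull x).hom a := fun a => by
    have h1 : (pull k').hom ((pull u).hom a) = (pull x).hom a :=
      congrArg (fun z => (pull z).hom a) hu
    have h2 : (pull k').hom (dualValue (h ≫ d)) = 0 :=
      (congrArg dualValue hd).trans (dualValue_zeroPoint E')
    rw [← h1, hw, map_add, map_mul, h2, zero_mul, add_zero, hk]
  obtain ⟨v, hv⟩ := exists_der_of_point hb u (LinearMap.snd K _ _ ∘ₗ w) fun a => by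
    rw [hw, h0]; rfl
  refine ⟨v, tangentAut_ext fun F F' f' d' h' x' => ?_⟩
  obtain ⟨l, hld, hlf⟩ := hE F d' f'
  obtain ⟨l', hlh, hlx⟩ := hE' F' (h' ≫ l) x'
  -- Every value is a pullback of the value at the generic point.
  have h1 : ∀ g', tangentAutEval g' f' d' h' x' = l' ≫ tangentAutEval g' f d h x := fun g' => by
    rw [← tangentAutEval_naturality, hlh, hlx, ← tangentAutEval_comp, hld, hlf]
  rw [h1, h1, tangentAutEval_tangentOfDer, hv]

variable (X) in
/-- Infinitesimal automorphisms of `X` are derivations. -/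
def tangentAutIso : (tangentAut X).toFunctor ≅
    hDerAb X.alg ⋙ forget AddCommGrpCat.{u} ⋙ uliftFunctor.{u + 1} :=
  (NatIso.ofComponents (fun Y => (Equiv.ulift.trans (Equiv.ofBijective
    (tangentOfDer : hDer X.alg Y.unop.alg → (tangentAut X).toFunctor.obj Y)
    ⟨tangentOfDer_injective, tangentOfDer_surjective⟩)).toIso)
    fun k => ConcreteCategory.hom_ext _ _ fun v => tangentOfDer_map v.down k.unop).symm

lemma tangentOfDer_tangentAutIso (g : (tangentAut X).toFunctor.obj (Opposite.op Y)) :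
    tangentOfDer ((tangentAutIso X).hom.app (Opposite.op Y) g).down = g :=
  (Equiv.ofBijective (tangentOfDer : hDer X.alg Y.alg → _)
    ⟨tangentOfDer_injective, tangentOfDer_surjective⟩).apply_symm_apply g

lemma tangentAutEval_apply (g : (tangentAut X).toFunctor.obj (Opposite.op Y)) {E E' : ToricSpace R}
    (f : E ⟶ Y) (d : E ⟶ dualSpace R) (h : E' ⟶ E) (x : E' ⟶ X) (a : X.alg) :
    (pull (tangentAutEval g f d h x)).hom a = (pull x).hom a +
      dualValue (h ≫ d) * coprodDesc (pull (h ≫ f)) (pull x)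
        (((tangentAutIso X).hom.app (Opposite.op Y) g).down.1 a) := by
  conv_lhs => rw [← tangentOfDer_tangentAutIso g]
  rfl

end Generic

end Toric

end

/-! ### The main theorem -/

theorem mainTheorem1 {K : Type u} [Field K] {n : ℕ} (R : Toric.Cotriangular K n)
    (A : Toric.ToricAlg R) (P : Toric.Presentation A) :
    (∃ (hK : Presheaf.IsSheaf (Toric.zariskiTopology R) (Toric.lineRing R))
      (hj : Presheaf.IsSheaf (Toric.zariskiTopology R) (Toric.jMod P.der R).presheaf)
      (hD : Presheaf.IsSheaf (Toric.zariskiTopology R) (Toric.hDerMod A).presheaf),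
      IsIso (P.xiSheaf hK hj hD)) ∧
    ∃ Φ : (Toric.tangentAut (⟨A, ⟨P⟩⟩ : Toric.ToricSpace R)).toFunctor ≅
        Toric.hDerAb A ⋙ forget AddCommGrpCat.{u} ⋙ uliftFunctor.{u + 1},
      ∀ (Y E E' : Toric.ToricSpace R)
        (g : (Toric.tangentAut (⟨A, ⟨P⟩⟩ : Toric.ToricSpace R)).toFunctor.obj (Opposite.op Y))
        (f : E ⟶ Y) (d : E ⟶ Toric.dualSpace R) (h : E' ⟶ E)
        (x : E' ⟶ (⟨A, ⟨P⟩⟩ : Toric.ToricSpace R)) (a : A),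
        Toric.pull (Toric.tangentAutEval g f d h x) a =
          Toric.pull x a + Toric.pull h (Toric.pull d (Toric.dualEps R)) *
            LinearMap.mul' K E'.alg (TensorProduct.map (Toric.pull (h ≫ f)).hom.toLinearMap
              (Toric.pull x).hom.toLinearMap ((Φ.hom.app (Opposite.op Y) g).down.1 a)) := by
  refine ⟨⟨Toric.isSheaf_lineRing, Toric.isSheaf_jMod P.der, P.isSheaf_hDerMod,
    P.isIso_xiSheaf _ _ _⟩, Toric.tangentAutIso _, fun Y E E' g f d h x a => ?_⟩
  exact Toric.tangentAutEval_apply g f d h x a
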